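/- **Theorem (Stochastic Fourier integral operators).** Let $X\subset\mathbb R^{n_X}$, $Y\subset\mathbb R^{n_Y}$ be open, $\Xi=\mathbb R^{N}\setminus\{0\}$, $\alpha>0$, $d\in\mathbb R$, $0<\varrho\le 1$, $0\le\delta<1$. For an open set $Z\subset\mathbb R^n$ let $K_{Z,m}=\{z\in Z:\|z\|\le m,\ \operatorname{dist}(z,\mathbb R^n\setminus Z)\ge 1/m\}$ (the distance to $\emptyset$ being $\infty$), and $\langle\xi\rangle=(1+\|\xi\|^2)^{1/2}$. *Phase functions.* $\mathcal M_{hg}(X,Y,\Xi)$ is the space of smooth functions $\Phi:X\times Y\times\Xi\to\mathbb R$ that are positively homogeneous of degree $1$ in $\xi$, with the topology of the seminorms $$p_m(\Phi)=\sup\{|\partial_x^j\partial_y^k\partial_\xi^l\Phi(x,y,\xi)|: x\in K_{X,m},\,y\in K_{Y,m},\,\|\xi\|=1,\,|j|+|k|+|l|\le m\}.$$ $\mathcal M_\alpha$ is its subspace of all $\Phi$ such that, for all $(x,y,\xi)\in X\times Y\times\Xi$, $$\|\xi\|^{-2}\|\nabla_x\Phi\|^2+\|\nabla_\xi\Phi\|^2\ge\alpha\quad\text{and}\quad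 \|\xi\|^{-2}\|\nabla_y\Phi\|^2+\|\nabla_\xi\Phi\|^2\ge\alpha .$$ *Amplitudes.* $\mathcal S^d_{\varrho,\delta}$ is the space of restrictions to $X\times Y\times\Xi$ of the Hörmander symbols $a\in S^d_{\varrho,\delta}(X\times Y\times\mathbb R^N)$ (smooth complex functions such that for all multi-indices $j,k,l$ and all compact $K\subset X\times Y$ there is $C$ with $|\partial_x^j\partial_y^k\partial_\xi^l a(x,y,\xi)|\le C\langle\xi\rangle^{d-\varrho|l|+\delta(|j|+|k|)}$ for $(x,y)\in K$, $\xi\in\mathbb R^N$), with the topology of the seminorms $$q_m(a)=\sup\{\langle\xi\rangle^{-d+\varrho|l|-\delta(|j|+|k|)}|\partial_x^j\partial_y^k\partial_\xi^la(x,y,\xi)|: x\in K_{X,m},\,y\in K_{Y,m},\,\xi\in\Xi,\,|j|+|k|+|l|\le m\}.$$ *Oscillatory integrals.* Fix $\chi\in\mathcal D(\mathbb R^N)$ with $\chi(\xi)=1$ for $\|\xi\|<1$ and $\chi(\xi)=0$ for $\|\xi\|>2$. For a phase $\Phi(y,\xi)$ on $Y\times\Xi$ put $r=\|\xi\|^2\|\nabla_\xi\Phi\|^2+\|\nabla_y\Phi\|^2$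 and $$Lf=-\sum_{l}\partial_{\xi_l}\Big(\tfrac{-i}{r}(1-\chi)\|\xi\|^2(\partial_{\xi_l}\Phi) f\Big)-\sum_k\partial_{y_k}\Big(\tfrac{-i}{r}(1-\chi)(\partial_{y_k}\Phi) f\Big)+\chi f .$$ The oscillatory integral $\int_\Xi\int_Y e^{i\Phi}f\,dy\,d\xi$ exists and equals $I$ if for all sufficiently large $\kappa\in\mathbb N$ the function $e^{i\Phi}L^\kappa f$ is absolutely integrable on $Y\times\Xi$ and $\int_\Xi\int_Y e^{i\Phi}L^\kappa f\,dy\,d\xi=I$. *Operators.* For $\psi\in\mathcal D(Y)$ and $\phi\in\mathcal D(X)$, in the sense of oscillatory integrals in $(y,\xi)$ for fixed $x\in X$, respectively in $(x,\xi)$ for fixed $y\in Y$ (with $x$ in place of $y$ and $X$ in place of $Y$ in the definition of $L$), $$A_{\Phi,a}[\psi](x)=(2\pi)^{-N}\int_\Xi\int_Y e^{i\Phi(x,y,\xi)}a(x,y,\xi)\psi(y)\,dy\,d\xi,\qquad {}^{t}\!A_{\Phi,a}[\phi](y)=(2\pi)^{-N}\int_\Xi\int_X e^{i\Phi(x,y,\xi)}a(x,y,\xi)\phi(x)\,dx\,d\xi,$$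 and for $u\in\mathcal E'(Y)$ (the dual of $C^\infty(Y)$), $\langle A_{\Phi,a}[u],\phi\rangle=\langle u,{}^{t}\!A_{\Phi,a}[\phi]\rangle$. The space $C^\infty(X)$ carries the topology of the seminorms $\pi_{X,m}(v)=\sup\{|\partial^jv(x)|:x\in K_{X,m},|j|\le m\}$ (and likewise $C^\infty(Y)$), and $\mathcal D'(X)$, the dual of the LF-space $\mathcal D(X)$, carries the weak-$*$ topology. All spaces carry their Borel $\sigma$-algebras. *Statement.* Let $\Omega$ be a measurable space (for instance, the one underlying a probability space), and let $\omega\mapsto\Phi_\omega\in\mathcal M_\alpha$ and $\omega\mapsto a_\omega\in\mathcal S^d_{\varrho,\delta}$ be measurable maps. Then: 1. for every fixed $\psi\in\mathcal D(Y)$ the oscillatory integrals $A_{\Phi_\omega,a_\omega}[\psi](x)$, $x\in X$, exist and define elements of $C^\infty(X)$, and the map $\Omega\to C^\infty(X)$, $\omega\mapsto A_{\Phi_\omega,a_\omega}[\psi]$, is Borel measurable; 2. for every fixed $u\in\mathcal E'(Y)$, ${}^{t}\!A_{\Phi_\omega,a_\omega}[\phi]$ exists and belongs to $C^\infty(Y)$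 for every $\phi\in\mathcal D(X)$, $A_{\Phi_\omega,a_\omega}[u]$ belongs to $\mathcal D'(X)$, and the map $\Omega\to\mathcal D'(X)$, $\omega\mapsto A_{\Phi_\omega,a_\omega}[u]$, is Borel measurable. -/

import Mathlib

open Set TopologicalSpace MeasureTheory Filter
open scoped Distributions ENNReal

noncomputable section

namespace SFIO

open scoped ContDiff

/-- `ℝⁿ` with its Euclidean norm. -/
abbrev Euc (n : ℕ) : Type := EuclideanSpace ℝ (Fin n)

/-! ### Smooth functions on an open set

A function on an open set `U` is represented by the function on the whole space that extends it
by zero. All derivatives are taken at points of `U`, so they depend on the values in `U` only. -/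

section Smooth

variable {E : Type*} [NormedAddCommGroup E] [NormedSpace ℝ E]

/-- The smooth `𝕜`-valued functions on the open set `U`, extended by zero. -/
def smoothOn (𝕜 : Type) [RCLike 𝕜] (U : Opens E) : Submodule 𝕜 (E → 𝕜) where
  carrier := {f | ContDiffOn ℝ ∞ f U ∧ ∀ p ∉ U, f p = 0}
  add_mem' := by
    rintro f g ⟨hf, hf0⟩ ⟨hg, hg0⟩
    exact ⟨hf.add hg, fun p hp => by simp [hf0 p hp, hg0 p hp]⟩
  zero_mem' := ⟨contDiffOn_const, fun _ _ => rfl⟩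
  smul_mem' := by
    rintro c f ⟨hf, hf0⟩
    exact ⟨hf.const_smul c, fun p hp => by simp [hf0 p hp]⟩

theorem smoothOn_contDiffAt {𝕜 : Type} [RCLike 𝕜] {U : Opens E} {f : E → 𝕜}
    (hf : f ∈ smoothOn 𝕜 U) {p : E} (hp : p ∈ U) (k : ℕ) : ContDiffAt ℝ k f p :=
  (hf.1.contDiffAt (U.isOpen.mem_nhds hp)).of_le (by exact_mod_cast le_top)

/-- The iterated derivative `f ↦ ∂_{v₁} ⋯ ∂_{v_k} f (p)` at a point `p` of `U`, as a linear
functional of the smooth function `f`. -/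
def derivAt (𝕜 : Type) [RCLike 𝕜] (U : Opens E) (p : U) {k : ℕ} (v : Fin k → E) :
    smoothOn 𝕜 U →ₗ[𝕜] 𝕜 where
  toFun f := iteratedFDeriv ℝ k f.1 p.1 v
  map_add' f g := by
    have := iteratedFDeriv_add_apply (smoothOn_contDiffAt f.2 p.2 k)
      (smoothOn_contDiffAt g.2 p.2 k)
    simp [this]
  map_smul' c f := by
    have := iteratedFDeriv_const_smul_apply (a := c) (smoothOn_contDiffAt f.2 p.2 k)
    simp [this]

theorem continuousOn_deriv {𝕜 : Type} [RCLike 𝕜] {U : Opens E} {f : E → 𝕜}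
    (hf : f ∈ smoothOn 𝕜 U) {k : ℕ} (v : Fin k → E) :
    ContinuousOn (fun p => iteratedFDeriv ℝ k f p v) U := by
  have h1 := hf.1.continuousOn_iteratedFDerivWithin (m := k) (by exact_mod_cast le_top)
    U.isOpen.uniqueDiffOn
  have h2 : ContinuousOn (iteratedFDeriv ℝ k f) U :=
    h1.congr fun p hp => (iteratedFDerivWithin_of_isOpen k U.isOpen hp).symm
  exact (continuous_eval_const v).comp_continuousOn h2

/-- The seminorm `f ↦ sup_i w i * |L i f|`, for a pointwise bounded weighted family of linear
functionals. -/
def supSeminorm {𝕜 V I : Type*} [RCLike 𝕜] [AddCommGroup V] [Module 𝕜 V] (w : I → ℝ)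
    (hw : ∀ i, 0 ≤ w i) (L : I → V →ₗ[𝕜] 𝕜)
    (hL : ∀ f, BddAbove (range fun i => w i * ‖L i f‖)) : Seminorm 𝕜 V :=
  Seminorm.ofSMulLE (fun f => ⨆ i, w i * ‖L i f‖) (by simp)
    (fun f g => by
      refine Real.iSup_le (fun i => ?_) (add_nonneg
        (Real.iSup_nonneg fun i => mul_nonneg (hw i) (norm_nonneg _))
        (Real.iSup_nonneg fun i => mul_nonneg (hw i) (norm_nonneg _)))
      calc w i * ‖L i (f + g)‖ ≤ w i * ‖L i f‖ + w i * ‖L i g‖ := by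
            rw [map_add, ← mul_add]
            exact mul_le_mul_of_nonneg_left (norm_add_le _ _) (hw i)
        _ ≤ _ := add_le_add (le_ciSup (hL f) i) (le_ciSup (hL g) i))
    (fun c f => by
      refine Real.iSup_le (fun i => ?_) (mul_nonneg (norm_nonneg _)
        (Real.iSup_nonneg fun i => mul_nonneg (hw i) (norm_nonneg _)))
      rw [map_smul, norm_smul, mul_left_comm]
      exact mul_le_mul_of_nonneg_left (le_ciSup (hL f) i) (norm_nonneg c))

theorem bddAbove_range_of_finite {I J : Type*} [Finite J] (g : I → ℝ) (π : I → J)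
    (h : ∀ j, ∃ C, ∀ i, π i = j → g i ≤ C) : BddAbove (range g) := by
  choose C hC using h
  obtain ⟨M, hM⟩ := (finite_range C).bddAbove
  exact ⟨M, by rintro _ ⟨i, rfl⟩; exact (hC _ i rfl).trans (hM ⟨_, rfl⟩)⟩

end Smooth

/-- A list of at most `m` coordinate indices; it stands for the partial derivative
`∂_{s 1} ⋯ ∂_{s k}` of order `k ≤ m`. -/
abbrev Multi (ι : Type) (m : ℕ) : Type := Σ k : Fin (m + 1), Fin k → ι

/-- The compact exhaustion `K_{Z,m} = {x ∈ Z : ‖x‖ ≤ m, dist(x, Zᶜ) ≥ 1/m}` of an open set `Z`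
(the distance to the empty set being `∞`). -/
def exhaustion {n : ℕ} (Z : Opens (Euc n)) (m : ℕ) : Set (Euc n) :=
  {x | x ∈ Z ∧ ‖x‖ ≤ m ∧ (m : ℝ≥0∞)⁻¹ ≤ Metric.infEDist x (Z : Set (Euc n))ᶜ}

theorem isCompact_exhaustion {n : ℕ} (Z : Opens (Euc n)) (m : ℕ) :
    IsCompact (exhaustion Z m) := by
  have h : exhaustion Z m = Metric.closedBall 0 m ∩
      {x | (m : ℝ≥0∞)⁻¹ ≤ Metric.infEDist x (Z : Set (Euc n))ᶜ} := by
    ext x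
    simp only [exhaustion, mem_ofPred_eq, mem_inter_iff, Metric.mem_closedBall, dist_zero_right]
    refine ⟨fun h => h.2, fun h => ⟨?_, h⟩⟩
    by_contra hx
    have h0 : Metric.infEDist x (Z : Set (Euc n))ᶜ = 0 := Metric.infEDist_zero_of_mem hx
    have := h.2
    rw [h0] at this
    simp at this
  rw [h]
  exact (isCompact_closedBall _ _).inter_right
    (isClosed_le continuous_const Metric.continuous_infEDist)

/-! ### The Fréchet space of smooth functions and the distribution spaces -/

section CInfty

variable {n : ℕ}

/-- `C^∞(X)`: the smooth complex functions on the open set `X`, extended by zero. -/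
def CInfty (X : Opens (Euc n)) : Type := smoothOn ℂ X

variable (X : Opens (Euc n))

instance : AddCommGroup (CInfty X) := inferInstanceAs (AddCommGroup (smoothOn ℂ X))
instance : Module ℂ (CInfty X) := inferInstanceAs (Module ℂ (smoothOn ℂ X))
instance : CoeFun (CInfty X) (fun _ => Euc n → ℂ) := ⟨fun f => f.1⟩

/-- The coordinate directions of `ℝⁿ`. -/
def basisDir (i : Fin n) : Euc n := EuclideanSpace.single i 1

theorem CInfty.bdd (m : ℕ) (f : CInfty X) :
    BddAbove (range fun i : {q : X × Multi (Fin n) m // q.1.1 ∈ exhaustion X m} =>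
      (1 : ℝ) * ‖derivAt ℂ X i.1.1 (fun t => basisDir (i.1.2.2 t)) f‖) := by
  refine bddAbove_range_of_finite _ (fun i => i.1.2) fun s => ?_
  obtain ⟨C, hC⟩ := (isCompact_exhaustion X m).exists_bound_of_continuousOn
    ((continuousOn_deriv f.2 (fun t => basisDir (s.2 t))).mono fun x hx => hx.1)
  refine ⟨C, ?_⟩
  rintro ⟨⟨x, s'⟩, hx⟩ rfl
  rw [one_mul]
  exact hC x.1 hx

/-- The seminorm `π_{X,m}(v) = sup {|∂^j v(x)| : x ∈ K_{X,m}, |j| ≤ m}`. -/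
def CInfty.seminorm (m : ℕ) : Seminorm ℂ (CInfty X) :=
  supSeminorm (I := {q : X × Multi (Fin n) m // q.1.1 ∈ exhaustion X m}) (fun _ => 1)
    (fun _ => zero_le_one) (fun i => derivAt ℂ X i.1.1 (fun t => basisDir (i.1.2.2 t)))
    (CInfty.bdd X m)

instance : TopologicalSpace (CInfty X) :=
  (show SeminormFamily ℂ (CInfty X) ℕ from CInfty.seminorm X).moduleFilterBasis.topology

theorem CInfty.withSeminorms :
    WithSeminorms (show SeminormFamily ℂ (CInfty X) ℕ from CInfty.seminorm X) := ⟨rfl⟩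

instance : MeasurableSpace (CInfty X) := borel _
instance : BorelSpace (CInfty X) := ⟨rfl⟩

/-- `𝓔'(X)`: the compactly supported distributions, that is, the dual of `C^∞(X)`. -/
abbrev CompactDistribution : Type := CInfty X →L[ℂ] ℂ

/-- `𝓓'(X)`: the dual of the LF-space `𝓓(X)` of complex test functions, with the weak-∗
topology. -/
def WeakDistribution : Type := WeakDual ℂ 𝓓(X, ℂ)

instance : TopologicalSpace (WeakDistribution X) :=
  inferInstanceAs (TopologicalSpace (WeakDual ℂ 𝓓(X, ℂ)))
instance : FunLike (WeakDistribution X) 𝓓(X, ℂ) ℂ :=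
  inferInstanceAs (FunLike (WeakDual ℂ 𝓓(X, ℂ)) 𝓓(X, ℂ) ℂ)
instance : MeasurableSpace (WeakDistribution X) := borel _
instance : BorelSpace (WeakDistribution X) := ⟨rfl⟩

end CInfty

/-! ### Phase functions and amplitudes -/

section PhaseAmplitude

variable {nX nY : ℕ}

/-- The coordinate indices of `ℝ^{nX} × ℝ^{nY} × ℝ^N`. -/
abbrev Idx (nX nY N : ℕ) : Type := Fin nX ⊕ Fin nY ⊕ Fin N

/-- The coordinate directions of `ℝ^{nX} × ℝ^{nY} × ℝ^N`. -/
def dir {nX nY N : ℕ} : Idx nX nY N → Euc nX × Euc nY × Euc N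
  | .inl i => (basisDir i, 0, 0)
  | .inr (.inl i) => (0, basisDir i, 0)
  | .inr (.inr i) => (0, 0, basisDir i)

/-- The number `|l|` of derivatives with respect to `ξ` in the list `s`. -/
def xiOrder {nX nY N k : ℕ} (s : Fin k → Idx nX nY N) : ℕ :=
  ∑ t, match s t with
    | .inr (.inr _) => 1
    | _ => 0

/-- The number `|j| + |k|` of derivatives with respect to `x` and `y` in the list `s`. -/
def xyOrder {nX nY N k : ℕ} (s : Fin k → Idx nX nY N) : ℕ :=
  ∑ t, match s t with
    | .inr (.inr _) => 0
    | _ => 1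

/-- `⟨ξ⟩ = (1 + ‖ξ‖²)^{1/2}`. -/
def bracket {N : ℕ} (ξ : Euc N) : ℝ := √(1 + ‖ξ‖ ^ 2)

/-- The open set `X × Y × Ξ`, where `Ξ = ℝ^N ∖ {0}`. -/
def dom (X : Opens (Euc nX)) (Y : Opens (Euc nY)) (N : ℕ) : Opens (Euc nX × Euc nY × Euc N) :=
  ⟨(X : Set (Euc nX)) ×ˢ (Y : Set (Euc nY)) ×ˢ {0}ᶜ,
    X.isOpen.prod (Y.isOpen.prod isOpen_compl_singleton)⟩

variable (X : Opens (Euc nX)) (Y : Opens (Euc nY)) (N : ℕ)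

/-- The smooth real functions on `X × Y × Ξ` that are positively homogeneous of degree one
in `ξ`. -/
def homogeneousSubmodule : Submodule ℝ (smoothOn ℝ (dom X Y N)) where
  carrier := {Φ | ∀ x ∈ X, ∀ y ∈ Y, ∀ ξ : Euc N, ξ ≠ 0 → ∀ t : ℝ, 0 < t →
    Φ.1 (x, y, t • ξ) = t * Φ.1 (x, y, ξ)}
  add_mem' := by
    intro f g hf hg x hx y hy ξ hξ t ht
    simp [hf x hx y hy ξ hξ t ht, hg x hx y hy ξ hξ t ht, mul_add]
  zero_mem' := by simp
  smul_mem' := by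
    intro c f hf x hx y hy ξ hξ t ht
    simp [hf x hx y hy ξ hξ t ht, mul_left_comm]

/-- The space `𝓜_{hg}(X, Y, Ξ)`. -/
def Mhg : Type := homogeneousSubmodule X Y N

instance : AddCommGroup (Mhg X Y N) := inferInstanceAs (AddCommGroup (homogeneousSubmodule X Y N))
instance : Module ℝ (Mhg X Y N) := inferInstanceAs (Module ℝ (homogeneousSubmodule X Y N))
instance : CoeFun (Mhg X Y N) (fun _ => Euc nX × Euc nY × Euc N → ℝ) := ⟨fun Φ => Φ.1.1⟩

theorem Mhg.bdd (m : ℕ) (Φ : Mhg X Y N) :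
    BddAbove (range fun i : {q : dom X Y N × Multi (Idx nX nY N) m //
        q.1.1.1 ∈ exhaustion X m ∧ q.1.1.2.1 ∈ exhaustion Y m ∧ ‖q.1.1.2.2‖ = 1} =>
      (1 : ℝ) * ‖(derivAt ℝ (dom X Y N) i.1.1 (fun t => dir (i.1.2.2 t))).comp
        (homogeneousSubmodule X Y N).subtype Φ‖) := by
  refine bddAbove_range_of_finite _ (fun i => i.1.2) fun s => ?_
  have hK : IsCompact (exhaustion X m ×ˢ exhaustion Y m ×ˢ Metric.sphere (0 : Euc N) 1) :=
    (isCompact_exhaustion X m).prod ((isCompact_exhaustion Y m).prod (isCompact_sphere _ _))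
  obtain ⟨C, hC⟩ := hK.exists_bound_of_continuousOn
    ((continuousOn_deriv Φ.1.2 (fun t => dir (s.2 t))).mono (by
      rintro ⟨x, y, ξ⟩ ⟨hx, hy, hξ⟩
      refine ⟨hx.1, hy.1, ?_⟩
      rintro rfl
      simp at hξ))
  refine ⟨C, ?_⟩
  rintro ⟨⟨p, s'⟩, hx, hy, hξ⟩ rfl
  rw [one_mul]
  exact hC p.1 ⟨hx, hy, by simpa using hξ⟩

/-- The seminorm `p_m(Φ) = sup |∂_x^j ∂_y^k ∂_ξ^l Φ(x, y, ξ)|` over `x ∈ K_{X,m}`, `y ∈ K_{Y,m}`,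
`‖ξ‖ = 1` and `|j| + |k| + |l| ≤ m`. -/
def Mhg.seminorm (m : ℕ) : Seminorm ℝ (Mhg X Y N) :=
  supSeminorm (V := homogeneousSubmodule X Y N) (I := {q : dom X Y N × Multi (Idx nX nY N) m //
      q.1.1.1 ∈ exhaustion X m ∧ q.1.1.2.1 ∈ exhaustion Y m ∧ ‖q.1.1.2.2‖ = 1})
    (fun _ => 1) (fun _ => zero_le_one)
    (fun i => (derivAt ℝ (dom X Y N) i.1.1 (fun t => dir (i.1.2.2 t))).comp
      (homogeneousSubmodule X Y N).subtype)
    (Mhg.bdd X Y N m)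

instance : TopologicalSpace (Mhg X Y N) :=
  (show SeminormFamily ℝ (Mhg X Y N) ℕ from Mhg.seminorm X Y N).moduleFilterBasis.topology

theorem Mhg.withSeminorms :
    WithSeminorms (show SeminormFamily ℝ (Mhg X Y N) ℕ from Mhg.seminorm X Y N) := ⟨rfl⟩

instance : MeasurableSpace (Mhg X Y N) := borel _
instance : BorelSpace (Mhg X Y N) := ⟨rfl⟩

/-- The set `𝓜_α(X, Y, Ξ)`; as a type it carries the subspace topology and its Borel
σ-algebra. -/
def Malpha (α : ℝ) : Set (Mhg X Y N) :=
  {Φ | ∀ x ∈ X, ∀ y ∈ Y, ∀ ξ : Euc N, ξ ≠ 0 →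
    α ≤ ∑ i, (‖ξ‖⁻¹ * fderiv ℝ Φ (x, y, ξ) (basisDir i, 0, 0)) ^ 2
        + ∑ l, (fderiv ℝ Φ (x, y, ξ) (0, 0, basisDir l)) ^ 2 ∧
    α ≤ ∑ k, (‖ξ‖⁻¹ * fderiv ℝ Φ (x, y, ξ) (0, basisDir k, 0)) ^ 2
        + ∑ l, (fderiv ℝ Φ (x, y, ξ) (0, 0, basisDir l)) ^ 2}

/-- `a` is a Hörmander symbol of class `S^d_{ρ,δ}(X × Y × ℝ^N)`. -/
def IsSymbol (d ρ δ : ℝ) (a : Euc nX × Euc nY × Euc N → ℂ) : Prop :=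
  ContDiffOn ℝ ∞ a ((X : Set (Euc nX)) ×ˢ (Y : Set (Euc nY)) ×ˢ univ) ∧
  ∀ (k : ℕ) (s : Fin k → Idx nX nY N) (K : Set (Euc nX × Euc nY)), IsCompact K →
    K ⊆ (X : Set (Euc nX)) ×ˢ (Y : Set (Euc nY)) → ∃ C : ℝ, ∀ x y, (x, y) ∈ K → ∀ ξ : Euc N,
      ‖iteratedFDeriv ℝ k a (x, y, ξ) (fun t => dir (s t))‖ ≤
        C * bracket ξ ^ (d - ρ * xiOrder s + δ * xyOrder s)

variable {X Y N} in
theorem isSymbol_contDiffAt {d ρ δ : ℝ} {a : Euc nX × Euc nY × Euc N → ℂ}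
    (ha : IsSymbol X Y N d ρ δ a) {x : Euc nX} {y : Euc nY} (hx : x ∈ X) (hy : y ∈ Y) (ξ : Euc N)
    (k : ℕ) : ContDiffAt ℝ k a (x, y, ξ) :=
  (ha.1.contDiffAt ((X.isOpen.prod (Y.isOpen.prod isOpen_univ)).mem_nhds
    ⟨hx, hy, mem_univ _⟩)).of_le (by exact_mod_cast le_top)

variable {X Y N} in
theorem IsSymbol.add {d ρ δ : ℝ} {a b : Euc nX × Euc nY × Euc N → ℂ}
    (ha : IsSymbol X Y N d ρ δ a) (hb : IsSymbol X Y N d ρ δ b) :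
    IsSymbol X Y N d ρ δ (a + b) := by
  refine ⟨ha.1.add hb.1, fun k s K hK hKs => ?_⟩
  obtain ⟨C, hC⟩ := ha.2 k s K hK hKs
  obtain ⟨D, hD⟩ := hb.2 k s K hK hKs
  refine ⟨C + D, fun x y hxy ξ => ?_⟩
  have h := hKs hxy
  rw [iteratedFDeriv_add_apply (isSymbol_contDiffAt ha h.1 h.2 ξ k)
    (isSymbol_contDiffAt hb h.1 h.2 ξ k), add_apply, add_mul]
  exact (norm_add_le _ _).trans (add_le_add (hC x y hxy ξ) (hD x y hxy ξ))

variable {X Y N} in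
theorem IsSymbol.smul {d ρ δ : ℝ} {a : Euc nX × Euc nY × Euc N → ℂ}
    (ha : IsSymbol X Y N d ρ δ a) (c : ℂ) : IsSymbol X Y N d ρ δ (c • a) := by
  refine ⟨ha.1.const_smul c, fun k s K hK hKs => ?_⟩
  obtain ⟨C, hC⟩ := ha.2 k s K hK hKs
  refine ⟨‖c‖ * C, fun x y hxy ξ => ?_⟩
  have h := hKs hxy
  rw [iteratedFDeriv_const_smul_apply (isSymbol_contDiffAt ha h.1 h.2 ξ k),
    smul_apply, norm_smul, mul_assoc]
  exact mul_le_mul_of_nonneg_left (hC x y hxy ξ) (norm_nonneg c)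

theorem isSymbol_zero (d ρ δ : ℝ) : IsSymbol X Y N d ρ δ 0 :=
  ⟨contDiffOn_const, fun k s K _ _ => ⟨0, fun x y _ ξ => by simp⟩⟩

/-- The restrictions to `X × Y × Ξ` of the symbols in `S^d_{ρ,δ}(X × Y × ℝ^N)`. -/
def amplitudeSubmodule (d ρ δ : ℝ) : Submodule ℂ (smoothOn ℂ (dom X Y N)) where
  carrier := {b | ∃ a, IsSymbol X Y N d ρ δ a ∧ EqOn b.1 a (dom X Y N)}
  add_mem' := by
    rintro f g ⟨a, ha, hfa⟩ ⟨b, hb, hgb⟩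
    exact ⟨a + b, ha.add hb, fun p hp => by simp [hfa hp, hgb hp]⟩
  zero_mem' := ⟨0, isSymbol_zero X Y N d ρ δ, fun p _ => rfl⟩
  smul_mem' := by
    rintro c f ⟨a, ha, hfa⟩
    exact ⟨c • a, ha.smul c, fun p hp => by simp [hfa hp]⟩

/-- The space `𝓢^d_{ρ,δ}(X, Y, Ξ)` of amplitude functions. -/
def Amplitude (d ρ δ : ℝ) : Type := amplitudeSubmodule X Y N d ρ δ

variable (d ρ δ : ℝ)

instance : AddCommGroup (Amplitude X Y N d ρ δ) :=
  inferInstanceAs (AddCommGroup (amplitudeSubmodule X Y N d ρ δ))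
instance : Module ℂ (Amplitude X Y N d ρ δ) :=
  inferInstanceAs (Module ℂ (amplitudeSubmodule X Y N d ρ δ))
instance : CoeFun (Amplitude X Y N d ρ δ) (fun _ => Euc nX × Euc nY × Euc N → ℂ) :=
  ⟨fun a => a.1.1⟩

theorem bracket_pos {N : ℕ} (ξ : Euc N) : 0 < bracket ξ := Real.sqrt_pos.2 (by positivity)

theorem Amplitude.bdd (m : ℕ) (b : Amplitude X Y N d ρ δ) :
    BddAbove (range fun i : {q : dom X Y N × Multi (Idx nX nY N) m //
        q.1.1.1 ∈ exhaustion X m ∧ q.1.1.2.1 ∈ exhaustion Y m} =>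
      bracket i.1.1.1.2.2 ^ (-d + ρ * xiOrder i.1.2.2 - δ * xyOrder i.1.2.2) *
        ‖(derivAt ℂ (dom X Y N) i.1.1 (fun t => dir (i.1.2.2 t))).comp
          (amplitudeSubmodule X Y N d ρ δ).subtype b‖) := by
  refine bddAbove_range_of_finite _ (fun i => i.1.2) fun s => ?_
  obtain ⟨a, ha, hba⟩ := b.2
  obtain ⟨C, hC⟩ := ha.2 _ s.2 (exhaustion X m ×ˢ exhaustion Y m)
    ((isCompact_exhaustion X m).prod (isCompact_exhaustion Y m))
    (prod_mono (fun x hx => hx.1) (fun y hy => hy.1))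
  refine ⟨C, ?_⟩
  rintro ⟨⟨⟨⟨x, y, ξ⟩, hp⟩, s'⟩, hx, hy⟩ rfl
  have h1 := hC x y ⟨hx, hy⟩ ξ
  have h2 : iteratedFDeriv ℝ s'.1 b.1.1 (x, y, ξ) = iteratedFDeriv ℝ s'.1 a (x, y, ξ) :=
    ((hba.eventuallyEq_of_mem ((dom X Y N).isOpen.mem_nhds hp)).iteratedFDeriv ℝ _).eq_of_nhds
  change bracket ξ ^ (-d + ρ * xiOrder s'.2 - δ * xyOrder s'.2) *
    ‖iteratedFDeriv ℝ s'.1 b.1.1 (x, y, ξ) (fun t => dir (s'.2 t))‖ ≤ C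
  rw [h2]
  calc _ ≤ bracket ξ ^ (-d + ρ * xiOrder s'.2 - δ * xyOrder s'.2) *
        (C * bracket ξ ^ (d - ρ * xiOrder s'.2 + δ * xyOrder s'.2)) :=
      mul_le_mul_of_nonneg_left h1 (Real.rpow_nonneg (bracket_pos ξ).le _)
    _ = C := by
      rw [mul_left_comm, ← Real.rpow_add (bracket_pos ξ)]
      ring_nf
      simp

/-- The seminorm
`q_m(a) = sup ⟨ξ⟩^{-d + ρ|l| - δ(|j|+|k|)} |∂_x^j ∂_y^k ∂_ξ^l a(x, y, ξ)|` over `x ∈ K_{X,m}`,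
`y ∈ K_{Y,m}`, `ξ ∈ Ξ` and `|j| + |k| + |l| ≤ m`. -/
def Amplitude.seminorm (m : ℕ) : Seminorm ℂ (Amplitude X Y N d ρ δ) :=
  supSeminorm (V := amplitudeSubmodule X Y N d ρ δ)
    (I := {q : dom X Y N × Multi (Idx nX nY N) m //
      q.1.1.1 ∈ exhaustion X m ∧ q.1.1.2.1 ∈ exhaustion Y m})
    (fun i => bracket i.1.1.1.2.2 ^ (-d + ρ * xiOrder i.1.2.2 - δ * xyOrder i.1.2.2))
    (fun _ => Real.rpow_nonneg (bracket_pos _).le _)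
    (fun i => (derivAt ℂ (dom X Y N) i.1.1 (fun t => dir (i.1.2.2 t))).comp
      (amplitudeSubmodule X Y N d ρ δ).subtype)
    (Amplitude.bdd X Y N d ρ δ m)

instance : TopologicalSpace (Amplitude X Y N d ρ δ) :=
  (show SeminormFamily ℂ (Amplitude X Y N d ρ δ) ℕ from
    Amplitude.seminorm X Y N d ρ δ).moduleFilterBasis.topology

theorem Amplitude.withSeminorms :
    WithSeminorms (show SeminormFamily ℂ (Amplitude X Y N d ρ δ) ℕ from
      Amplitude.seminorm X Y N d ρ δ) := ⟨rfl⟩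

instance : MeasurableSpace (Amplitude X Y N d ρ δ) := borel _
instance : BorelSpace (Amplitude X Y N d ρ δ) := ⟨rfl⟩

end PhaseAmplitude

/-! ### Oscillatory integrals and Fourier integral operators -/

section Oscillatory

variable {n N : ℕ}

/-- `χ ∈ 𝓓(ℝ^N)` with `χ = 1` for `‖ξ‖ < 1` and `χ = 0` for `‖ξ‖ > 2`. -/
structure IsCutoff (χ : Euc N → ℂ) : Prop where
  contDiff : ContDiff ℝ ∞ χ
  hasCompactSupport : HasCompactSupport χ
  eq_one : ∀ ξ, ‖ξ‖ < 1 → χ ξ = 1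
  eq_zero : ∀ ξ, 2 < ‖ξ‖ → χ ξ = 0

/-- The partial derivative `∂_{y_k} f`. -/
def partialY {F : Type*} [NormedAddCommGroup F] [NormedSpace ℝ F] (k : Fin n)
    (f : Euc n × Euc N → F) (p : Euc n × Euc N) : F := fderiv ℝ f p (basisDir k, 0)

/-- The partial derivative `∂_{ξ_l} f`. -/
def partialXi {F : Type*} [NormedAddCommGroup F] [NormedSpace ℝ F] (l : Fin N)
    (f : Euc n × Euc N → F) (p : Euc n × Euc N) : F := fderiv ℝ f p (0, basisDir l)

/-- `r = ∑_l ‖ξ‖² |∂_{ξ_l} Φ|² + ∑_k |∂_{y_k} Φ|²`. -/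
def rFun (Φ : Euc n × Euc N → ℝ) (p : Euc n × Euc N) : ℝ :=
  ∑ l, ‖p.2‖ ^ 2 * (partialXi l Φ p) ^ 2 + ∑ k, (partialY k Φ p) ^ 2

/-- The coefficient `(-i / r) (1 - χ) ‖ξ‖² ∂_{ξ_l} Φ`. -/
def coeffXi (χ : Euc N → ℂ) (Φ : Euc n × Euc N → ℝ) (l : Fin N) (p : Euc n × Euc N) : ℂ :=
  -Complex.I / (rFun Φ p : ℂ) * (1 - χ p.2) * (‖p.2‖ ^ 2 : ℝ) * ((partialXi l Φ p : ℝ) : ℂ)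

/-- The coefficient `(-i / r) (1 - χ) ∂_{y_k} Φ`. -/
def coeffY (χ : Euc N → ℂ) (Φ : Euc n × Euc N → ℝ) (k : Fin n) (p : Euc n × Euc N) : ℂ :=
  -Complex.I / (rFun Φ p : ℂ) * (1 - χ p.2) * ((partialY k Φ p : ℝ) : ℂ)

/-- The regularizing operator
`L f = - ∑_l ∂_{ξ_l} (α_l f) - ∑_k ∂_{y_k} (β_k f) + χ f`. -/
def regOp (χ : Euc N → ℂ) (Φ : Euc n × Euc N → ℝ) (f : Euc n × Euc N → ℂ)
    (p : Euc n × Euc N) : ℂ :=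
  -(∑ l, partialXi l (fun q => coeffXi χ Φ l q * f q) p)
    - (∑ k, partialY k (fun q => coeffY χ Φ k q * f q) p) + χ p.2 * f p

/-- The oscillatory integral `∫_Ξ ∫_Y e^{iΦ(y,ξ)} f(y,ξ) dy dξ`, regularized by means of the
cutoff `χ`, exists and has the value `I`: for all large enough `κ` the function `e^{iΦ} L^κ f` is
absolutely integrable over `Y × Ξ` and its integral is `I`. -/
def HasOscIntegral (χ : Euc N → ℂ) (Y : Opens (Euc n)) (Φ : Euc n × Euc N → ℝ)
    (f : Euc n × Euc N → ℂ) (I : ℂ) : Prop :=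
  ∀ᶠ κ : ℕ in atTop,
    IntegrableOn (fun p => Complex.exp (Complex.I * Φ p) * ((regOp χ Φ)^[κ] f) p)
      ((Y : Set (Euc n)) ×ˢ ({0}ᶜ : Set (Euc N))) ∧
    ∫ ξ in ({0}ᶜ : Set (Euc N)), ∫ y in (Y : Set (Euc n)),
      Complex.exp (Complex.I * Φ (y, ξ)) * ((regOp χ Φ)^[κ] f) (y, ξ) = I

theorem HasOscIntegral.unique {χ : Euc N → ℂ} {Y : Opens (Euc n)} {Φ : Euc n × Euc N → ℝ}
    {f : Euc n × Euc N → ℂ} {I J : ℂ} (hI : HasOscIntegral χ Y Φ f I)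
    (hJ : HasOscIntegral χ Y Φ f J) : I = J := by
  obtain ⟨κ, h1, h2⟩ := (hI.and hJ).exists
  exact h1.2.symm.trans h2.2

variable {nX nY : ℕ} {X : Opens (Euc nX)} {Y : Opens (Euc nY)}

/-- The smooth function `v ∈ C^∞(X)` is `A_{Φ,a}[ψ]`, that is, for every `x ∈ X`,
`v(x) = (2π)^{-N} ∫_Ξ ∫_Y e^{iΦ(x,y,ξ)} a(x,y,ξ) ψ(y) dy dξ` as an oscillatory integral. -/
def IsFIO (χ : Euc N → ℂ) (Φ : Euc nX × Euc nY × Euc N → ℝ) (a : Euc nX × Euc nY × Euc N → ℂ)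
    (ψ : 𝓓(Y, ℂ)) (v : CInfty X) : Prop :=
  ∀ x ∈ X, ∃ I : ℂ,
    HasOscIntegral χ Y (fun p => Φ (x, p.1, p.2)) (fun p => a (x, p.1, p.2) * ψ p.1) I ∧
    v x = ((2 * Real.pi : ℝ) : ℂ)⁻¹ ^ N * I

/-- The smooth function `w ∈ C^∞(Y)` is `ᵗA_{Φ,a}[φ]`, that is, for every `y ∈ Y`,
`w(y) = (2π)^{-N} ∫_Ξ ∫_X e^{iΦ(x,y,ξ)} a(x,y,ξ) φ(x) dx dξ` as an oscillatory integral. -/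
def IsTransposeFIO (χ : Euc N → ℂ) (Φ : Euc nX × Euc nY × Euc N → ℝ)
    (a : Euc nX × Euc nY × Euc N → ℂ) (φ : 𝓓(X, ℂ)) (w : CInfty Y) : Prop :=
  ∀ y ∈ Y, ∃ I : ℂ,
    HasOscIntegral χ X (fun p => Φ (p.1, y, p.2)) (fun p => a (p.1, y, p.2) * φ p.1) I ∧
    w y = ((2 * Real.pi : ℝ) : ℂ)⁻¹ ^ N * I

/-- The distribution `T ∈ 𝓓'(X)` is `A_{Φ,a}[u]` for `u ∈ 𝓔'(Y)`: for every test function `φ`,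
`ᵗA_{Φ,a}[φ]` is in `C^∞(Y)` and `⟨T, φ⟩ = ⟨u, ᵗA_{Φ,a}[φ]⟩`. -/
def IsFIODistribution (χ : Euc N → ℂ) (Φ : Euc nX × Euc nY × Euc N → ℝ)
    (a : Euc nX × Euc nY × Euc N → ℂ) (u : CompactDistribution Y) (T : WeakDistribution X) :
    Prop :=
  ∀ φ : 𝓓(X, ℂ), ∃ w : CInfty Y, IsTransposeFIO χ Φ a φ w ∧ T φ = u w

theorem CInfty.ext {v w : CInfty X} (h : ∀ x ∈ X, v x = w x) : v = w := by
  refine Subtype.ext (funext fun x => ?_)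
  by_cases hx : x ∈ X
  · exact h x hx
  · rw [v.2.2 x hx, w.2.2 x hx]

theorem IsFIO.unique {χ : Euc N → ℂ} {Φ : Euc nX × Euc nY × Euc N → ℝ}
    {a : Euc nX × Euc nY × Euc N → ℂ} {ψ : 𝓓(Y, ℂ)} {v w : CInfty X}
    (hv : IsFIO χ Φ a ψ v) (hw : IsFIO χ Φ a ψ w) : v = w := by
  refine CInfty.ext fun x hx => ?_
  obtain ⟨I, hI, h1⟩ := hv x hx
  obtain ⟨J, hJ, h2⟩ := hw x hx
  rw [h1, h2, hI.unique hJ]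

theorem IsTransposeFIO.unique {χ : Euc N → ℂ} {Φ : Euc nX × Euc nY × Euc N → ℝ}
    {a : Euc nX × Euc nY × Euc N → ℂ} {φ : 𝓓(X, ℂ)} {v w : CInfty Y}
    (hv : IsTransposeFIO χ Φ a φ v) (hw : IsTransposeFIO χ Φ a φ w) : v = w := by
  refine CInfty.ext fun y hy => ?_
  obtain ⟨I, hI, h1⟩ := hv y hy
  obtain ⟨J, hJ, h2⟩ := hw y hy
  rw [h1, h2, hI.unique hJ]

theorem IsFIODistribution.unique {χ : Euc N → ℂ} {Φ : Euc nX × Euc nY × Euc N → ℝ}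
    {a : Euc nX × Euc nY × Euc N → ℂ} {u : CompactDistribution Y} {S T : WeakDistribution X}
    (hS : IsFIODistribution χ Φ a u S) (hT : IsFIODistribution χ Φ a u T) : S = T := by
  refine DFunLike.ext _ _ fun φ => ?_
  obtain ⟨v, hv, h1⟩ := hS φ
  obtain ⟨w, hw, h2⟩ := hT φ
  rw [h1, h2, hv.unique hw]

end Oscillatory

end SFIO

end

open SFIO

namespace SFIO

open scoped ContDiff Topology

/-! ### Iterated derivatives in fixed directions -/

section Calculus

variable {E F : Type*} [NormedAddCommGroup E] [NormedSpace ℝ E] [NormedAddCommGroup F]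
  [NormedSpace ℝ F]

/-! Existence and smoothness. The operator L is designed so that e^{iΦ} L g differs from e^{iΦ} g by
a divergence (`exp_mul_regOpParam`). The bound by α gives r ≥ α‖ξ‖² > 0, so up to the cutoff the
coefficients of L are homogeneous in ξ, of degree 0 for ξ-derivatives and -1 for y-derivatives.
Hence each application of L lowers the order of a symbol by τ = min(ρ, 1 - δ) > 0
(`symb_regOpParam`). Once d - κτ < -N, the integrand e^{iΦ} L^κ f is dominated by a multiple of
1_S(y)⟨ξ⟩^{d-κτ}, which is integrable for compact S, and raising κ does not change the integral
(`paramIntegral_oscIntegrand_succ`). An x-derivative of e^{iΦ} costs one power of ⟨ξ⟩, so k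
derivatives pass under the integral after κ has been enlarged (`contDiffOn_oscValue`).

The same estimates are uniform over bounded families of test functions. This makes the operator
continuous on every 𝓓_K (`continuous_comp_ofSupportedIn`), hence on the LF-space. Applied with x and
y exchanged, it yields the transpose and, by duality, the distribution A[u].

Measurability. Point evaluations of phases and amplitudes are continuous, hence measurable in ω.
Derivatives are limits of difference quotients, so the integrand is measurable in ω at each point;
the exponent κ depends on N, d, ρ, δ only and not on ω. A Carathéodory argument and Fubini give
measurability of each value of the oscillatory integral (`measurable_oscValue`).

From values to Borel measurability. In C^∞ every open set is a countable union of seminorm balls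
with centres in a countable dense set, and the seminorms are suprema over countably many points
(`CInfty.measurable_of_apply`). The weak-∗ topology of 𝓓' is not handled by a countable base.
Instead, for each compact set of the exhaustion, the distributions are covered by countably many
sets that are equicontinuous on test functions supported there; on each of these sets, pairings with
countably many test functions suffice (`WeakDistribution.measurable_of_apply`). -/

theorem iteratedFDeriv_succ_apply_last {f : E → F} {x : E} {k : ℕ}
    (hf : ContDiffAt ℝ (k + 1) f x) (v : Fin (k + 1) → E) :
    iteratedFDeriv ℝ (k + 1) f x v =
      iteratedFDeriv ℝ k (fun z => fderiv ℝ f z (v (Fin.last k))) x (Fin.init v) := by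
  have h : ContDiffAt ℝ k (fderiv ℝ f) x := hf.fderiv_right (m := k) le_rfl
  have := ContinuousLinearMap.iteratedFDeriv_comp_left
    (ContinuousLinearMap.apply ℝ F (v (Fin.last k))) h (i := k) le_rfl
  rw [iteratedFDeriv_succ_apply_right]
  have h2 : (fun z => fderiv ℝ f z (v (Fin.last k))) =
    (ContinuousLinearMap.apply ℝ F (v (Fin.last k))) ∘ fderiv ℝ f := rfl
  rw [h2, this]
  rfl

theorem ContDiffOn.fderiv_apply_const {f : E → F} {U : Set E} (hf : ContDiffOn ℝ ∞ f U)
    (hU : IsOpen U) (v : E) : ContDiffOn ℝ ∞ (fun p => fderiv ℝ f p v) U :=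
  (hf.fderiv_of_isOpen hU (m := ∞) (by simp)).clm_apply contDiffOn_const

theorem differentiableAt_of_contDiffOn {f : E → F} {U : Set E} (hf : ContDiffOn ℝ ∞ f U)
    (hU : IsOpen U) {p : E} (hp : p ∈ U) : DifferentiableAt ℝ f p :=
  (hf.differentiableOn (by simp)).differentiableAt (hU.mem_nhds hp)

theorem fderiv_eq_of_eqOn {f g : E → F} {U : Set E} (hU : IsOpen U) (h : EqOn f g U) {p : E}
    (hp : p ∈ U) : fderiv ℝ f p = fderiv ℝ g p :=
  (h.eventuallyEq_of_mem (hU.mem_nhds hp)).fderiv_eq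

theorem fderiv_eq_zero_of_eqOn {f : E → F} {U : Set E} (hU : IsOpen U) (h : ∀ p ∈ U, f p = 0)
    {p : E} (hp : p ∈ U) : fderiv ℝ f p = 0 := by
  rw [fderiv_eq_of_eqOn hU (g := fun _ => 0) h hp]
  simp

end Calculus

theorem one_le_bracket {N : ℕ} (ξ : Euc N) : 1 ≤ bracket ξ :=
  Real.one_le_sqrt.2 (by nlinarith [sq_nonneg ‖ξ‖])

/-! ### Symbol estimates -/

section Symbols

variable {nX nY N : ℕ} {I ι ι' : Type*}

/-- The open set `X × Y × R`. -/
def box (X : Opens (Euc nX)) (Y : Opens (Euc nY)) (R : Opens (Euc N)) :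
    Opens (Euc nX × Euc nY × Euc N) :=
  ⟨(X : Set (Euc nX)) ×ˢ (Y : Set (Euc nY)) ×ˢ (R : Set (Euc N)),
    X.isOpen.prod (Y.isOpen.prod R.isOpen)⟩

/-- The open set `ℝ^N ∖ {0}`. -/
def punctured (N : ℕ) : Opens (Euc N) := ⟨{0}ᶜ, isOpen_compl_singleton⟩

variable (X : Opens (Euc nX)) (Y : Opens (Euc nY)) (R : Opens (Euc N))

/-- A family of smooth functions on `X × Y × R` that is `O(⟨ξ⟩^m)`, uniformly in the index and
locally uniformly in `(x, y)`. -/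
def SymbBound (m : ℝ) (f : I → Euc nX × Euc nY × Euc N → ℂ) : Prop :=
  (∀ i, ContDiffOn ℝ ∞ (f i) (box X Y R)) ∧
  ∀ K ⊆ (X : Set (Euc nX)) ×ˢ (Y : Set (Euc nY)), IsCompact K → ∃ C : ℝ, 0 ≤ C ∧
    ∀ i x y ξ, (x, y) ∈ K → ξ ∈ R → ‖f i (x, y, ξ)‖ ≤ C * bracket ξ ^ m

/-- The derivatives of order at most `n` in the directions `e j` of the family `f` satisfy symbol
estimates of order `m`, where a derivative in the direction `e j` changes the order by `w j`. -/
def Symb (e : ι → Euc nX × Euc nY × Euc N) (w : ι → ℝ) :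
    ℕ → ℝ → (I → Euc nX × Euc nY × Euc N → ℂ) → Prop
  | 0, m, f => SymbBound X Y R m f
  | n + 1, m, f => SymbBound X Y R m f ∧
      ∀ j, Symb e w n (m + w j) (fun i p => fderiv ℝ (f i) p (e j))

variable {X Y R} {e : ι → Euc nX × Euc nY × Euc N} {w : ι → ℝ} {n : ℕ} {m m' : ℝ}
  {f g : I → Euc nX × Euc nY × Euc N → ℂ}

theorem Symb.symbBound (h : Symb X Y R e w n m f) : SymbBound X Y R m f := by
  cases n with
  | zero => exact h
  | succ n => exact h.1

theorem Symb.contDiffOn (h : Symb X Y R e w n m f) (i : I) : ContDiffOn ℝ ∞ (f i) (box X Y R) :=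
  h.symbBound.1 i

theorem Symb.pred (h : Symb X Y R e w (n + 1) m f) : Symb X Y R e w n m f := by
  induction n generalizing m f with
  | zero => exact h.1
  | succ n ih => exact ⟨h.1, fun j => ih (h.2 j)⟩

theorem SymbBound.mono (h : SymbBound X Y R m f) (hm : m ≤ m') : SymbBound X Y R m' f := by
  refine ⟨h.1, fun K hK hKc => ?_⟩
  obtain ⟨C, hC0, hC⟩ := h.2 K hK hKc
  refine ⟨C, hC0, fun i x y ξ hxy hξ => (hC i x y ξ hxy hξ).trans ?_⟩
  exact mul_le_mul_of_nonneg_left (Real.rpow_le_rpow_of_exponent_le (one_le_bracket ξ) hm) hC0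

/-- Serves two purposes: discarding all directions but those of the parameter, and weakening the
type, for instance from (ρ, δ) to (0, 1). -/
theorem Symb.mono_reindex {e' : ι' → Euc nX × Euc nY × Euc N} {w' : ι' → ℝ} (σ : ι' → ι)
    (he : ∀ j, e' j = e (σ j)) (hw : ∀ j, w (σ j) ≤ w' j)
    (h : Symb X Y R e w n m f) (hm : m ≤ m') : Symb X Y R e' w' n m' f := by
  induction n generalizing m m' f with
  | zero => exact SymbBound.mono h hm
  | succ n ih =>
    refine ⟨h.1.mono hm, fun j => ?_⟩
    rw [he j]
    exact ih (h.2 (σ j)) (add_le_add hm (hw j))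

theorem Symb.mono (h : Symb X Y R e w n m f) (hm : m ≤ m') : Symb X Y R e w n m' f :=
  h.mono_reindex id (fun _ => rfl) (fun _ => le_rfl) hm

theorem Symb.congr (h : Symb X Y R e w n m f) (hfg : ∀ i, EqOn (f i) (g i) (box X Y R)) :
    Symb X Y R e w n m g := by
  have h0 {m : ℝ} {f g : I → Euc nX × Euc nY × Euc N → ℂ} (h : SymbBound X Y R m f)
      (hfg : ∀ i, EqOn (f i) (g i) (box X Y R)) : SymbBound X Y R m g := by
    refine ⟨fun i => (h.1 i).congr fun p hp => (hfg i hp).symm, fun K hK hKc => ?_⟩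
    obtain ⟨C, hC0, hC⟩ := h.2 K hK hKc
    refine ⟨C, hC0, fun i x y ξ hxy hξ => ?_⟩
    rw [← hfg i (show (x, y, ξ) ∈ box X Y R from ⟨(hK hxy).1, (hK hxy).2, hξ⟩)]
    exact hC i x y ξ hxy hξ
  induction n generalizing m f g with
  | zero => exact h0 h hfg
  | succ n ih =>
    refine ⟨h0 h.1 hfg, fun j => ih (h.2 j) fun i p hp => ?_⟩
    simp only [fderiv_eq_of_eqOn (box X Y R).isOpen (hfg i) hp]

theorem SymbBound.add (hf : SymbBound X Y R m f) (hg : SymbBound X Y R m g) :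
    SymbBound X Y R m (fun i p => f i p + g i p) := by
  refine ⟨fun i => (hf.1 i).add (hg.1 i), fun K hK hKc => ?_⟩
  obtain ⟨C, hC0, hC⟩ := hf.2 K hK hKc
  obtain ⟨D, hD0, hD⟩ := hg.2 K hK hKc
  refine ⟨C + D, add_nonneg hC0 hD0, fun i x y ξ hxy hξ => ?_⟩
  rw [add_mul]
  exact (norm_add_le _ _).trans (add_le_add (hC i x y ξ hxy hξ) (hD i x y ξ hxy hξ))

theorem Symb.add (hf : Symb X Y R e w n m f) (hg : Symb X Y R e w n m g) :
    Symb X Y R e w n m (fun i p => f i p + g i p) := by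
  induction n generalizing m f g with
  | zero => exact SymbBound.add hf hg
  | succ n ih =>
    refine ⟨hf.1.add hg.1, fun j => (ih (hf.2 j) (hg.2 j)).congr fun i p hp => ?_⟩
    dsimp only
    rw [fderiv_fun_add (differentiableAt_of_contDiffOn (hf.1.1 i) (box X Y R).isOpen hp)
      (differentiableAt_of_contDiffOn (hg.1.1 i) (box X Y R).isOpen hp)]
    rfl

theorem SymbBound.mul (hf : SymbBound X Y R m f) (hg : SymbBound X Y R m' g) :
    SymbBound X Y R (m + m') (fun i p => f i p * g i p) := by
  refine ⟨fun i => (hf.1 i).mul (hg.1 i), fun K hK hKc => ?_⟩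
  obtain ⟨C, hC0, hC⟩ := hf.2 K hK hKc
  obtain ⟨D, hD0, hD⟩ := hg.2 K hK hKc
  refine ⟨C * D, mul_nonneg hC0 hD0, fun i x y ξ hxy hξ => ?_⟩
  rw [norm_mul, Real.rpow_add (bracket_pos ξ)]
  calc _ ≤ (C * bracket ξ ^ m) * (D * bracket ξ ^ m') :=
        mul_le_mul (hC i x y ξ hxy hξ) (hD i x y ξ hxy hξ) (norm_nonneg _)
          (mul_nonneg hC0 (Real.rpow_nonneg (bracket_pos ξ).le _))
    _ = _ := by ring

theorem Symb.mul (hf : Symb X Y R e w n m f) (hg : Symb X Y R e w n m' g) :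
    Symb X Y R e w n (m + m') (fun i p => f i p * g i p) := by
  induction n generalizing m m' f g with
  | zero => exact SymbBound.mul hf hg
  | succ n ih =>
    refine ⟨hf.1.mul hg.1, fun j => ?_⟩
    have h1 := (ih hf.pred (hg.2 j)).mono (m' := m + m' + w j) (by linarith)
    have h2 := (ih (hf.2 j) hg.pred).mono (m' := m + m' + w j) (by linarith)
    refine (h1.add h2).congr fun i p hp => ?_
    dsimp only
    rw [fderiv_fun_mul (differentiableAt_of_contDiffOn (hf.1.1 i) (box X Y R).isOpen hp)
      (differentiableAt_of_contDiffOn (hg.1.1 i) (box X Y R).isOpen hp)]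
    simp [mul_comm]

theorem symb_zero : Symb X Y R e w n m (fun (_ : I) _ => 0) := by
  have h0 (m : ℝ) : SymbBound X Y R m (fun (_ : I) _ => 0) :=
    ⟨fun i => contDiffOn_const, fun K _ _ => ⟨0, le_rfl, fun i x y ξ _ _ => by simp⟩⟩
  induction n generalizing m with
  | zero => exact h0 m
  | succ n ih => exact ⟨h0 m, fun j => by simpa using ih⟩

theorem symb_const (c : ℂ) (hm : 0 ≤ m) : Symb X Y R e w n m (fun (_ : I) _ => c) := by
  have h0 : SymbBound X Y R m (fun (_ : I) _ => c) :=
    ⟨fun i => contDiffOn_const, fun K _ _ => ⟨‖c‖, norm_nonneg _, fun i x y ξ _ _ =>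
      le_mul_of_one_le_right (norm_nonneg _) (Real.one_le_rpow (one_le_bracket ξ) hm)⟩⟩
  cases n with
  | zero => exact h0
  | succ n => exact ⟨h0, fun j => by simpa using symb_zero⟩

theorem Symb.const_mul (hf : Symb X Y R e w n m f) (c : ℂ) :
    Symb X Y R e w n m (fun i p => c * f i p) := by
  simpa using (symb_const c le_rfl).mul hf

theorem Symb.neg (hf : Symb X Y R e w n m f) : Symb X Y R e w n m (fun i p => -f i p) := by
  simpa using hf.const_mul (-1)

theorem Symb.sum {J : Type*} (s : Finset J) {f : J → I → Euc nX × Euc nY × Euc N → ℂ}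
    (hf : ∀ j ∈ s, Symb X Y R e w n m (f j)) :
    Symb X Y R e w n m (fun i p => ∑ j ∈ s, f j i p) := by
  classical
  induction s using Finset.induction_on with
  | empty => simpa using symb_zero
  | insert a s ha ih =>
    simp only [Finset.sum_insert ha]
    exact (hf a (by simp)).add (ih fun j hj => hf j (by simp [hj]))

theorem Symb.union {R' : Opens (Euc N)} (h : Symb X Y R e w n m f)
    (h' : Symb X Y R' e w n m f) : Symb X Y (R ⊔ R') e w n m f := by
  have h0 {m : ℝ} {f : I → Euc nX × Euc nY × Euc N → ℂ} (h : SymbBound X Y R m f)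
      (h' : SymbBound X Y R' m f) : SymbBound X Y (R ⊔ R') m f := by
    refine ⟨fun i p hp => ?_, fun K hK hKc => ?_⟩
    · rcases hp with ⟨h1, h2, h3 | h3⟩
      · exact ((h.1 i).contDiffAt ((box X Y R).isOpen.mem_nhds ⟨h1, h2, h3⟩)).contDiffWithinAt
      · exact ((h'.1 i).contDiffAt ((box X Y R').isOpen.mem_nhds ⟨h1, h2, h3⟩)).contDiffWithinAt
    obtain ⟨C, hC0, hC⟩ := h.2 K hK hKc
    obtain ⟨D, hD0, hD⟩ := h'.2 K hK hKc
    refine ⟨max C D, le_max_of_le_left hC0, fun i x y ξ hxy hξ => ?_⟩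
    have hb := Real.rpow_nonneg (bracket_pos ξ).le m
    rcases hξ with hξ | hξ
    · exact (hC i x y ξ hxy hξ).trans (mul_le_mul_of_nonneg_right (le_max_left _ _) hb)
    · exact (hD i x y ξ hxy hξ).trans (mul_le_mul_of_nonneg_right (le_max_right _ _) hb)
  induction n generalizing m f with
  | zero => exact h0 h h'
  | succ n ih => exact ⟨h0 h.1 h'.1, fun j => ih (h.2 j) (h'.2 j)⟩

theorem Symb.restrict {R' : Opens (Euc N)} (h : Symb X Y R e w n m f) (hR : R' ≤ R) :
    Symb X Y R' e w n m f := by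
  have h0 {m : ℝ} {f : I → Euc nX × Euc nY × Euc N → ℂ} (h : SymbBound X Y R m f) :
      SymbBound X Y R' m f := by
    refine ⟨fun i => (h.1 i).mono fun p hp => ⟨hp.1, hp.2.1, hR hp.2.2⟩, fun K hK hKc => ?_⟩
    obtain ⟨C, hC0, hC⟩ := h.2 K hK hKc
    exact ⟨C, hC0, fun i x y ξ hxy hξ => hC i x y ξ hxy (hR hξ)⟩
  induction n generalizing m f with
  | zero => exact h0 h
  | succ n ih => exact ⟨h0 h.1, fun j => ih (h.2 j)⟩

theorem Symb.reparam {I' : Type*} (h : Symb X Y R e w n m f) (σ : I' → I) :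
    Symb X Y R e w n m (fun i => f (σ i)) := by
  have h0 {m : ℝ} {f : I → Euc nX × Euc nY × Euc N → ℂ} (h : SymbBound X Y R m f) :
      SymbBound X Y R m (fun i => f (σ i)) := by
    refine ⟨fun i => h.1 (σ i), fun K hK hKc => ?_⟩
    obtain ⟨C, hC0, hC⟩ := h.2 K hK hKc
    exact ⟨C, hC0, fun i x y ξ hxy hξ => hC (σ i) x y ξ hxy hξ⟩
  induction n generalizing m f with
  | zero => exact h0 h
  | succ n ih => exact ⟨h0 h.1, fun j => ih (h.2 j)⟩

/-- The linear map that exchanges the first two variables. -/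
def swapXY (nX nY N : ℕ) : (Euc nY × Euc nX × Euc N) →L[ℝ] (Euc nX × Euc nY × Euc N) :=
  ((ContinuousLinearMap.fst ℝ _ _).comp (ContinuousLinearMap.snd ℝ _ _)).prod
    ((ContinuousLinearMap.fst ℝ _ _).prod
      ((ContinuousLinearMap.snd ℝ _ _).comp (ContinuousLinearMap.snd ℝ _ _)))

/-- Through this exchange the transposed operator becomes an instance of the operator itself, so
that only one of them needs estimates. -/
theorem Symb.swap {e' : ι' → Euc nY × Euc nX × Euc N} {w' : ι' → ℝ} (σ : ι' → ι)
    (he : ∀ j, swapXY nX nY N (e' j) = e (σ j)) (hw : ∀ j, w (σ j) = w' j)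
    (h : Symb X Y R e w n m f) :
    Symb Y X R e' w' n m (fun i p => f i (swapXY nX nY N p)) := by
  have hmaps : MapsTo (swapXY nX nY N) (box Y X R) (box X Y R) :=
    fun p hp => ⟨hp.2.1, hp.1, hp.2.2⟩
  have h0 {m : ℝ} {f : I → Euc nX × Euc nY × Euc N → ℂ} (h : SymbBound X Y R m f) :
      SymbBound Y X R m (fun i p => f i (swapXY nX nY N p)) := by
    refine ⟨fun i => (h.1 i).comp (swapXY nX nY N).contDiff.contDiffOn hmaps, fun K hK hKc => ?_⟩
    obtain ⟨C, hC0, hC⟩ := h.2 (Prod.swap '' K) (by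
      rintro _ ⟨p, hp, rfl⟩
      exact ⟨(hK hp).2, (hK hp).1⟩) (hKc.image continuous_swap)
    exact ⟨C, hC0, fun i x y ξ hxy hξ => hC i y x ξ ⟨_, hxy, rfl⟩ hξ⟩
  induction n generalizing m f with
  | zero => exact h0 h
  | succ n ih =>
    refine ⟨h0 h.1, fun j => ?_⟩
    rw [← hw j]
    refine (ih (h.2 (σ j))).congr fun i p hp => ?_
    have hd := (differentiableAt_of_contDiffOn (h.1.1 i) (box X Y R).isOpen
      (hmaps hp)).hasFDerivAt.comp p (swapXY nX nY N).hasFDerivAt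
    rw [← he j]
    change _ = fderiv ℝ (f i ∘ swapXY nX nY N) p (e' j)
    rw [hd.fderiv]
    rfl

/-- The exponential has modulus one, and a derivative only multiplies it by i∂Φ. Therefore the
weight of a direction has to be the order of the corresponding derivative of Φ. -/
theorem symb_exp {Φ : I → Euc nX × Euc nY × Euc N → ℝ}
    (hΦ : ∀ i, ContDiffOn ℝ ∞ (Φ i) (box X Y R))
    (h : ∀ j, Symb X Y R e w n (w j) (fun i p => ((fderiv ℝ (Φ i) p (e j) : ℝ) : ℂ))) :
    Symb X Y R e w n 0 (fun i p => Complex.exp (Complex.I * Φ i p)) := by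
  have hs (i : I) : ContDiffOn ℝ ∞ (fun p => Complex.exp (Complex.I * Φ i p)) (box X Y R) :=
    (contDiffOn_const.mul (Complex.ofRealCLM.contDiff.comp_contDiffOn (hΦ i))).cexp
  have h0 : SymbBound X Y R 0 (fun i p => Complex.exp (Complex.I * Φ i p)) := by
    refine ⟨hs, fun K hK hKc => ⟨1, zero_le_one, fun i x y ξ _ _ => ?_⟩⟩
    change ‖Complex.exp (Complex.I * (Φ i (x, y, ξ) : ℂ))‖ ≤ _
    rw [mul_comm Complex.I, Complex.norm_exp_ofReal_mul_I]
    simp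
  induction n with
  | zero => exact h0
  | succ n ih =>
    refine ⟨h0, fun j => ?_⟩
    have h1 := ((h j).pred.mul (ih fun j => (h j).pred)).const_mul Complex.I
    refine (h1.mono (by linarith)).congr fun i p hp => ?_
    have hd := (differentiableAt_of_contDiffOn (hΦ i) (box X Y R).isOpen hp).hasFDerivAt
    have hc : HasFDerivAt (fun p => (Φ i p : ℂ)) (Complex.ofRealCLM.comp (fderiv ℝ (Φ i) p)) p :=
      Complex.ofRealCLM.hasFDerivAt.comp p hd
    dsimp only
    rw [((hc.const_mul Complex.I).cexp).fderiv]
    simp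
    ring

end Symbols


/-! ### Sources of symbol estimates -/

section Constructors

variable {nX nY N : ℕ} {I ι : Type*} {X : Opens (Euc nX)} {Y : Opens (Euc nY)} {R : Opens (Euc N)}

theorem symb_of_iteratedFDeriv {e : ι → Euc nX × Euc nY × Euc N} {w : ι → ℝ} {n : ℕ} {m : ℝ}
    {f : I → Euc nX × Euc nY × Euc N → ℂ} (hs : ∀ i, ContDiffOn ℝ ∞ (f i) (box X Y R))
    (hb : ∀ (k : ℕ) (s : Fin k → ι), ∀ K ⊆ (X : Set (Euc nX)) ×ˢ (Y : Set (Euc nY)), IsCompact K →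
      ∃ C : ℝ, 0 ≤ C ∧ ∀ i x y ξ, (x, y) ∈ K → ξ ∈ R →
        ‖iteratedFDeriv ℝ k (f i) (x, y, ξ) (fun t => e (s t))‖ ≤
          C * bracket ξ ^ (m + ∑ t, w (s t))) :
    Symb X Y R e w n m f := by
  have h0 {m : ℝ} {f : I → Euc nX × Euc nY × Euc N → ℂ}
      (hs : ∀ i, ContDiffOn ℝ ∞ (f i) (box X Y R))
      (hb : ∀ (k : ℕ) (s : Fin k → ι), ∀ K ⊆ (X : Set (Euc nX)) ×ˢ (Y : Set (Euc nY)),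
        IsCompact K → ∃ C : ℝ, 0 ≤ C ∧ ∀ i x y ξ, (x, y) ∈ K → ξ ∈ R →
        ‖iteratedFDeriv ℝ k (f i) (x, y, ξ) (fun t => e (s t))‖ ≤
          C * bracket ξ ^ (m + ∑ t, w (s t))) : SymbBound X Y R m f := by
    refine ⟨hs, fun K hK hKc => ?_⟩
    simpa using hb 0 Fin.elim0 K hK hKc
  induction n generalizing m f with
  | zero => exact h0 hs hb
  | succ n ih =>
    refine ⟨h0 hs hb, fun j => ih (fun i => ContDiffOn.fderiv_apply_const (hs i)
      (box X Y R).isOpen _) fun k s K hK hKc => ?_⟩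
    obtain ⟨C, hC0, hC⟩ := hb (k + 1) (Fin.snoc s j) K hK hKc
    refine ⟨C, hC0, fun i x y ξ hxy hξ => ?_⟩
    have h1 := hC i x y ξ hxy hξ
    have hp : (x, y, ξ) ∈ (box X Y R : Set _) := ⟨(hK hxy).1, (hK hxy).2, hξ⟩
    have h2 : ContDiffAt ℝ (k + 1) (f i) (x, y, ξ) :=
      ((hs i).contDiffAt ((box X Y R).isOpen.mem_nhds hp)).of_le (by exact_mod_cast le_top)
    rw [iteratedFDeriv_succ_apply_last h2, Fin.sum_univ_castSucc] at h1
    simp only [Fin.snoc_last, Fin.snoc_castSucc] at h1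
    have h3 : (Fin.init fun t => e ((Fin.snoc s j : Fin (k + 1) → ι) t)) = fun t => e (s t) := by
      ext1 t
      simp [Fin.init]
    rw [h3] at h1
    rw [add_assoc, add_comm (w j)]
    exact h1

/-- The change of the order of a symbol of type `(ρ, δ)` by a coordinate derivative. -/
def stdWeight (ρ δ : ℝ) : Idx nX nY N → ℝ
  | .inr (.inr _) => -ρ
  | _ => δ

theorem sum_stdWeight (ρ δ : ℝ) {k : ℕ} (s : Fin k → Idx nX nY N) :
    ∑ t, stdWeight ρ δ (s t) = -ρ * xiOrder s + δ * xyOrder s := by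
  simp only [xiOrder, xyOrder, Nat.cast_sum, Finset.mul_sum, ← Finset.sum_add_distrib]
  refine Finset.sum_congr rfl fun t _ => ?_
  rcases s t with j | j | j <;> simp [stdWeight]

/-- The change of the degree of a homogeneous function by a coordinate derivative. -/
def xiDeg : Idx nX nY N → ℝ
  | .inr (.inr _) => 1
  | _ => 0

theorem symb_of_mem_amplitude {d ρ δ : ℝ} (a : Amplitude X Y N d ρ δ) (n : ℕ) :
    Symb X Y (punctured N) dir (stdWeight ρ δ) n d (fun (_ : I) => a.1.1) := by
  obtain ⟨b, hb, hab⟩ := a.2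
  refine symb_of_iteratedFDeriv (fun _ => a.1.2.1) fun k s K hK hKc => ?_
  obtain ⟨C, hC⟩ := hb.2 k s K hKc hK
  refine ⟨max C 0, le_max_right _ _, fun i x y ξ hxy hξ => ?_⟩
  have h2 : iteratedFDeriv ℝ k a.1.1 (x, y, ξ) = iteratedFDeriv ℝ k b (x, y, ξ) :=
    ((hab.eventuallyEq_of_mem ((dom X Y N).isOpen.mem_nhds (show (x, y, ξ) ∈ dom X Y N from
      ⟨(hK hxy).1, (hK hxy).2, hξ⟩))).iteratedFDeriv ℝ _).eq_of_nhds
  rw [h2, sum_stdWeight, ← add_assoc, neg_mul, ← sub_eq_add_neg]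
  exact (hC x y hxy ξ).trans (mul_le_mul_of_nonneg_right (le_max_left _ _)
    (Real.rpow_nonneg (bracket_pos ξ).le _))

/-! ### Homogeneous functions -/

/-- `f` is positively homogeneous of degree `m` in `ξ` on `X × Y × Ξ`. -/
def HomogeneousXi {F : Type*} [SMul ℝ F] (X : Opens (Euc nX)) (Y : Opens (Euc nY)) (m : ℝ)
    (f : Euc nX × Euc nY × Euc N → F) : Prop :=
  ∀ x ∈ X, ∀ y ∈ Y, ∀ ξ : Euc N, ξ ≠ 0 → ∀ t : ℝ, 0 < t → f (x, y, t • ξ) = t ^ m • f (x, y, ξ)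

/-- Differentiate f ∘ D = t^m f, where D dilates ξ by t. The direction `dir j` is an eigenvector of
D with eigenvalue t^{xiDeg j}. -/
theorem HomogeneousXi.fderiv_apply {F : Type*} [NormedAddCommGroup F] [NormedSpace ℝ F] {m : ℝ}
    {f : Euc nX × Euc nY × Euc N → F} (h : HomogeneousXi X Y m f)
    (hf : ContDiffOn ℝ ∞ f (box X Y (punctured N))) (j : Idx nX nY N) :
    HomogeneousXi X Y (m - xiDeg j) (fun p => fderiv ℝ f p (dir j)) := by
  intro x hx y hy ξ hξ t ht
  let D : (Euc nX × Euc nY × Euc N) →L[ℝ] (Euc nX × Euc nY × Euc N) :=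
    (ContinuousLinearMap.fst ℝ _ _).prod
      (((ContinuousLinearMap.fst ℝ _ _).comp (ContinuousLinearMap.snd ℝ _ _)).prod
        (t • (ContinuousLinearMap.snd ℝ _ _).comp (ContinuousLinearMap.snd ℝ _ _)))
  have hD (p : Euc nX × Euc nY × Euc N) : D p = (p.1, p.2.1, t • p.2.2) := rfl
  have hU := (box X Y (punctured N)).isOpen
  have hp : (x, y, ξ) ∈ (box X Y (punctured N) : Set _) := ⟨hx, hy, hξ⟩
  have hp' : D (x, y, ξ) ∈ (box X Y (punctured N) : Set _) :=
    ⟨hx, hy, smul_ne_zero ht.ne' hξ⟩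
  have h1 : fderiv ℝ (f ∘ D) (x, y, ξ) = (fderiv ℝ f (D (x, y, ξ))).comp D :=
    ((differentiableAt_of_contDiffOn hf hU hp').hasFDerivAt.comp _ D.hasFDerivAt).fderiv
  have h2 : fderiv ℝ (f ∘ D) (x, y, ξ) = t ^ m • fderiv ℝ f (x, y, ξ) := by
    have : EqOn (f ∘ D) (t ^ m • f) (box X Y (punctured N)) := fun p hp =>
      h p.1 hp.1 p.2.1 hp.2.1 p.2.2 hp.2.2 t ht
    rw [fderiv_eq_of_eqOn hU this hp,
      fderiv_const_smul (differentiableAt_of_contDiffOn hf hU hp)]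
  have h3 : fderiv ℝ f (D (x, y, ξ)) (D (dir j)) = t ^ m • fderiv ℝ f (x, y, ξ) (dir j) := by
    have := congrArg (fun L => L (dir j)) (h1.symm.trans h2)
    simpa using this
  have h4 : D (dir j) = t ^ xiDeg j • dir j := by
    rcases j with j | j | j <;> simp [hD, dir, xiDeg]
  rw [h4, map_smul] at h3
  have h5 : (t ^ xiDeg j)⁻¹ * t ^ m = t ^ (m - xiDeg j) := by
    rw [Real.rpow_sub ht]
    field_simp
  change fderiv ℝ f (D (x, y, ξ)) (dir j) = _
  rw [← h5, mul_smul, ← h3, inv_smul_smul₀ (Real.rpow_pos_of_pos ht _).ne']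

theorem isCompact_assoc {K : Set (Euc nX × Euc nY)} (hK : IsCompact K) {L : Set (Euc N)}
    (hL : IsCompact L) :
    IsCompact {p : Euc nX × Euc nY × Euc N | (p.1, p.2.1) ∈ K ∧ p.2.2 ∈ L} := by
  convert (hK.prod hL).image (f := fun q : (Euc nX × Euc nY) × Euc N => (q.1.1, q.1.2, q.2))
    (by fun_prop) using 1
  ext ⟨x, y, ξ⟩
  simp

theorem HomogeneousXi.exists_bound {m : ℝ} {f : Euc nX × Euc nY × Euc N → ℂ}
    (h : HomogeneousXi X Y m f) (hf : ContinuousOn f (box X Y (punctured N)))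
    {K : Set (Euc nX × Euc nY)} (hK : K ⊆ (X : Set (Euc nX)) ×ˢ (Y : Set (Euc nY)))
    (hKc : IsCompact K) : ∃ C : ℝ, 0 ≤ C ∧ ∀ x y ξ, (x, y) ∈ K → ξ ≠ 0 →
      ‖f (x, y, ξ)‖ ≤ C * ‖ξ‖ ^ m := by
  obtain ⟨C, hC⟩ := (isCompact_assoc hKc (isCompact_sphere (0 : Euc N) 1)).exists_bound_of_continuousOn
    (hf.mono (by
      rintro ⟨x, y, ξ⟩ ⟨hxy, hξ⟩
      refine ⟨(hK hxy).1, (hK hxy).2, ?_⟩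
      rintro rfl
      simp at hξ))
  refine ⟨max C 0, le_max_right _ _, fun x y ξ hxy hξ => ?_⟩
  have hn : 0 < ‖ξ‖ := norm_pos_iff.2 hξ
  have h1 := h x (hK hxy).1 y (hK hxy).2 (‖ξ‖⁻¹ • ξ) (smul_ne_zero (inv_ne_zero hn.ne') hξ) ‖ξ‖ hn
  rw [smul_inv_smul₀ hn.ne'] at h1
  rw [h1, norm_smul, Real.norm_of_nonneg (Real.rpow_nonneg hn.le _), mul_comm]
  refine mul_le_mul_of_nonneg_right ((hC _ ⟨hxy, ?_⟩).trans (le_max_left _ _))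
    (Real.rpow_nonneg hn.le _)
  simp [norm_smul, hn.ne']

/-- Homogeneity bounds f by ‖ξ‖^m, which is controlled by ⟨ξ⟩^m near ξ = 0 only if m ≥ 0. The set
`S` collects the degrees that arise under repeated differentiation: all reals away from the origin,
but only {1} for x-derivatives of the phase up to the origin. -/
theorem HomogeneousXi.symb {m : ℝ} {f : Euc nX × Euc nY × Euc N → ℂ} {w : ι → ℝ}
    (h : HomogeneousXi X Y m f) (hf : ContDiffOn ℝ ∞ f (box X Y (punctured N)))
    (hR : R ≤ punctured N) (σ : ι → Idx nX nY N) (hw : ∀ j, -xiDeg (σ j) ≤ w j) (S : Set ℝ)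
    (hm : m ∈ S) (hS : ∀ m ∈ S, ∀ j, m - xiDeg (σ j) ∈ S)
    (hSR : ∀ m ∈ S, ∃ C, 0 ≤ C ∧ ∀ ξ ∈ R, ‖ξ‖ ^ m ≤ C * bracket ξ ^ m) (n : ℕ) :
    Symb X Y R (fun j => dir (σ j)) w n m (fun (_ : I) => f) := by
  have h0 {m : ℝ} {f : Euc nX × Euc nY × Euc N → ℂ}
      (h : HomogeneousXi X Y m f) (hf : ContDiffOn ℝ ∞ f (box X Y (punctured N))) (hm : m ∈ S) :
      SymbBound X Y R m (fun (_ : I) => f) := by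
    refine ⟨fun _ => hf.mono fun p hp => ⟨hp.1, hp.2.1, hR hp.2.2⟩, fun K hK hKc => ?_⟩
    obtain ⟨C, hC0, hC⟩ := h.exists_bound hf.continuousOn hK hKc
    obtain ⟨D, hD0, hD⟩ := hSR m hm
    refine ⟨C * D, mul_nonneg hC0 hD0, fun _ x y ξ hxy hξ => (hC x y ξ hxy (hR hξ)).trans ?_⟩
    rw [mul_assoc]
    exact mul_le_mul_of_nonneg_left (hD ξ hξ) hC0
  induction n generalizing m f with
  | zero => exact h0 h hf hm
  | succ n ih =>
    refine ⟨h0 h hf hm, fun j => ?_⟩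
    refine (ih (h.fderiv_apply hf (σ j)) (ContDiffOn.fderiv_apply_const hf
      (box X Y (punctured N)).isOpen _) (hS m hm j)).mono ?_
    linarith [hw j]

/-- The open set `{‖ξ‖ > 1/2}`. -/
def outer (N : ℕ) : Opens (Euc N) :=
  ⟨{ξ | 1 / 2 < ‖ξ‖}, isOpen_lt continuous_const continuous_norm⟩

theorem outer_le_punctured : outer N ≤ punctured N := by
  rintro ξ (hξ : 1 / 2 < ‖ξ‖) (h0 : ξ = 0)
  rw [h0, norm_zero] at hξ
  norm_num at hξ

theorem norm_le_bracket (ξ : Euc N) : ‖ξ‖ ≤ bracket ξ :=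
  Real.le_sqrt_of_sq_le (by linarith)

theorem bracket_le_of_mem_outer {ξ : Euc N} (hξ : ξ ∈ outer N) : bracket ξ ≤ 3 * ‖ξ‖ := by
  have h : 1 / 2 < ‖ξ‖ := hξ
  refine Real.sqrt_le_iff.2 ⟨by positivity, ?_⟩
  nlinarith

theorem norm_rpow_le_of_nonneg {m : ℝ} (hm : 0 ≤ m) (ξ : Euc N) : ‖ξ‖ ^ m ≤ bracket ξ ^ m :=
  Real.rpow_le_rpow (norm_nonneg _) (norm_le_bracket ξ) hm

theorem norm_rpow_le_of_mem_outer (m : ℝ) :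
    ∃ C, 0 ≤ C ∧ ∀ ξ ∈ outer N, ‖ξ‖ ^ m ≤ C * bracket ξ ^ m := by
  rcases le_total 0 m with hm | hm
  · exact ⟨1, zero_le_one, fun ξ _ => by simpa using norm_rpow_le_of_nonneg hm ξ⟩
  -- A nonpositive exponent reverses ⟨ξ⟩/3 ≤ ‖ξ‖, which holds for ‖ξ‖ > 1/2.
  · refine ⟨(3⁻¹ : ℝ) ^ m, by positivity, fun ξ hξ => ?_⟩
    rw [← Real.mul_rpow (by norm_num) (bracket_pos ξ).le]
    refine Real.rpow_le_rpow_of_nonpos (mul_pos (by norm_num) (bracket_pos ξ)) ?_ hm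
    linarith [bracket_le_of_mem_outer hξ]

theorem HomogeneousXi.symb_outer {m ρ δ : ℝ} {f : Euc nX × Euc nY × Euc N → ℂ}
    (h : HomogeneousXi X Y m f) (hf : ContDiffOn ℝ ∞ f (box X Y (punctured N)))
    (hρ : ρ ≤ 1) (hδ : 0 ≤ δ) (n : ℕ) :
    Symb X Y (outer N) dir (stdWeight ρ δ) n m (fun (_ : I) => f) :=
  h.symb hf outer_le_punctured id
    (by rintro (j | j | j) <;> simp [xiDeg, stdWeight, hρ, hδ]) univ (mem_univ _)
    (fun _ _ _ => mem_univ _) (fun m _ => norm_rpow_le_of_mem_outer m) n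

theorem continuous_bracket : Continuous (bracket : Euc N → ℝ) := by
  unfold bracket
  fun_prop

/-- On the compact shell 1/2 ≤ ‖ξ‖ ≤ 2 all powers of ⟨ξ⟩ are comparable, so such a function has
every order and the weights do not matter. The cutoff χ is the intended example. -/
theorem symb_of_eq_zero {e : ι → Euc nX × Euc nY × Euc N} {w : ι → ℝ} {m : ℝ}
    {f : Euc nX × Euc nY × Euc N → ℂ} (hf : ContDiffOn ℝ ∞ f (box X Y (punctured N)))
    (h0 : ∀ p ∈ box X Y (punctured N), 2 < ‖p.2.2‖ → f p = 0) (n : ℕ) :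
    Symb X Y (outer N) e w n m (fun (_ : I) => f) := by
  have hb {m : ℝ} {f : Euc nX × Euc nY × Euc N → ℂ}
      (hf : ContDiffOn ℝ ∞ f (box X Y (punctured N)))
      (h0 : ∀ p ∈ box X Y (punctured N), 2 < ‖p.2.2‖ → f p = 0) :
      SymbBound X Y (outer N) m (fun (_ : I) => f) := by
    refine ⟨fun _ => hf.mono fun p hp => ⟨hp.1, hp.2.1, outer_le_punctured hp.2.2⟩,
      fun K hK hKc => ?_⟩
    have hL : IsCompact {ξ : Euc N | 1 / 2 ≤ ‖ξ‖ ∧ ‖ξ‖ ≤ 2} := by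
      have : {ξ : Euc N | 1 / 2 ≤ ‖ξ‖ ∧ ‖ξ‖ ≤ 2} =
          Metric.closedBall 0 2 ∩ {ξ | 1 / 2 ≤ ‖ξ‖} := by
        ext ξ
        simp [and_comm]
      rw [this]
      exact (isCompact_closedBall _ _).inter_right (isClosed_le continuous_const continuous_norm)
    have hg : ContinuousOn (fun p => ((bracket p.2.2 ^ (-m) : ℝ) : ℂ) * f p)
        (box X Y (punctured N)) := by
      refine ContinuousOn.mul ?_ hf.continuousOn
      refine (Complex.continuous_ofReal.comp ?_).continuousOn
      exact (continuous_bracket.comp (by fun_prop)).rpow_const fun p =>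
        Or.inl (bracket_pos _).ne'
    obtain ⟨C, hC⟩ := (isCompact_assoc hKc hL).exists_bound_of_continuousOn (hg.mono (by
      rintro ⟨x, y, ξ⟩ ⟨hxy, hξ, -⟩
      refine ⟨(hK hxy).1, (hK hxy).2, ?_⟩
      rintro rfl
      norm_num at hξ))
    refine ⟨max C 0, le_max_right _ _, fun _ x y ξ hxy hξ => ?_⟩
    rcases le_or_gt ‖ξ‖ 2 with h2 | h2
    · have h1 := (hC (x, y, ξ) ⟨hxy, le_of_lt hξ, h2⟩).trans (le_max_left C 0)
      have hpos := Real.rpow_pos_of_pos (bracket_pos ξ) m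
      rw [norm_mul, Complex.norm_real, Real.norm_of_nonneg (Real.rpow_nonneg (bracket_pos ξ).le _),
        Real.rpow_neg (bracket_pos ξ).le, inv_mul_le_iff₀ hpos] at h1
      rwa [mul_comm]
    · dsimp only
      rw [h0 (x, y, ξ) ⟨(hK hxy).1, (hK hxy).2, outer_le_punctured hξ⟩ h2, norm_zero]
      exact mul_nonneg (le_max_right _ _) (Real.rpow_nonneg (bracket_pos ξ).le _)
  induction n generalizing m f with
  | zero => exact hb hf h0
  | succ n ih =>
    refine ⟨hb hf h0, fun j => ih (ContDiffOn.fderiv_apply_const hf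
      (box X Y (punctured N)).isOpen _) fun p hp h2 => ?_⟩
    have hU : IsOpen ((box X Y (punctured N) : Set _) ∩
        {p : Euc nX × Euc nY × Euc N | 2 < ‖p.2.2‖}) :=
      (box X Y (punctured N)).isOpen.inter (isOpen_lt continuous_const (by fun_prop))
    rw [fderiv_eq_zero_of_eqOn hU (fun q hq => h0 q hq.1 hq.2) ⟨hp, h2⟩]
    rfl

/-- A family of smooth functions whose derivatives of each order are uniformly bounded. -/
def IsBoundedFamily (ψ : I → Euc nY → ℂ) : Prop :=
  (∀ i, ContDiff ℝ ∞ (ψ i)) ∧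
    ∀ k : ℕ, ∃ C : ℝ, 0 ≤ C ∧ ∀ i y, ‖iteratedFDeriv ℝ k (ψ i) y‖ ≤ C

theorem IsBoundedFamily.fderiv_apply {ψ : I → Euc nY → ℂ} (h : IsBoundedFamily ψ) (v : Euc nY) :
    IsBoundedFamily (fun i y => fderiv ℝ (ψ i) y v) := by
  have hs (i : I) : ContDiff ℝ ∞ (fderiv ℝ (ψ i)) := (h.1 i).fderiv_right (m := ∞) (by simp)
  refine ⟨fun i => (hs i).clm_apply contDiff_const, fun k => ?_⟩
  obtain ⟨C, hC0, hC⟩ := h.2 (k + 1)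
  refine ⟨‖v‖ * C, mul_nonneg (norm_nonneg _) hC0, fun i y => ?_⟩
  refine (norm_iteratedFDeriv_clm_apply_const (hs i).contDiffAt (by exact_mod_cast le_top)).trans ?_
  rw [norm_iteratedFDeriv_fderiv]
  exact mul_le_mul_of_nonneg_left (hC i y) (norm_nonneg _)

/-- Test functions are symbols of order 0: directions without a y-component annihilate them, and
y-derivatives stay bounded. The uniformity in the index is what later proves continuity of the
operator. -/
theorem IsBoundedFamily.symb {ψ : I → Euc nY → ℂ} (h : IsBoundedFamily ψ)
    {e : ι → Euc nX × Euc nY × Euc N} {w : ι → ℝ} (hw : ∀ j, (e j).2.1 = 0 ∨ 0 ≤ w j) {m : ℝ}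
    (hm : 0 ≤ m) (n : ℕ) :
    Symb X Y R e w n m (fun i p => ψ i p.2.1) := by
  have hb {m : ℝ} {ψ : I → Euc nY → ℂ} (h : IsBoundedFamily ψ) (hm : 0 ≤ m) :
      SymbBound X Y R m (fun i p => ψ i p.2.1) := by
    refine ⟨fun i => ((h.1 i).comp (by fun_prop)).contDiffOn, fun K hK hKc => ?_⟩
    obtain ⟨C, hC0, hC⟩ := h.2 0
    refine ⟨C, hC0, fun i x y ξ _ _ => ?_⟩
    have := hC i y
    rw [norm_iteratedFDeriv_zero] at this
    exact this.trans (le_mul_of_one_le_right hC0 (Real.one_le_rpow (one_le_bracket ξ) hm))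
  induction n generalizing m ψ with
  | zero => exact hb h hm
  | succ n ih =>
    refine ⟨hb h hm, fun j => ?_⟩
    have hd (i : I) (p : Euc nX × Euc nY × Euc N) : fderiv ℝ (fun p => ψ i p.2.1) p (e j) =
        fderiv ℝ (ψ i) p.2.1 (e j).2.1 := by
      have h1 := ((h.1 i).differentiable (by simp) p.2.1).hasFDerivAt.comp p
        ((ContinuousLinearMap.fst ℝ (Euc nY) (Euc N)).comp
          (ContinuousLinearMap.snd ℝ (Euc nX) (Euc nY × Euc N))).hasFDerivAt
      exact congrArg (fun L => L (e j)) h1.fderiv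
    refine Symb.congr (f := fun i p => fderiv ℝ (ψ i) p.2.1 (e j).2.1) ?_
      (fun i p _ => (hd i p).symm)
    rcases hw j with h0 | h0
    · simpa [h0] using symb_zero
    · exact ih (h.fderiv_apply _) (by linarith)

end Constructors


/-! ### The regularizing operator and its gain in order -/

section Regularization

variable {nX nY N : ℕ} {I : Type*} {X : Opens (Euc nX)} {Y : Opens (Euc nY)}

/-- The function `r` of the phase `Φ` with respect to the variables `(y, ξ)`. -/
noncomputable def phaseR (Φ : Euc nX × Euc nY × Euc N → ℝ) (p : Euc nX × Euc nY × Euc N) : ℝ :=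
  ∑ l, ‖p.2.2‖ ^ 2 * (fderiv ℝ Φ p (dir (.inr (.inr l)))) ^ 2 +
    ∑ k, (fderiv ℝ Φ p (dir (.inr (.inl k)))) ^ 2

/-- A smooth phase function, homogeneous of degree one in `ξ` and without critical points in the
variables `(y, ξ)`. -/
structure IsPhase (X : Opens (Euc nX)) (Y : Opens (Euc nY))
    (Φ : Euc nX × Euc nY × Euc N → ℝ) : Prop where
  contDiffOn : ContDiffOn ℝ ∞ Φ (box X Y (punctured N))
  homogeneous : HomogeneousXi X Y 1 Φ
  phaseR_pos : ∀ p ∈ box X Y (punctured N), 0 < phaseR Φ p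

/-- The factor `1` for `y`-derivatives and `‖ξ‖²` for `ξ`-derivatives. -/
noncomputable def coordFactor (j : Fin nY ⊕ Fin N) (ξ : Euc N) : ℝ :=
  j.elim (fun _ => 1) (fun _ => ‖ξ‖ ^ 2)

/-- The coefficients of the regularizing operator without the cutoff. -/
noncomputable def coeffHom (Φ : Euc nX × Euc nY × Euc N → ℝ) (j : Fin nY ⊕ Fin N)
    (p : Euc nX × Euc nY × Euc N) : ℂ :=
  -Complex.I / (phaseR Φ p : ℂ) * (coordFactor j p.2.2 : ℝ) *
    ((fderiv ℝ Φ p (dir (.inr j)) : ℝ) : ℂ)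

/-- The coefficients of the regularizing operator. -/
noncomputable def coeff (χ : Euc N → ℂ) (Φ : Euc nX × Euc nY × Euc N → ℝ) (j : Fin nY ⊕ Fin N)
    (p : Euc nX × Euc nY × Euc N) : ℂ :=
  (1 - χ p.2.2) * coeffHom Φ j p

/-- The regularizing operator in the variables `(y, ξ)`, acting on functions of `(x, y, ξ)`. -/
noncomputable def regOpParam (χ : Euc N → ℂ) (Φ : Euc nX × Euc nY × Euc N → ℝ)
    (f : Euc nX × Euc nY × Euc N → ℂ) (p : Euc nX × Euc nY × Euc N) : ℂ :=
  -(∑ j, fderiv ℝ (fun q => coeff χ Φ j q * f q) p (dir (.inr j))) + χ p.2.2 * f p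

variable {χ : Euc N → ℂ} {Φ : Euc nX × Euc nY × Euc N → ℝ}

theorem contDiff_snd_snd {F : Type*} [NormedAddCommGroup F] [NormedSpace ℝ F] {g : Euc N → F}
    (hg : ContDiff ℝ ∞ g) : ContDiff ℝ ∞ (fun p : Euc nX × Euc nY × Euc N => g p.2.2) :=
  hg.comp (by fun_prop)

theorem contDiff_coordFactor (j : Fin nY ⊕ Fin N) : ContDiff ℝ ∞ (coordFactor j : Euc N → ℝ) := by
  rcases j with j | j
  · exact contDiff_const
  · exact contDiff_norm_sq ℝ

theorem IsPhase.contDiffOn_fderiv (h : IsPhase X Y Φ) (v : Euc nX × Euc nY × Euc N) :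
    ContDiffOn ℝ ∞ (fun p => fderiv ℝ Φ p v) (box X Y (punctured N)) :=
  ContDiffOn.fderiv_apply_const h.contDiffOn (box X Y (punctured N)).isOpen v

theorem IsPhase.contDiffOn_phaseR (h : IsPhase X Y Φ) :
    ContDiffOn ℝ ∞ (phaseR Φ) (box X Y (punctured N)) := by
  refine (ContDiffOn.sum fun l _ => ?_).add (ContDiffOn.sum fun k _ => ?_)
  · exact (contDiff_snd_snd (contDiff_norm_sq ℝ)).contDiffOn.mul ((h.contDiffOn_fderiv _).pow 2)
  · exact (h.contDiffOn_fderiv _).pow 2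

theorem ContDiffOn.ofReal {E : Type*} [NormedAddCommGroup E] [NormedSpace ℝ E] {f : E → ℝ}
    {U : Set E} (hf : ContDiffOn ℝ ∞ f U) : ContDiffOn ℝ ∞ (fun p => (f p : ℂ)) U :=
  Complex.ofRealCLM.contDiff.comp_contDiffOn hf

theorem IsPhase.contDiffOn_coeffHom (h : IsPhase X Y Φ) (j : Fin nY ⊕ Fin N) :
    ContDiffOn ℝ ∞ (coeffHom Φ j) (box X Y (punctured N)) := by
  unfold coeffHom
  simp only [div_eq_mul_inv]
  refine ((contDiffOn_const.mul (h.contDiffOn_phaseR.ofReal.inv fun p hp => ?_)).mul ?_).mul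
    (h.contDiffOn_fderiv _).ofReal
  · exact Complex.ofReal_ne_zero.2 (h.phaseR_pos p hp).ne'
  · exact (contDiff_snd_snd (contDiff_coordFactor j)).contDiffOn.ofReal

theorem IsPhase.contDiffOn_coeff (h : IsPhase X Y Φ) (hχ : IsCutoff χ) (j : Fin nY ⊕ Fin N) :
    ContDiffOn ℝ ∞ (coeff χ Φ j) (box X Y (punctured N)) :=
  (contDiff_snd_snd (contDiff_const.sub hχ.contDiff)).contDiffOn.mul (h.contDiffOn_coeffHom j)

/-- Count degrees: r has degree 2, ∂_yΦ has degree 1, and ‖ξ‖²∂_ξΦ has degree 2. -/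
theorem IsPhase.homogeneous_coeffHom (h : IsPhase X Y Φ) (j : Fin nY ⊕ Fin N) :
    HomogeneousXi X Y (j.elim (fun _ => -1) (fun _ => 0)) (coeffHom Φ j) := by
  intro x hx y hy ξ hξ t ht
  have hY (k : Fin nY) : fderiv ℝ Φ (x, y, t • ξ) (dir (.inr (.inl k))) =
      t * fderiv ℝ Φ (x, y, ξ) (dir (.inr (.inl k))) := by
    have := h.homogeneous.fderiv_apply h.contDiffOn (.inr (.inl k)) x hx y hy ξ hξ t ht
    simpa [xiDeg] using this
  have hN (l : Fin N) : fderiv ℝ Φ (x, y, t • ξ) (dir (.inr (.inr l))) =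
      fderiv ℝ Φ (x, y, ξ) (dir (.inr (.inr l))) := by
    have := h.homogeneous.fderiv_apply h.contDiffOn (.inr (.inr l)) x hx y hy ξ hξ t ht
    simpa [xiDeg] using this
  have hr : phaseR Φ (x, y, t • ξ) = t ^ 2 * phaseR Φ (x, y, ξ) := by
    simp only [phaseR, hY, hN, norm_smul, Real.norm_of_nonneg ht.le, mul_add, Finset.mul_sum]
    congr 1 <;> refine Finset.sum_congr rfl fun _ _ => by ring
  have hr0 : (phaseR Φ (x, y, ξ) : ℂ) ≠ 0 :=
    Complex.ofReal_ne_zero.2 (h.phaseR_pos (x, y, ξ) ⟨hx, hy, hξ⟩).ne'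
  have ht0 : (t : ℂ) ≠ 0 := Complex.ofReal_ne_zero.2 ht.ne'
  rcases j with k | l
  · simp only [coeffHom, hY, hr, coordFactor, Sum.elim_inl, Real.rpow_neg_one, Complex.real_smul]
    push_cast
    field_simp
  · simp only [coeffHom, hN, hr, coordFactor, Sum.elim_inr, Real.rpow_zero, Complex.real_smul,
      norm_smul, Real.norm_of_nonneg ht.le]
    push_cast
    field_simp

theorem coeff_eq_zero (hχ : IsCutoff χ) (j : Fin nY ⊕ Fin N) {p : Euc nX × Euc nY × Euc N}
    (hp : ‖p.2.2‖ < 1) : coeff χ Φ j p = 0 := by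
  simp [coeff, hχ.eq_one _ hp]

theorem symb_cutoff (hχ : IsCutoff χ) {ι : Type*} {e : ι → Euc nX × Euc nY × Euc N} {w : ι → ℝ}
    {m : ℝ} (n : ℕ) : Symb X Y (outer N) e w n m (fun (_ : I) p => χ p.2.2) :=
  symb_of_eq_zero (contDiff_snd_snd hχ.contDiff).contDiffOn (fun _ _ h2 => hχ.eq_zero _ h2) n

theorem IsPhase.symb_coeff (h : IsPhase X Y Φ) (hχ : IsCutoff χ) (j : Fin nY ⊕ Fin N) {ρ δ : ℝ}
    (hρ : ρ ≤ 1) (hδ : 0 ≤ δ) (n : ℕ) :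
    Symb X Y (outer N) dir (stdWeight ρ δ) n (j.elim (fun _ => -1) (fun _ => 0))
      (fun (_ : I) => coeff χ Φ j) := by
  have h1 : Symb X Y (outer N) dir (stdWeight ρ δ) n 0 (fun (_ : I) p => 1 + -χ p.2.2) :=
    (symb_const 1 le_rfl).add (symb_cutoff hχ n).neg
  refine ((h1.mul ((h.homogeneous_coeffHom j).symb_outer (h.contDiffOn_coeffHom j) hρ hδ n)).mono
    (zero_add _).le).congr fun _ p _ => ?_
  simp [coeff, sub_eq_add_neg]

theorem contDiffOn_coeff_mul (h : IsPhase X Y Φ) (hχ : IsCutoff χ)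
    {f : Euc nX × Euc nY × Euc N → ℂ} (hf : ContDiffOn ℝ ∞ f (box X Y (punctured N)))
    (j : Fin nY ⊕ Fin N) :
    ContDiffOn ℝ ∞ (fun q => coeff χ Φ j q * f q) (box X Y (punctured N)) :=
  (h.contDiffOn_coeff hχ j).mul hf

theorem contDiffOn_regOpParam (h : IsPhase X Y Φ) (hχ : IsCutoff χ)
    {f : Euc nX × Euc nY × Euc N → ℂ} (hf : ContDiffOn ℝ ∞ f (box X Y (punctured N))) :
    ContDiffOn ℝ ∞ (regOpParam χ Φ f) (box X Y (punctured N)) := by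
  refine (ContDiffOn.neg (ContDiffOn.sum fun j _ => ?_)).add
    ((contDiff_snd_snd hχ.contDiff).contDiffOn.mul hf)
  exact ContDiffOn.fderiv_apply_const (contDiffOn_coeff_mul h hχ hf j)
    (box X Y (punctured N)).isOpen _

theorem contDiffOn_regOpParam_iterate (h : IsPhase X Y Φ) (hχ : IsCutoff χ)
    {f : Euc nX × Euc nY × Euc N → ℂ} (hf : ContDiffOn ℝ ∞ f (box X Y (punctured N))) (κ : ℕ) :
    ContDiffOn ℝ ∞ ((regOpParam χ Φ)^[κ] f) (box X Y (punctured N)) := by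
  induction κ with
  | zero => exact hf
  | succ κ ih =>
    rw [Function.iterate_succ_apply']
    exact contDiffOn_regOpParam h hχ ih

/-- A y-term changes the order by -1 from its coefficient and δ from the derivative, a ξ-term by 0
and -ρ; both gain at least min(ρ, 1 - δ). The term with χ has arbitrarily low order. -/
theorem symb_regOpParam (h : IsPhase X Y Φ) (hχ : IsCutoff χ) {ρ δ m : ℝ}
    (hρ : ρ ≤ 1) (hδ : 0 ≤ δ) {f : I → Euc nX × Euc nY × Euc N → ℂ}
    (hf : ∀ n, Symb X Y (outer N) dir (stdWeight ρ δ) n m f) (n : ℕ) :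
    Symb X Y (outer N) dir (stdWeight ρ δ) n (m - min ρ (1 - δ))
      (fun i => regOpParam χ Φ (f i)) := by
  refine (Symb.neg (Symb.sum _ fun j _ => ?_)).add ?_
  · have h1 := ((h.symb_coeff hχ j hρ hδ (n + 1)).mul (hf (n + 1))).2 (.inr j)
    refine h1.mono ?_
    rcases j with j | j
    · simp only [Sum.elim_inl, stdWeight]
      linarith [min_le_right ρ (1 - δ)]
    · simp only [Sum.elim_inr, stdWeight]
      linarith [min_le_left ρ (1 - δ)]
  · exact ((symb_cutoff hχ n (m := -min ρ (1 - δ))).mul (hf n)).mono (by linarith)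

theorem symb_regOpParam_iterate (h : IsPhase X Y Φ) (hχ : IsCutoff χ) {ρ δ m : ℝ}
    (hρ : ρ ≤ 1) (hδ : 0 ≤ δ) {f : I → Euc nX × Euc nY × Euc N → ℂ}
    (hf : ∀ n, Symb X Y (outer N) dir (stdWeight ρ δ) n m f) (κ n : ℕ) :
    Symb X Y (outer N) dir (stdWeight ρ δ) n (m - κ * min ρ (1 - δ))
      (fun i => (regOpParam χ Φ)^[κ] (f i)) := by
  induction κ generalizing n with
  | zero => simpa using hf n
  | succ κ ih =>
    simp only [Function.iterate_succ_apply']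
    refine (symb_regOpParam h hχ hρ hδ ih n).mono ?_
    push_cast
    linarith

/-- Near ξ = 0 the operator is the identity, so possible singularities of the homogeneous
coefficients there never enter. -/
theorem regOpParam_of_norm_lt (hχ : IsCutoff χ) (f : Euc nX × Euc nY × Euc N → ℂ)
    {p : Euc nX × Euc nY × Euc N} (hp : ‖p.2.2‖ < 1) : regOpParam χ Φ f p = f p := by
  have hU : IsOpen {p : Euc nX × Euc nY × Euc N | ‖p.2.2‖ < 1} :=
    isOpen_lt (by fun_prop) continuous_const
  have h0 (j : Fin nY ⊕ Fin N) : fderiv ℝ (fun q => coeff χ Φ j q * f q) p = 0 :=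
    fderiv_eq_zero_of_eqOn hU (fun q hq => by rw [coeff_eq_zero hχ j hq, zero_mul]) hp
  simp [regOpParam, h0, hχ.eq_one _ hp]

theorem regOpParam_iterate_of_norm_lt (hχ : IsCutoff χ) (f : Euc nX × Euc nY × Euc N → ℂ) (κ : ℕ)
    {p : Euc nX × Euc nY × Euc N} (hp : ‖p.2.2‖ < 1) : (regOpParam χ Φ)^[κ] f p = f p := by
  induction κ with
  | zero => rfl
  | succ κ ih => rw [Function.iterate_succ_apply', regOpParam_of_norm_lt hχ _ hp, ih]

theorem regOpParam_eq_zero {S : Set (Euc nY)} (hS : IsClosed S)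
    {f : Euc nX × Euc nY × Euc N → ℂ} (hf : ∀ p, p.2.1 ∉ S → f p = 0)
    (p : Euc nX × Euc nY × Euc N) (hp : p.2.1 ∉ S) : regOpParam χ Φ f p = 0 := by
  have hU : IsOpen {p : Euc nX × Euc nY × Euc N | p.2.1 ∉ S} :=
    hS.isOpen_compl.preimage (by fun_prop)
  have h0 (j : Fin nY ⊕ Fin N) : fderiv ℝ (fun q => coeff χ Φ j q * f q) p = 0 :=
    fderiv_eq_zero_of_eqOn hU (fun q hq => by rw [hf q hq, mul_zero]) hp
  simp [regOpParam, h0, hf p hp]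

theorem regOpParam_iterate_eq_zero {S : Set (Euc nY)} (hS : IsClosed S)
    {f : Euc nX × Euc nY × Euc N → ℂ} (hf : ∀ p, p.2.1 ∉ S → f p = 0) (κ : ℕ)
    (p : Euc nX × Euc nY × Euc N) (hp : p.2.1 ∉ S) : (regOpParam χ Φ)^[κ] f p = 0 := by
  induction κ generalizing p with
  | zero => exact hf p hp
  | succ κ ih =>
    rw [Function.iterate_succ_apply']
    exact regOpParam_eq_zero hS ih p hp

theorem regOpParam_congr {f g : Euc nX × Euc nY × Euc N → ℂ}
    (hfg : EqOn f g (box X Y (punctured N))) :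
    EqOn (regOpParam χ Φ f) (regOpParam χ Φ g) (box X Y (punctured N)) := by
  intro p hp
  have h0 (j : Fin nY ⊕ Fin N) : fderiv ℝ (fun q => coeff χ Φ j q * f q) p =
      fderiv ℝ (fun q => coeff χ Φ j q * g q) p :=
    fderiv_eq_of_eqOn (box X Y (punctured N)).isOpen (fun q hq => by simp only [hfg hq]) hp
  simp only [regOpParam, h0, hfg hp]

theorem regOpParam_iterate_add_smul (h : IsPhase X Y Φ) (hχ : IsCutoff χ)
    {f g : Euc nX × Euc nY × Euc N → ℂ} (hf : ContDiffOn ℝ ∞ f (box X Y (punctured N)))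
    (hg : ContDiffOn ℝ ∞ g (box X Y (punctured N))) (c : ℂ) (κ : ℕ) :
    EqOn ((regOpParam χ Φ)^[κ] (fun p => f p + c * g p))
      (fun p => (regOpParam χ Φ)^[κ] f p + c * (regOpParam χ Φ)^[κ] g p)
      (box X Y (punctured N)) := by
  induction κ with
  | zero => exact fun _ _ => rfl
  | succ κ ih =>
    intro p hp
    simp only [Function.iterate_succ_apply']
    rw [regOpParam_congr ih hp]
    set F := (regOpParam χ Φ)^[κ] f
    set G := (regOpParam χ Φ)^[κ] g
    have hF (j) := differentiableAt_of_contDiffOn (contDiffOn_coeff_mul h hχ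
      (contDiffOn_regOpParam_iterate h hχ hf κ) j) (box X Y (punctured N)).isOpen hp
    have hG (j) := differentiableAt_of_contDiffOn (contDiffOn_coeff_mul h hχ
      (contDiffOn_regOpParam_iterate h hχ hg κ) j) (box X Y (punctured N)).isOpen hp
    have h0 (j : Fin nY ⊕ Fin N) : fderiv ℝ (fun q => coeff χ Φ j q * (F q + c * G q)) p =
        fderiv ℝ (fun q => coeff χ Φ j q * F q) p +
          c • fderiv ℝ (fun q => coeff χ Φ j q * G q) p := by
      rw [← ((hF j).hasFDerivAt.add ((hG j).hasFDerivAt.const_mul c)).fderiv]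
      congr 1
      ext q
      simp only [Pi.add_apply]
      ring
    simp only [regOpParam, h0, add_apply, smul_apply,
      Finset.sum_add_distrib, smul_eq_mul, ← Finset.mul_sum]
    ring

/-! ### Restriction to a fixed value of the parameter -/

theorem fderiv_slice {F : Type*} [NormedAddCommGroup F] [NormedSpace ℝ F]
    {g : Euc nX × Euc nY × Euc N → F} {x : Euc nX} {q : Euc nY × Euc N}
    (hg : DifferentiableAt ℝ g (x, q)) (v : Euc nY × Euc N) :
    fderiv ℝ (fun q => g (x, q)) q v = fderiv ℝ g (x, q) (0, v) := by
  have h1 : HasFDerivAt (fun q : Euc nY × Euc N => (x, q))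
      (ContinuousLinearMap.inr ℝ (Euc nX) (Euc nY × Euc N)) q := hasFDerivAt_prodMk_right x q
  have h2 := hg.hasFDerivAt.comp q h1
  exact congrArg (fun L => L v) h2.fderiv

/-- Links the operator of the definition, at fixed x, with the one on functions of all variables,
for which smoothness in x is available. The identity is confined to the domain because both sides
involve derivatives of functions that are smooth only there. -/
theorem regOp_slice (h : IsPhase X Y Φ) (hχ : IsCutoff χ) {f : Euc nX × Euc nY × Euc N → ℂ}
    (hf : ContDiffOn ℝ ∞ f (box X Y (punctured N))) {x : Euc nX} {q : Euc nY × Euc N}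
    (hp : (x, q) ∈ box X Y (punctured N)) :
    regOp χ (fun q => Φ (x, q)) (fun q => f (x, q)) q = regOpParam χ Φ f (x, q) := by
  have hO := (box X Y (punctured N)).isOpen
  have hU : IsOpen {q : Euc nY × Euc N | (x, q) ∈ box X Y (punctured N)} :=
    hO.preimage (by fun_prop)
  have hΦ {q : Euc nY × Euc N} (hq : (x, q) ∈ box X Y (punctured N)) (v : Euc nY × Euc N) :
      fderiv ℝ (fun q => Φ (x, q)) q v = fderiv ℝ Φ (x, q) (0, v) :=
    fderiv_slice (differentiableAt_of_contDiffOn h.contDiffOn hO hq) v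
  have hr {q : Euc nY × Euc N} (hq : (x, q) ∈ box X Y (punctured N)) :
      rFun (fun q => Φ (x, q)) q = phaseR Φ (x, q) := by
    simp only [rFun, phaseR, partialXi, partialY, hΦ hq, dir]
  have hX (l : Fin N) {q : Euc nY × Euc N} (hq : (x, q) ∈ box X Y (punctured N)) :
      coeffXi χ (fun q => Φ (x, q)) l q = coeff χ Φ (.inr l) (x, q) := by
    simp only [coeffXi, coeff, coeffHom, coordFactor, hr hq, partialXi, hΦ hq, dir, Sum.elim_inr]
    ring
  have hY (k : Fin nY) {q : Euc nY × Euc N} (hq : (x, q) ∈ box X Y (punctured N)) :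
      coeffY χ (fun q => Φ (x, q)) k q = coeff χ Φ (.inl k) (x, q) := by
    simp only [coeffY, coeff, coeffHom, coordFactor, hr hq, partialY, hΦ hq, dir, Sum.elim_inl,
      Complex.ofReal_one]
    ring
  have hd (j) := differentiableAt_of_contDiffOn (contDiffOn_coeff_mul h hχ hf j) hO hp
  have h1 (l : Fin N) : partialXi l (fun q => coeffXi χ (fun q => Φ (x, q)) l q * f (x, q)) q =
      fderiv ℝ (fun q => coeff χ Φ (.inr l) q * f q) (x, q) (dir (.inr (.inr l))) := by
    rw [partialXi, fderiv_eq_of_eqOn hU (g := fun q => coeff χ Φ (.inr l) (x, q) * f (x, q))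
      (fun q hq => by simp only [hX l hq]) hp, dir, ← fderiv_slice (hd _)]
  have h2 (k : Fin nY) : partialY k (fun q => coeffY χ (fun q => Φ (x, q)) k q * f (x, q)) q =
      fderiv ℝ (fun q => coeff χ Φ (.inl k) q * f q) (x, q) (dir (.inr (.inl k))) := by
    rw [partialY, fderiv_eq_of_eqOn hU (g := fun q => coeff χ Φ (.inl k) (x, q) * f (x, q))
      (fun q hq => by simp only [hY k hq]) hp, dir, ← fderiv_slice (hd _)]
  simp only [regOp, regOpParam, h1, h2, Fintype.sum_sum_type]
  ring

theorem regOp_congr {n : ℕ} {Ψ : Euc n × Euc N → ℝ} {U : Set (Euc n × Euc N)} (hU : IsOpen U)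
    {f g : Euc n × Euc N → ℂ} (hfg : EqOn f g U) : EqOn (regOp χ Ψ f) (regOp χ Ψ g) U := by
  intro q hq
  have h1 (l : Fin N) : partialXi l (fun q => coeffXi χ Ψ l q * f q) q =
      partialXi l (fun q => coeffXi χ Ψ l q * g q) q := by
    rw [partialXi, partialXi, fderiv_eq_of_eqOn hU (g := fun q => coeffXi χ Ψ l q * g q)
      (fun q hq => by simp only [hfg hq]) hq]
  have h2 (k : Fin n) : partialY k (fun q => coeffY χ Ψ k q * f q) q =
      partialY k (fun q => coeffY χ Ψ k q * g q) q := by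
    rw [partialY, partialY, fderiv_eq_of_eqOn hU (g := fun q => coeffY χ Ψ k q * g q)
      (fun q hq => by simp only [hfg hq]) hq]
  simp only [regOp, h1, h2, hfg hq]

theorem regOp_iterate_slice (h : IsPhase X Y Φ) (hχ : IsCutoff χ)
    {f : Euc nX × Euc nY × Euc N → ℂ} (hf : ContDiffOn ℝ ∞ f (box X Y (punctured N)))
    (κ : ℕ) {x : Euc nX} {q : Euc nY × Euc N} (hp : (x, q) ∈ box X Y (punctured N)) :
    (regOp χ (fun q => Φ (x, q)))^[κ] (fun q => f (x, q)) q =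
      (regOpParam χ Φ)^[κ] f (x, q) := by
  induction κ generalizing q with
  | zero => rfl
  | succ κ ih =>
    rw [Function.iterate_succ_apply', Function.iterate_succ_apply']
    have hU : IsOpen {q : Euc nY × Euc N | (x, q) ∈ box X Y (punctured N)} :=
      (box X Y (punctured N)).isOpen.preimage (by fun_prop)
    rw [regOp_congr hU (fun q hq => ih hq) hp]
    exact regOp_slice h hχ (contDiffOn_regOpParam_iterate h hχ hf κ) hp

end Regularization


/-! ### Integrals with a parameter: continuity, derivatives, bounds -/

section ParametricIntegral

variable {nX nY N : ℕ} {I : Type*} {X : Opens (Euc nX)} {Y : Opens (Euc nY)}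

/-- The integrable function `1_S(y) ⟨ξ⟩^m`. -/
noncomputable def dominator (S : Set (Euc nY)) (m : ℝ) (q : Euc nY × Euc N) : ℝ :=
  S.indicator (fun _ => 1) q.1 * bracket q.2 ^ m

theorem integrable_bracket_rpow {m : ℝ} (hm : m < -N) :
    Integrable (fun ξ : Euc N => bracket ξ ^ m) := by
  have h := integrable_rpow_neg_one_add_norm_sq (E := Euc N) (μ := volume) (r := -m)
    (by rw [finrank_euclideanSpace_fin]; linarith)
  refine h.congr (Eventually.of_forall fun ξ => ?_)
  dsimp only [bracket]
  rw [Real.sqrt_eq_rpow, ← Real.rpow_mul (by positivity)]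
  ring_nf

theorem integrable_dominator {S : Set (Euc nY)} (hS : IsCompact S) {m : ℝ} (hm : m < -N) :
    Integrable (dominator S m : Euc nY × Euc N → ℝ) := by
  have h1 : Integrable (S.indicator (fun _ => (1 : ℝ))) :=
    (integrableOn_const hS.measure_lt_top.ne).integrable_indicator hS.measurableSet
  exact h1.mul_prod (integrable_bracket_rpow hm)

/-- The integral over `Y × Ξ` of a function with parameter `x`. -/
noncomputable def paramIntegral (Y : Opens (Euc nY)) (f : Euc nX × Euc nY × Euc N → ℂ)
    (x : Euc nX) : ℂ :=
  ∫ q in (Y : Set (Euc nY)) ×ˢ ({0}ᶜ : Set (Euc N)), f (x, q)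

theorem measurableSet_fiber (Y : Opens (Euc nY)) (N : ℕ) :
    MeasurableSet ((Y : Set (Euc nY)) ×ˢ ({0}ᶜ : Set (Euc N))) :=
  Y.isOpen.measurableSet.prod (measurableSet_singleton 0).compl

theorem continuousOn_slice {F : Type*} [NormedAddCommGroup F]
    {f : Euc nX × Euc nY × Euc N → F} (hf : ContinuousOn f (box X Y (punctured N))) {x : Euc nX}
    (hx : x ∈ X) :
    ContinuousOn (fun q => f (x, q)) ((Y : Set (Euc nY)) ×ˢ ({0}ᶜ : Set (Euc N))) :=
  hf.comp (by fun_prop) fun _ hq => ⟨hx, hq.1, hq.2⟩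

theorem aestronglyMeasurable_slice {F : Type*} [NormedAddCommGroup F]
    {f : Euc nX × Euc nY × Euc N → F} (hf : ContinuousOn f (box X Y (punctured N))) {x : Euc nX}
    (hx : x ∈ X) : AEStronglyMeasurable (fun q => f (x, q))
      (volume.restrict ((Y : Set (Euc nY)) ×ˢ ({0}ᶜ : Set (Euc N)))) :=
  (continuousOn_slice hf hx).aestronglyMeasurable (measurableSet_fiber Y N)

/-- Reduces the integral of an operator-valued derivative to scalar integrals of partial
derivatives, to which symbol estimates apply. -/
theorem clm_eq_sum_smulRight {n : ℕ} (L : Euc n →L[ℝ] ℂ) :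
    L = ∑ j, (EuclideanSpace.proj j : Euc n →L[ℝ] ℝ).smulRight (L (basisDir j)) := by
  ext v
  have h := (EuclideanSpace.basisFun (Fin n) ℝ).sum_repr v
  conv_lhs => rw [← h]
  simp [basisDir]

theorem norm_proj_le_one {n : ℕ} (j : Fin n) :
    ‖(EuclideanSpace.proj j : Euc n →L[ℝ] ℝ)‖ ≤ 1 :=
  ContinuousLinearMap.opNorm_le_bound _ zero_le_one fun v => by
    simpa using PiLp.norm_apply_le v j

variable {m : ℝ} {f : I → Euc nX × Euc nY × Euc N → ℂ} {S : Set (Euc nY)}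

theorem SymbBound.exists_le_dominator {R : Opens (Euc N)} (h : SymbBound X Y R m f)
    (hS : IsCompact S) (hSY : S ⊆ Y) (hf0 : ∀ i p, p.1 ∈ X → p.2.1 ∉ S → f i p = 0)
    {K : Set (Euc nX)} (hK : IsCompact K) (hKX : K ⊆ X) :
    ∃ C, 0 ≤ C ∧ ∀ i, ∀ x ∈ K, ∀ q : Euc nY × Euc N, q.2 ∈ R →
      ‖f i (x, q)‖ ≤ C * dominator S m q := by
  obtain ⟨C, hC0, hC⟩ := h.2 (K ×ˢ S) (prod_mono hKX hSY) (hK.prod hS)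
  refine ⟨C, hC0, fun i x hx q hq => ?_⟩
  by_cases hqS : q.1 ∈ S
  · simpa [dominator, hqS] using hC i x q.1 q.2 ⟨hx, hqS⟩ hq
  · simp [dominator, hqS, hf0 i (x, q) (hKX hx) hqS]

theorem SymbBound.integrableOn_slice (h : SymbBound X Y (punctured N) m f) (hS : IsCompact S)
    (hSY : S ⊆ Y) (hf0 : ∀ i p, p.1 ∈ X → p.2.1 ∉ S → f i p = 0) (hm : m < -N) (i : I)
    {x : Euc nX} (hx : x ∈ X) :
    IntegrableOn (fun q => f i (x, q)) ((Y : Set (Euc nY)) ×ˢ ({0}ᶜ : Set (Euc N))) := by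
  obtain ⟨C, hC0, hC⟩ := h.exists_le_dominator hS hSY hf0 (isCompact_singleton (x := x))
    (by simpa using hx)
  refine Integrable.mono' ((integrable_dominator hS hm).const_mul C).integrableOn
    (aestronglyMeasurable_slice (h.1 i).continuousOn hx) ?_
  exact (ae_restrict_mem (measurableSet_fiber Y N)).mono fun q hq => hC i x rfl q hq.2

theorem SymbBound.exists_norm_paramIntegral_le (h : SymbBound X Y (punctured N) m f)
    (hS : IsCompact S) (hSY : S ⊆ Y) (hf0 : ∀ i p, p.1 ∈ X → p.2.1 ∉ S → f i p = 0)
    (hm : m < -N) {K : Set (Euc nX)} (hK : IsCompact K) (hKX : K ⊆ X) :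
    ∃ C, 0 ≤ C ∧ ∀ i, ∀ x ∈ K, ‖paramIntegral Y (f i) x‖ ≤ C := by
  obtain ⟨C, hC0, hC⟩ := h.exists_le_dominator hS hSY hf0 hK hKX
  have hnn (q : Euc nY × Euc N) : 0 ≤ C * dominator S m q :=
    mul_nonneg hC0 (mul_nonneg (indicator_nonneg (fun _ _ => zero_le_one) _)
      (Real.rpow_nonneg (bracket_pos _).le _))
  refine ⟨∫ q in (Y : Set (Euc nY)) ×ˢ ({0}ᶜ : Set (Euc N)), C * dominator S m q,
    integral_nonneg hnn, fun i x hx => ?_⟩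
  refine norm_integral_le_of_norm_le ((integrable_dominator hS hm).const_mul C).integrableOn ?_
  exact (ae_restrict_mem (measurableSet_fiber Y N)).mono fun q hq => hC i x hx q hq.2

theorem SymbBound.continuousOn_paramIntegral (h : SymbBound X Y (punctured N) m f)
    (hS : IsCompact S) (hSY : S ⊆ Y) (hf0 : ∀ i p, p.1 ∈ X → p.2.1 ∉ S → f i p = 0)
    (hm : m < -N) (i : I) : ContinuousOn (paramIntegral Y (f i)) X := by
  intro x hx
  refine ContinuousAt.continuousWithinAt ?_
  obtain ⟨K, hK, hxK, hKX⟩ := exists_compact_subset X.isOpen hx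
  obtain ⟨C, hC0, hC⟩ := h.exists_le_dominator hS hSY hf0 hK hKX
  have hX : ∀ᶠ z in 𝓝 x, z ∈ K := mem_interior_iff_mem_nhds.1 hxK
  refine continuousAt_of_dominated (bound := fun q => C * dominator S m q) ?_ ?_
    ((integrable_dominator hS hm).const_mul C).integrableOn ?_
  · exact hX.mono fun z hz => aestronglyMeasurable_slice (h.1 i).continuousOn (hKX hz)
  · exact hX.mono fun z hz => (ae_restrict_mem (measurableSet_fiber Y N)).mono
      fun q hq => hC i z hz q hq.2
  · refine (ae_restrict_mem (measurableSet_fiber Y N)).mono fun q hq => ?_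
    have hp : (x, q) ∈ box X Y (punctured N) := ⟨hx, hq.1, hq.2⟩
    exact ((h.1 i).continuousOn.continuousAt
      ((box X Y (punctured N)).isOpen.mem_nhds hp)).comp (f := fun z => (z, q)) (by fun_prop)

/-- The coordinate directions of the parameter space. -/
noncomputable def paramDir {nX nY N : ℕ} (j : Fin nX) : Euc nX × Euc nY × Euc N := dir (.inl j)

theorem fderiv_paramDir_eq_zero (hSc : IsClosed S)
    (hf0 : ∀ i p, p.1 ∈ X → p.2.1 ∉ S → f i p = 0) (v : Euc nX × Euc nY × Euc N) (i : I)
    (p : Euc nX × Euc nY × Euc N) (hp : p.1 ∈ X) (hpS : p.2.1 ∉ S) :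
    fderiv ℝ (f i) p v = 0 := by
  have hU : IsOpen {p : Euc nX × Euc nY × Euc N | p.1 ∈ X ∧ p.2.1 ∉ S} :=
    (X.isOpen.preimage continuous_fst).inter
      (hSc.isOpen_compl.preimage (continuous_fst.comp continuous_snd))
  rw [fderiv_eq_zero_of_eqOn hU (fun q hq => hf0 i q hq.1 hq.2) ⟨hp, hpS⟩]
  rfl

/-- Dominated differentiation under the integral sign: an x-derivative raises the order by one, and
m + 1 < -N keeps the dominating function integrable. -/
theorem hasFDerivAt_paramIntegral
    (h : Symb X Y (punctured N) paramDir (fun _ => 1) 1 m f) (hS : IsCompact S)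
    (hSY : S ⊆ Y) (hf0 : ∀ i p, p.1 ∈ X → p.2.1 ∉ S → f i p = 0) (hm : m + 1 < -N) (i : I)
    {x : Euc nX} (hx : x ∈ X) :
    HasFDerivAt (paramIntegral Y (f i))
      (∑ j, (EuclideanSpace.proj j : Euc nX →L[ℝ] ℝ).smulRight
        (paramIntegral Y (fun p => fderiv ℝ (f i) p (paramDir j)) x)) x := by
  obtain ⟨K, hK, hxK, hKX⟩ := exists_compact_subset X.isOpen hx
  have hd (j : Fin nX) : SymbBound X Y (punctured N) (m + 1)
      (fun i p => fderiv ℝ (f i) p (paramDir j)) := h.2 j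
  have hd0 (j : Fin nX) (i : I) (p : Euc nX × Euc nY × Euc N) (hp : p.1 ∈ X) (hpS : p.2.1 ∉ S) :
      fderiv ℝ (f i) p (paramDir j) = 0 :=
    fderiv_paramDir_eq_zero hS.isClosed hf0 _ i p hp hpS
  choose C hC0 hC using fun j => (hd j).exists_le_dominator hS hSY (hd0 j) hK hKX
  have hint (j : Fin nX) := (hd j).integrableOn_slice hS hSY (hd0 j) hm i hx
  let L (j : Fin nX) : ℂ →L[ℝ] (Euc nX →L[ℝ] ℂ) :=
    ContinuousLinearMap.smulRightL ℝ (Euc nX) ℂ (EuclideanSpace.proj j)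
  have key := hasFDerivAt_integral_of_dominated_of_fderiv_le (𝕜 := ℝ)
    (μ := volume.restrict ((Y : Set (Euc nY)) ×ˢ ({0}ᶜ : Set (Euc N))))
    (F := fun z q => f i (z, q)) (x₀ := x) (s := K)
    (F' := fun z q => ∑ j, L j (fderiv ℝ (f i) (z, q) (paramDir j)))
    (bound := fun q => ∑ j, C j * dominator S (m + 1) q)
    (mem_interior_iff_mem_nhds.1 hxK)
    ?_ (h.1.integrableOn_slice hS hSY hf0 (by linarith) i hx) ?_ ?_ ?_ ?_
  · rw [integral_finsetSum _ fun j _ => (L j).integrable_comp (hint j)] at key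
    simp only [fun j => (L j).integral_comp_comm (hint j)] at key
    exact key
  · filter_upwards [mem_interior_iff_mem_nhds.1 hxK] with z hz
    exact aestronglyMeasurable_slice (h.contDiffOn i).continuousOn (hKX hz)
  · refine Finset.aestronglyMeasurable_fun_sum _ fun j _ => ?_
    exact (L j).continuous.comp_aestronglyMeasurable
      (aestronglyMeasurable_slice ((hd j).1 i).continuousOn hx)
  · refine (ae_restrict_mem (measurableSet_fiber Y N)).mono fun q hq z hz => ?_
    refine (norm_sum_le _ _).trans (Finset.sum_le_sum fun j _ => ?_)
    change ‖(EuclideanSpace.proj j : Euc nX →L[ℝ] ℝ).smulRight _‖ ≤ _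
    rw [ContinuousLinearMap.norm_smulRight_apply]
    exact (mul_le_of_le_one_left (norm_nonneg _) (norm_proj_le_one j)).trans (hC j i z hz q hq.2)
  · exact integrable_finsetSum _ fun j _ =>
      ((integrable_dominator hS hm).const_mul (C j)).integrableOn
  · refine (ae_restrict_mem (measurableSet_fiber Y N)).mono fun q hq z hz => ?_
    have hp : (z, q) ∈ (box X Y (punctured N) : Set _) := ⟨hKX hz, hq.1, hq.2⟩
    have h0 : HasFDerivAt (fun z => (z, q))
      (ContinuousLinearMap.inl ℝ (Euc nX) (Euc nY × Euc N)) z := hasFDerivAt_prodMk_left z q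
    have h1 := (differentiableAt_of_contDiffOn (h.contDiffOn i) (box X Y (punctured N)).isOpen
      hp).hasFDerivAt.comp z h0
    exact h1.congr_fderiv (clm_eq_sum_smulRight _)

theorem contDiffOn_paramIntegral {k : ℕ}
    (h : Symb X Y (punctured N) paramDir (fun _ => 1) k m f) (hS : IsCompact S)
    (hSY : S ⊆ Y) (hf0 : ∀ i p, p.1 ∈ X → p.2.1 ∉ S → f i p = 0) (hm : m + k < -N) (i : I) :
    ContDiffOn ℝ k (paramIntegral Y (f i)) X := by
  induction k generalizing m f with
  | zero =>
    simp only [CharP.cast_eq_zero, add_zero] at hm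
    simpa [contDiffOn_zero] using SymbBound.continuousOn_paramIntegral h hS hSY hf0 hm i
  | succ k ih =>
    push_cast at hm
    -- The recursion iterates `Symb.pred` to keep only the first of the k + 1 available derivatives.
    have hd (x : Euc nX) (hx : x ∈ X) := hasFDerivAt_paramIntegral
      (Nat.rec (motive := fun k => Symb X Y (punctured N) paramDir (fun _ => 1) (k + 1) m f →
        Symb X Y (punctured N) paramDir (fun _ => 1) 1 m f) id (fun _ ih h => ih h.pred) k h)
      hS hSY hf0 (by have : (0 : ℝ) ≤ k := k.cast_nonneg; linarith) i hx
    push_cast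
    rw [contDiffOn_succ_iff_fderiv_of_isOpen X.isOpen]
    refine ⟨fun x hx => (hd x hx).differentiableAt.differentiableWithinAt, by simp, ?_⟩
    refine ContDiffOn.congr (ContDiffOn.sum fun j _ => ?_) fun x hx => (hd x hx).fderiv
    exact (ContinuousLinearMap.smulRightL ℝ (Euc nX) ℂ
      (EuclideanSpace.proj j)).contDiff.comp_contDiffOn (ih (h.2 j)
        (fun i p hp hpS => fderiv_paramDir_eq_zero hS.isClosed hf0 _ i p hp hpS) (by linarith))

theorem exists_norm_iteratedFDeriv_paramIntegral_le {k : ℕ}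
    (h : Symb X Y (punctured N) paramDir (fun _ => 1) k m f) (hS : IsCompact S)
    (hSY : S ⊆ Y) (hf0 : ∀ i p, p.1 ∈ X → p.2.1 ∉ S → f i p = 0) (hm : m + k < -N)
    {K : Set (Euc nX)} (hK : IsCompact K) (hKX : K ⊆ X) (s : Fin k → Fin nX) :
    ∃ C, 0 ≤ C ∧ ∀ i, ∀ x ∈ K,
      ‖iteratedFDeriv ℝ k (paramIntegral Y (f i)) x (fun t => basisDir (s t))‖ ≤ C := by
  induction k generalizing m f with
  | zero =>
    simp only [CharP.cast_eq_zero, add_zero] at hm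
    simpa using SymbBound.exists_norm_paramIntegral_le h hS hSY hf0 hm hK hKX
  | succ k ih =>
    have hcd := contDiffOn_paramIntegral h hS hSY hf0 hm
    push_cast at hm
    have hd (i : I) (x : Euc nX) (hx : x ∈ X) := hasFDerivAt_paramIntegral
      (Nat.rec (motive := fun k => Symb X Y (punctured N) paramDir (fun _ => 1) (k + 1) m f →
        Symb X Y (punctured N) paramDir (fun _ => 1) 1 m f) id (fun _ ih h => ih h.pred) k h)
      hS hSY hf0 (by have : (0 : ℝ) ≤ k := k.cast_nonneg; linarith) i hx
    obtain ⟨C, hC0, hC⟩ := ih (h.2 (s (Fin.last k)))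
      (fun i p hp hpS => fderiv_paramDir_eq_zero hS.isClosed hf0 _ i p hp hpS) (by linarith)
      (Fin.init s)
    refine ⟨C, hC0, fun i x hx => ?_⟩
    have hcx : ContDiffAt ℝ (k + 1) (paramIntegral Y (f i)) x := by
      have := (hcd i).contDiffAt (X.isOpen.mem_nhds (hKX hx))
      exact_mod_cast this
    rw [iteratedFDeriv_succ_apply_last hcx]
    -- Equality is needed on a neighbourhood, since the remaining k derivatives are taken of this
    -- function.
    have he : (fun z => fderiv ℝ (paramIntegral Y (f i)) z (basisDir (s (Fin.last k)))) =ᶠ[𝓝 x]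
        paramIntegral Y (fun p => fderiv ℝ (f i) p (paramDir (s (Fin.last k)))) := by
      filter_upwards [X.isOpen.mem_nhds (hKX hx)] with z hz
      rw [(hd i z hz).fderiv]
      simp [basisDir, ite_smul]
    rw [(he.iteratedFDeriv ℝ k).eq_of_nhds]
    exact hC i x hx

end ParametricIntegral


/-! ### The oscillatory integrand and integration by parts -/

section Oscillatory

variable {nX nY N : ℕ} {I ι : Type*} {X : Opens (Euc nX)} {Y : Opens (Euc nY)}

/-- The open set `{0 < ‖ξ‖ < 1}`. -/
def inner (N : ℕ) : Opens (Euc N) :=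
  ⟨{ξ | ‖ξ‖ < 1} ∩ {0}ᶜ,
    (isOpen_lt continuous_norm continuous_const).inter isOpen_compl_singleton⟩

/-- For ‖ξ‖ < 1 one has 1 ≤ ⟨ξ⟩ ≤ 2, so the order carries no information there. -/
theorem Symb.change_order_inner {e : ι → Euc nX × Euc nY × Euc N} {w : ι → ℝ} {n : ℕ} {m m' : ℝ}
    {f : I → Euc nX × Euc nY × Euc N → ℂ} (h : Symb X Y (inner N) e w n m f) :
    Symb X Y (inner N) e w n m' f := by
  have h0 {m m' : ℝ} {f : I → Euc nX × Euc nY × Euc N → ℂ} (h : SymbBound X Y (inner N) m f) :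
      SymbBound X Y (inner N) m' f := by
    refine ⟨h.1, fun K hK hKc => ?_⟩
    obtain ⟨C, hC0, hC⟩ := h.2 K hK hKc
    refine ⟨C * 2 ^ |m - m'|, by positivity, fun i x y ξ hxy hξ => (hC i x y ξ hxy hξ).trans ?_⟩
    rw [mul_assoc]
    refine mul_le_mul_of_nonneg_left ?_ hC0
    have h1 : bracket ξ ≤ 2 := by
      have : ‖ξ‖ < 1 := hξ.1
      exact Real.sqrt_le_iff.2 ⟨by norm_num, by nlinarith [norm_nonneg ξ]⟩
    calc bracket ξ ^ m = bracket ξ ^ (m - m') * bracket ξ ^ m' := by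
          rw [← Real.rpow_add (bracket_pos ξ)]
          ring_nf
      _ ≤ _ := by
          refine mul_le_mul_of_nonneg_right ?_ (Real.rpow_nonneg (bracket_pos ξ).le _)
          exact (Real.rpow_le_rpow_of_exponent_le (one_le_bracket ξ) (le_abs_self _)).trans
            (Real.rpow_le_rpow (bracket_pos ξ).le h1 (abs_nonneg _))
  induction n generalizing m m' f with
  | zero => exact h0 h
  | succ n ih => exact ⟨h0 h.1, fun j => ih (h.2 j)⟩

theorem punctured_le : punctured N ≤ outer N ⊔ inner N := by
  intro ξ hξ
  rcases lt_or_ge ‖ξ‖ 1 with h | h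
  · exact Or.inr ⟨h, hξ⟩
  · exact Or.inl (show 1 / 2 < ‖ξ‖ by linarith)

variable {χ : Euc N → ℂ} {Φ : Euc nX × Euc nY × Euc N → ℝ}

/-- The integrand `e^{iΦ} L^κ f`. -/
noncomputable def oscIntegrand (χ : Euc N → ℂ) (Φ : Euc nX × Euc nY × Euc N → ℝ) (κ : ℕ)
    (f : Euc nX × Euc nY × Euc N → ℂ) (p : Euc nX × Euc nY × Euc N) : ℂ :=
  Complex.exp (Complex.I * Φ p) * (regOpParam χ Φ)^[κ] f p

theorem homogeneous_ofReal {m : ℝ} {g : Euc nX × Euc nY × Euc N → ℝ} (h : HomogeneousXi X Y m g) :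
    HomogeneousXi X Y m (fun p => (g p : ℂ)) := fun x hx y hy ξ hξ t ht => by
  simp [h x hx y hy ξ hξ t ht]

/-- The x-derivatives of Φ keep degree 1, so their bounds persist up to ξ = 0. Thus no region around
the origin has to be removed. -/
theorem IsPhase.symb_exp_param (h : IsPhase X Y Φ) (n : ℕ) :
    Symb X Y (punctured N) paramDir (fun _ => 1) n 0
      (fun (_ : I) p => Complex.exp (Complex.I * Φ p)) := by
  refine symb_exp (fun _ => h.contDiffOn) fun j => ?_
  have h1 := homogeneous_ofReal (h.homogeneous.fderiv_apply h.contDiffOn (.inl j))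
  refine (h1.symb (h.contDiffOn_fderiv _).ofReal le_rfl Sum.inl (by simp [xiDeg]) {1}
    (by simp [xiDeg]) (by simp [xiDeg]) ?_ n).mono (by simp [xiDeg])
  rintro m rfl
  exact ⟨1, zero_le_one, fun ξ _ => by simpa using norm_le_bracket ξ⟩

/-- Type (0, 1) reflects that ∂_xΦ and ∂_yΦ have order 1 and ∂_ξΦ has order 0; ξ-derivatives beyond
the first may be singular at the origin, hence the restriction to `outer N`. -/
theorem IsPhase.symb_exp_outer (h : IsPhase X Y Φ) (n : ℕ) :
    Symb X Y (outer N) dir (stdWeight 0 1) n 0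
      (fun (_ : I) p => Complex.exp (Complex.I * Φ p)) := by
  refine symb_exp (fun _ => h.contDiffOn.mono fun p hp => ⟨hp.1, hp.2.1, outer_le_punctured hp.2.2⟩)
    fun j => ?_
  have h1 := homogeneous_ofReal (h.homogeneous.fderiv_apply h.contDiffOn j)
  refine (h1.symb_outer (h.contDiffOn_fderiv _).ofReal zero_le_one zero_le_one n).mono ?_
  rcases j with j | j | j <;> simp [xiDeg, stdWeight]

variable {ρ δ m : ℝ} {f : I → Euc nX × Euc nY × Euc N → ℂ} {S : Set (Euc nY)}

/-- For large ξ the operator has lowered the order κ times. For small ξ it acts as the identity and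
the order is irrelevant. The two regions cover Ξ, and an x-derivative costs at most one power of ⟨ξ⟩
on both. -/
theorem symb_oscIntegrand (h : IsPhase X Y Φ) (hχ : IsCutoff χ) (hρ_le : ρ ≤ 1) (hδ : 0 ≤ δ)
    (hδ_le : δ ≤ 1)
    (hf : ∀ n, Symb X Y (punctured N) dir (stdWeight ρ δ) n m f) (κ n : ℕ) :
    Symb X Y (punctured N) paramDir (fun _ => 1) n (m - κ * min ρ (1 - δ))
      (fun i => oscIntegrand χ Φ κ (f i)) := by
  have h1 : Symb X Y (outer N) paramDir (fun _ => 1) n (m - κ * min ρ (1 - δ))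
      (fun i => (regOpParam χ Φ)^[κ] (f i)) :=
    (symb_regOpParam_iterate h hχ hρ_le hδ (fun n => (hf n).restrict outer_le_punctured)
      κ n).mono_reindex Sum.inl (fun _ => rfl) (fun _ => hδ_le) le_rfl
  have h2 : Symb X Y (inner N) paramDir (fun _ => 1) n (m - κ * min ρ (1 - δ))
      (fun i => (regOpParam χ Φ)^[κ] (f i)) := by
    refine (((hf n).restrict (R' := inner N) fun ξ hξ => hξ.2).mono_reindex Sum.inl (fun _ => rfl)
      (fun _ => hδ_le) le_rfl).change_order_inner.congr fun i p hp => ?_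
    exact (regOpParam_iterate_of_norm_lt hχ (f i) κ hp.2.2.1).symm
  exact ((h.symb_exp_param n).mul ((h1.union h2).restrict punctured_le)).mono (zero_add _).le

/-- Integration by parts against the constant 1; integrability replaces compact support, which is
absent in ξ. -/
theorem integral_fderiv_eq_zero {E : Type*} [NormedAddCommGroup E] [NormedSpace ℝ E]
    [FiniteDimensional ℝ E] [MeasurableSpace E] [BorelSpace E] {μ : Measure E}
    [μ.IsAddHaarMeasure] {V : E → ℂ} (hV : Differentiable ℝ V) (hi : Integrable V μ) (v : E)
    (hi' : Integrable (fun q => fderiv ℝ V q v) μ) : ∫ q, fderiv ℝ V q v ∂μ = 0 := by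
  have := integral_mul_fderiv_eq_neg_fderiv_mul_of_integrable (𝕜 := ℂ) (μ := μ) (f := fun _ => 1)
    (g := V) (v := v) (by simp) (by simpa using hi') (by simpa using hi)
    (fun x _ => by fun_prop) (fun x _ => hV x)
  simpa using this

theorem norm_le_dominator_of_outer {C m : ℝ} (hC0 : 0 ≤ C) {V : Euc nY × Euc N → ℂ}
    (h1 : ∀ q : Euc nY × Euc N, q.2 ∈ outer N → ‖V q‖ ≤ C * dominator S m q)
    (h0 : ∀ q : Euc nY × Euc N, ‖q.2‖ < 1 → V q = 0) (q : Euc nY × Euc N) :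
    ‖V q‖ ≤ C * dominator S m q := by
  rcases lt_or_ge ‖q.2‖ 1 with h | h
  · rw [h0 q h, norm_zero]
    exact mul_nonneg hC0 (mul_nonneg (indicator_nonneg (fun _ _ => zero_le_one) _)
      (Real.rpow_nonneg (bracket_pos _).le _))
  · exact h1 q (show 1 / 2 < ‖q.2‖ by linarith)

/-- The integral of the divergence of the regularization remainder vanishes. -/
theorem integral_fderiv_coeff_mul (h : IsPhase X Y Φ) (hχ : IsCutoff χ)
    {g : Euc nX × Euc nY × Euc N → ℂ} (hρ : 0 ≤ ρ) (hδ_le : δ ≤ 1)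
    (hg : ContDiffOn ℝ ∞ g (box X Y (punctured N)))
    (hgs : Symb X Y (outer N) dir (stdWeight ρ δ) 1 m (fun (_ : Unit) => g)) (hm : m < -N)
    (hS : IsCompact S) (hSY : S ⊆ Y) (hg0 : ∀ p, p.2.1 ∉ S → g p = 0) (j : Fin nY ⊕ Fin N)
    {x : Euc nX} (hx : x ∈ X) :
    IntegrableOn (fun q => fderiv ℝ (fun p => Complex.exp (Complex.I * Φ p) *
        (coeff χ Φ j p * g p)) (x, q) (dir (.inr j)))
      ((Y : Set (Euc nY)) ×ˢ ({0}ᶜ : Set (Euc N))) ∧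
    ∫ q in (Y : Set (Euc nY)) ×ˢ ({0}ᶜ : Set (Euc N)),
      fderiv ℝ (fun p => Complex.exp (Complex.I * Φ p) *
        (coeff χ Φ j p * g p)) (x, q) (dir (.inr j)) = 0 := by
  have : (volume : Measure (Euc nY × Euc N)).IsAddHaarMeasure := by
    rw [Measure.volume_eq_prod]
    infer_instance
  set V : Euc nX × Euc nY × Euc N → ℂ := fun p => Complex.exp (Complex.I * Φ p) *
        (coeff χ Φ j p * g p) with hV
  have hVs : ContDiffOn ℝ ∞ V (box X Y (punctured N)) :=
    (contDiffOn_const.mul h.contDiffOn.ofReal).cexp.mul (contDiffOn_coeff_mul h hχ hg j)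
  have hO := (box X Y (punctured N)).isOpen
  have hVS (p : Euc nX × Euc nY × Euc N) (hp : p.2.1 ∉ S) : V p = 0 := by simp [hV, hg0 p hp]
  have hV1 (p : Euc nX × Euc nY × Euc N) (hp : ‖p.2.2‖ < 1) : V p = 0 := by
    simp [hV, coeff_eq_zero hχ j hp]
  have hOS : IsOpen {p : Euc nX × Euc nY × Euc N | p.2.1 ∉ S} :=
    hS.isClosed.isOpen_compl.preimage (by fun_prop)
  have hO1 : IsOpen {p : Euc nX × Euc nY × Euc N | ‖p.2.2‖ < 1} :=
    isOpen_lt (by fun_prop) continuous_const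
  have hdS (p : Euc nX × Euc nY × Euc N) (hp : p.2.1 ∉ S) : fderiv ℝ V p = 0 :=
    fderiv_eq_zero_of_eqOn hOS hVS hp
  have hd1 (p : Euc nX × Euc nY × Euc N) (hp : ‖p.2.2‖ < 1) : fderiv ℝ V p = 0 :=
    fderiv_eq_zero_of_eqOn hO1 hV1 hp
  -- V vanishes near every point with y outside S or ‖ξ‖ < 1, so its slice is differentiable on the
  -- whole space and there are no boundary terms.
  have hdiff (q : Euc nY × Euc N) : DifferentiableAt ℝ V (x, q) := by
    by_cases hqS : q.1 ∈ S
    · rcases lt_or_ge ‖q.2‖ 1 with hq | hq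
      · refine (differentiableAt_const (0 : ℂ)).congr_of_eventuallyEq ?_
        filter_upwards [hO1.mem_nhds (show (x, q) ∈ {p : Euc nX × Euc nY × Euc N | ‖p.2.2‖ < 1}
          from hq)] with p hp using hV1 p hp
      · refine differentiableAt_of_contDiffOn hVs hO ⟨hx, hSY hqS, fun h0 => ?_⟩
        rw [show q.2 = 0 from h0, norm_zero] at hq
        norm_num at hq
    · refine (differentiableAt_const (0 : ℂ)).congr_of_eventuallyEq ?_
      filter_upwards [hOS.mem_nhds (show (x, q) ∈ {p : Euc nX × Euc nY × Euc N | p.2.1 ∉ S}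
        from hqS)] with p hp using hVS p hp
  have hslice : Differentiable ℝ (fun q => V (x, q)) := fun q =>
    (hdiff q).comp (f := fun q => (x, q)) q (by fun_prop)
  -- The exponential is only known to be of type (0, 1), so g is weakened to this type.
  have hsymb : Symb X Y (outer N) dir (stdWeight 0 1) 1
      (j.elim (fun _ => -1) (fun _ => 0) + m) (fun (_ : Unit) => V) := by
    refine ((h.symb_exp_outer 1).mul ((h.symb_coeff hχ j zero_le_one zero_le_one 1).mul
      (hgs.mono_reindex id (fun _ => rfl) (fun i => ?_) le_rfl))).mono (zero_add _).le
    rcases i with i | i | i <;> simp [stdWeight, hρ, hδ_le]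
  have hle : (j.elim (fun _ => -1) (fun _ => 0) + m : ℝ) ≤ m := by
    rcases j with j | j <;> simp
  -- A y-derivative costs one order, which the coefficient of order -1 repays; a ξ-derivative costs
  -- nothing. The derivative therefore still has order at most m < -N.
  have hle' : (j.elim (fun _ => -1) (fun _ => 0) + m + stdWeight 0 1 (.inr j : Idx nX nY N) : ℝ)
      ≤ m := by
    rcases j with j | j <;> simp [stdWeight]
  have hdom : Integrable (fun q : Euc nY × Euc N => V (x, q)) := by
    obtain ⟨C, hC0, hC⟩ := (hsymb.1.mono hle).exists_le_dominator hS hSY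
      (fun _ p _ hp => hVS p hp) (isCompact_singleton (x := x)) (by simpa using hx)
    refine ((integrable_dominator hS hm).const_mul C).mono'
      hslice.continuous.aestronglyMeasurable (Eventually.of_forall fun q => ?_)
    exact norm_le_dominator_of_outer hC0 (fun q hq => hC () x rfl q hq)
      (fun q hq => hV1 (x, q) hq) q
  have hder (q : Euc nY × Euc N) : fderiv ℝ (fun q => V (x, q)) q (dir (.inr j) :
      Euc nX × Euc nY × Euc N).2 = fderiv ℝ V (x, q) (dir (.inr j)) := by
    rw [fderiv_slice (hdiff q)]
    rcases j with j | j <;> rfl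
  have hdom' : Integrable (fun q : Euc nY × Euc N => fderiv ℝ V (x, q) (dir (.inr j))) := by
    have hb : SymbBound X Y (outer N) _ (fun (_ : Unit) p => fderiv ℝ V p (dir (.inr j))) :=
      (hsymb.2 (.inr j)).symbBound.mono hle'
    obtain ⟨C, hC0, hC⟩ := hb.exists_le_dominator hS hSY
      (fun _ p _ hp => by simp [hdS p hp]) (isCompact_singleton (x := x)) (by simpa using hx)
    refine ((integrable_dominator hS hm).const_mul C).mono' ?_ (Eventually.of_forall fun q => ?_)
    · simp only [← hder]
      exact (measurable_fderiv_apply_const ℝ _ _).aestronglyMeasurable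
    · exact norm_le_dominator_of_outer hC0 (fun q hq => hC () x rfl q hq)
        (fun q hq => by simp [hd1 (x, q) hq]) q
  refine ⟨hdom'.integrableOn, ?_⟩
  rw [setIntegral_eq_integral_of_forall_compl_eq_zero]
  · simp only [← hder] at hdom' ⊢
    exact integral_fderiv_eq_zero hslice hdom _ hdom'
  -- Off Y × Ξ either y lies outside S or ξ = 0, and the derivative vanishes in both cases.
  · intro q hq
    by_cases hqS : q.1 ∈ S
    · have : q.2 = 0 := by
        by_contra h0
        exact hq ⟨hSY hqS, h0⟩
      rw [hd1 (x, q) (by simp [this])]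
      rfl
    · rw [hdS (x, q) hqS]
      rfl

/-- By the product rule the divergence contains e^{iΦ} g times the sum of the i∂_jΦ · coeff_j.
Division by r makes this sum equal to 1 - χ, and the term χg of the operator supplies the rest. -/
theorem exp_mul_regOpParam (h : IsPhase X Y Φ) (hχ : IsCutoff χ)
    {g : Euc nX × Euc nY × Euc N → ℂ} (hg : ContDiffOn ℝ ∞ g (box X Y (punctured N)))
    {p : Euc nX × Euc nY × Euc N} (hp : p ∈ box X Y (punctured N)) :
    Complex.exp (Complex.I * Φ p) * regOpParam χ Φ g p =
      Complex.exp (Complex.I * Φ p) * g p - ∑ j, fderiv ℝ (fun p =>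
        Complex.exp (Complex.I * Φ p) * (coeff χ Φ j p * g p)) p (dir (.inr j)) := by
  have hO := (box X Y (punctured N)).isOpen
  have hΦ : HasFDerivAt (fun p => (Φ p : ℂ)) (Complex.ofRealCLM.comp (fderiv ℝ Φ p)) p :=
    Complex.ofRealCLM.hasFDerivAt.comp p
      (differentiableAt_of_contDiffOn h.contDiffOn hO hp).hasFDerivAt
  have hd (j : Fin nY ⊕ Fin N) : fderiv ℝ (fun p => Complex.exp (Complex.I * Φ p) *
        (coeff χ Φ j p * g p)) p (dir (.inr j)) =
      Complex.exp (Complex.I * Φ p) *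
        (fderiv ℝ (fun p => coeff χ Φ j p * g p) p (dir (.inr j)) +
          Complex.I * fderiv ℝ Φ p (dir (.inr j)) * coeff χ Φ j p * g p) := by
    have h1 := (hΦ.const_mul Complex.I).cexp.mul
      (differentiableAt_of_contDiffOn (contDiffOn_coeff_mul h hχ hg j) hO hp).hasFDerivAt
    rw [show (fun p => Complex.exp (Complex.I * Φ p) * (coeff χ Φ j p * g p)) =
      (fun p => Complex.exp (Complex.I * Φ p)) * (fun p => coeff χ Φ j p * g p) from rfl, h1.fderiv]
    simp
    ring
  have hsum : ∑ j : Fin nY ⊕ Fin N, Complex.I * fderiv ℝ Φ p (dir (.inr j)) * coeff χ Φ j p =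
      1 - χ p.2.2 := by
    have hr0 : (phaseR Φ p : ℂ) ≠ 0 := Complex.ofReal_ne_zero.2 (h.phaseR_pos p hp).ne'
    have hterm (j : Fin nY ⊕ Fin N) : Complex.I * fderiv ℝ Φ p (dir (.inr j)) * coeff χ Φ j p =
        (1 - χ p.2.2) / phaseR Φ p *
          ((coordFactor j p.2.2 * (fderiv ℝ Φ p (dir (.inr j))) ^ 2 : ℝ) : ℂ) := by
      simp only [coeff, coeffHom]
      push_cast
      field_simp
      rw [Complex.I_sq]
      ring
    have hr : phaseR Φ p = ∑ j : Fin nY ⊕ Fin N,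
        coordFactor j p.2.2 * (fderiv ℝ Φ p (dir (.inr j))) ^ 2 := by
      simp only [phaseR, Fintype.sum_sum_type, coordFactor, Sum.elim_inl, Sum.elim_inr, one_mul]
      ring
    simp only [hterm, ← Finset.mul_sum]
    rw [← Complex.ofReal_sum, ← hr]
    field_simp
  simp only [hd, ← Finset.mul_sum, Finset.sum_add_distrib, ← Finset.sum_mul, hsum, regOpParam]
  ring

end Oscillatory


/-! ### Existence, smoothness and bounds of the oscillatory integral -/

section Operators

variable {nX nY N : ℕ} {I : Type*} {X : Opens (Euc nX)} {Y : Opens (Euc nY)}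
  {χ : Euc N → ℂ} {Φ : Euc nX × Euc nY × Euc N → ℝ} {ρ δ d : ℝ}
  {f : I → Euc nX × Euc nY × Euc N → ℂ} {S : Set (Euc nY)}

/-- An exponent `κ` for which `e^{iΦ} L^κ f` is integrable if `f` has order `d` and `L` lowers the
order by `τ`. -/
noncomputable def critIndex (N : ℕ) (d τ : ℝ) : ℕ := ⌈(d + N) / τ⌉₊ + 1

theorem lt_of_critIndex_le {d τ : ℝ} (hτ : 0 < τ) {κ : ℕ} (hκ : critIndex N d τ ≤ κ) :
    d - κ * τ < -N := by
  have h1 : (d + N) / τ < κ := by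
    -- The summand 1 in `critIndex` makes the inequality strict.
    refine (Nat.le_ceil _).trans_lt ?_
    exact_mod_cast (Nat.lt_succ_self _).trans_le hκ
  rw [div_lt_iff₀ hτ] at h1
  linarith

theorem min_pos_of (hρ : 0 < ρ) (hδ : δ < 1) : 0 < min ρ (1 - δ) := lt_min hρ (by linarith)

theorem oscIntegrand_eq_zero (hS : IsClosed S) {f : Euc nX × Euc nY × Euc N → ℂ}
    (hf0 : ∀ p, p.2.1 ∉ S → f p = 0) (κ : ℕ) (p : Euc nX × Euc nY × Euc N) (hp : p.2.1 ∉ S) :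
    oscIntegrand χ Φ κ f p = 0 := by
  rw [oscIntegrand, regOpParam_iterate_eq_zero hS hf0 κ p hp, mul_zero]

/-- The value of the regularized oscillatory integral. -/
noncomputable def oscValue (χ : Euc N → ℂ) (Y : Opens (Euc nY))
    (Φ : Euc nX × Euc nY × Euc N → ℝ) (d ρ δ : ℝ) (f : Euc nX × Euc nY × Euc N → ℂ) (x : Euc nX) :
    ℂ :=
  paramIntegral Y (oscIntegrand χ Φ (critIndex N d (min ρ (1 - δ))) f) x

variable (h : IsPhase X Y Φ) (hχ : IsCutoff χ) (hρ : 0 < ρ) (hρ_le : ρ ≤ 1) (hδ : 0 ≤ δ)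
  (hδ_lt : δ < 1) (hf : ∀ n, Symb X Y (punctured N) dir (stdWeight ρ δ) n d f)
  (hS : IsCompact S) (hSY : S ⊆ Y) (hf0 : ∀ i p, p.2.1 ∉ S → f i p = 0)

include h hχ hρ hρ_le hδ hδ_lt hf hS hSY hf0

theorem integrableOn_oscIntegrand {κ : ℕ} (hκ : critIndex N d (min ρ (1 - δ)) ≤ κ) (i : I)
    {x : Euc nX} (hx : x ∈ X) :
    IntegrableOn (fun q => oscIntegrand χ Φ κ (f i) (x, q))
      ((Y : Set (Euc nY)) ×ˢ ({0}ᶜ : Set (Euc N))) :=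
  (symb_oscIntegrand h hχ hρ_le hδ hδ_lt.le hf κ 0).symbBound.integrableOn_slice hS hSY
    (fun i p _ => oscIntegrand_eq_zero hS.isClosed (hf0 i) κ p)
    (lt_of_critIndex_le (min_pos_of hρ hδ_lt) hκ) i hx

/-- The two integrands differ by a sum of derivatives, each of which has integral zero at these
orders. -/
theorem paramIntegral_oscIntegrand_succ {κ : ℕ} (hκ : critIndex N d (min ρ (1 - δ)) ≤ κ) (i : I)
    {x : Euc nX} (hx : x ∈ X) :
    paramIntegral Y (oscIntegrand χ Φ (κ + 1) (f i)) x =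
      paramIntegral Y (oscIntegrand χ Φ κ (f i)) x := by
  have hfs : ContDiffOn ℝ ∞ (f i) (box X Y (punctured N)) := (hf 0).contDiffOn i
  have hg := contDiffOn_regOpParam_iterate h hχ hfs κ
  have hgs : Symb X Y (outer N) dir (stdWeight ρ δ) 1 (d - κ * min ρ (1 - δ))
      (fun (_ : Unit) => (regOpParam χ Φ)^[κ] (f i)) :=
    (symb_regOpParam_iterate h hχ hρ_le hδ (fun n => (hf n).restrict outer_le_punctured)
      κ 1).reparam (fun _ => i)
  have hdiv (j : Fin nY ⊕ Fin N) := integral_fderiv_coeff_mul h hχ hρ.le hδ_lt.le hg hgs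
    (lt_of_critIndex_le (min_pos_of hρ hδ_lt) hκ) hS hSY
    (regOpParam_iterate_eq_zero hS.isClosed (hf0 i) κ) j hx
  have hint := integrableOn_oscIntegrand h hχ hρ hρ_le hδ hδ_lt hf hS hSY hf0 hκ i hx
  rw [paramIntegral, setIntegral_congr_fun (measurableSet_fiber Y N) (g := fun q =>
    oscIntegrand χ Φ κ (f i) (x, q) - ∑ j, fderiv ℝ (fun p => Complex.exp (Complex.I * Φ p) *
        (coeff χ Φ j p * (regOpParam χ Φ)^[κ] (f i) p)) (x, q) (dir (.inr j))),
    integral_sub hint (integrable_finsetSum _ fun j _ => (hdiv j).1),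
    integral_finsetSum _ fun j _ => (hdiv j).1]
  · simp [hdiv, paramIntegral]
  · intro q hq
    dsimp only [oscIntegrand]
    rw [Function.iterate_succ_apply']
    exact exp_mul_regOpParam h hχ hg ⟨hx, hq.1, hq.2⟩

theorem paramIntegral_oscIntegrand_eq {κ : ℕ} (hκ : critIndex N d (min ρ (1 - δ)) ≤ κ) (i : I)
    {x : Euc nX} (hx : x ∈ X) :
    paramIntegral Y (oscIntegrand χ Φ κ (f i)) x = oscValue χ Y Φ d ρ δ (f i) x := by
  induction κ, hκ using Nat.le_induction with
  | base => rfl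
  | succ κ hκ ih =>
    rw [paramIntegral_oscIntegrand_succ h hχ hρ hρ_le hδ hδ_lt hf hS hSY hf0 hκ i hx, ih]

theorem hasOscIntegral_oscValue (i : I) {x : Euc nX} (hx : x ∈ X) :
    HasOscIntegral χ Y (fun q => Φ (x, q)) (fun q => f i (x, q))
      (oscValue χ Y Φ d ρ δ (f i) x) := by
  filter_upwards [eventually_ge_atTop (critIndex N d (min ρ (1 - δ)))] with κ hκ
  have heq : EqOn (fun q => oscIntegrand χ Φ κ (f i) (x, q)) (fun q =>
      Complex.exp (Complex.I * Φ (x, q)) *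
        ((regOp χ (fun q => Φ (x, q)))^[κ] (fun q => f i (x, q))) q)
      ((Y : Set (Euc nY)) ×ˢ ({0}ᶜ : Set (Euc N))) := fun q hq => by
    dsimp only [oscIntegrand]
    rw [regOp_iterate_slice h hχ ((hf 0).contDiffOn i) κ ⟨hx, hq.1, hq.2⟩]
  have hint := (integrableOn_oscIntegrand h hχ hρ hρ_le hδ hδ_lt hf hS hSY hf0 hκ i hx).congr_fun
    heq (measurableSet_fiber Y N)
  refine ⟨hint, ?_⟩
  rw [← paramIntegral_oscIntegrand_eq h hχ hρ hρ_le hδ hδ_lt hf hS hSY hf0 hκ i hx, paramIntegral,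
    setIntegral_congr_fun (measurableSet_fiber Y N) heq]
  -- Fubini, in the order of the definition: y inside, ξ outside.
  rw [IntegrableOn, Measure.volume_eq_prod, ← Measure.prod_restrict] at hint
  rw [Measure.volume_eq_prod, ← Measure.prod_restrict, integral_prod_symm _ hint]

/-- The value does not depend on κ, so each order of differentiability may be proved with its own,
larger κ. -/
theorem contDiffOn_oscValue (i : I) : ContDiffOn ℝ ∞ (oscValue χ Y Φ d ρ δ (f i)) X := by
  refine contDiffOn_infty.2 fun k => ?_
  have hτ := min_pos_of hρ hδ_lt
  -- The first index ensures that the value is the right one. The second leaves room for k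
  -- derivatives, each of which raises the order by one.
  set κ := max (critIndex N d (min ρ (1 - δ))) (critIndex N (d + k) (min ρ (1 - δ)))
  have h1 := lt_of_critIndex_le hτ (le_max_right _ _ : critIndex N (d + k) (min ρ (1 - δ)) ≤ κ)
  refine (contDiffOn_paramIntegral (symb_oscIntegrand h hχ hρ_le hδ hδ_lt.le hf κ k) hS hSY
    (fun i p _ => oscIntegrand_eq_zero hS.isClosed (hf0 i) κ p) (by linarith) i).congr
    fun x hx => ?_
  exact (paramIntegral_oscIntegrand_eq h hχ hρ hρ_le hδ hδ_lt hf hS hSY hf0 (le_max_left _ _)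
    i hx).symm

theorem exists_norm_iteratedFDeriv_oscValue_le {K : Set (Euc nX)} (hK : IsCompact K)
    (hKX : K ⊆ X) {k : ℕ} (s : Fin k → Fin nX) : ∃ C, 0 ≤ C ∧ ∀ i, ∀ x ∈ K,
      ‖iteratedFDeriv ℝ k (oscValue χ Y Φ d ρ δ (f i)) x (fun t => basisDir (s t))‖ ≤ C := by
  have hτ := min_pos_of hρ hδ_lt
  set κ := max (critIndex N d (min ρ (1 - δ))) (critIndex N (d + k) (min ρ (1 - δ)))
  have h1 := lt_of_critIndex_le hτ (le_max_right _ _ : critIndex N (d + k) (min ρ (1 - δ)) ≤ κ)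
  obtain ⟨C, hC0, hC⟩ := exists_norm_iteratedFDeriv_paramIntegral_le
    (symb_oscIntegrand h hχ hρ_le hδ hδ_lt.le hf κ k) hS hSY
    (fun i p _ => oscIntegrand_eq_zero hS.isClosed (hf0 i) κ p) (by linarith) hK hKX s
  refine ⟨C, hC0, fun i x hx => ?_⟩
  have he : oscValue χ Y Φ d ρ δ (f i) =ᶠ[𝓝 x] paramIntegral Y (oscIntegrand χ Φ κ (f i)) := by
    filter_upwards [X.isOpen.mem_nhds (hKX hx)] with z hz
    exact (paramIntegral_oscIntegrand_eq h hχ hρ hρ_le hδ hδ_lt hf hS hSY hf0 (le_max_left _ _)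
      i hz).symm
  rw [(he.iteratedFDeriv ℝ k).eq_of_nhds]
  exact hC i x hx

/-- The smooth function on `X` that is given by the oscillatory integral. -/
theorem exists_cinfty_oscValue (i : I) : ∃ v : CInfty X, ∀ x ∈ X,
    v x = ((2 * Real.pi : ℝ) : ℂ)⁻¹ ^ N * oscValue χ Y Φ d ρ δ (f i) x := by
  let F : Euc nX → ℂ := fun x =>
    ((2 * Real.pi : ℝ) : ℂ)⁻¹ ^ N * oscValue χ Y Φ d ρ δ (f i) x
  refine ⟨⟨(X : Set (Euc nX)).indicator F, ?_, fun x hx => indicator_of_notMem hx _⟩,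
    fun x hx => show (X : Set (Euc nX)).indicator F x = F x from indicator_of_mem hx F⟩
  exact (contDiffOn_const.mul (contDiffOn_oscValue h hχ hρ hρ_le hδ hδ_lt hf hS hSY hf0 i)).congr
    fun x hx => indicator_of_mem hx _

end Operators


/-! ### Measurable dependence of derivatives on ω -/

section MeasurableDerivatives

variable {Ω : Type*} [MeasurableSpace Ω] {E F : Type*} [NormedAddCommGroup E] [NormedSpace ℝ E]
  [NormedAddCommGroup F] [NormedSpace ℝ F] [MeasurableSpace F] [BorelSpace F]
  [SecondCountableTopology F]

/-- A directional derivative is the limit of the difference quotients with step 1/(n + 1); those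
that leave U are replaced by 0, which affects finitely many n only. -/
theorem measurable_fderiv_apply_of_forall {U : Set E} (hU : IsOpen U) {f : Ω → E → F}
    (hf : ∀ o, ContDiffOn ℝ ∞ (f o) U) (hm : ∀ p ∈ U, Measurable fun o => f o p) {p : E}
    (hp : p ∈ U) (v : E) : Measurable fun o => fderiv ℝ (f o) p v := by
  classical
  let c : ℕ → ℝ := fun n => n + 1
  have hc : Tendsto (fun n => ‖c n‖) atTop atTop :=
    tendsto_norm_atTop_atTop.comp (tendsto_natCast_atTop_atTop.atTop_add tendsto_const_nhds)
  have hc' : Tendsto (fun n => p + (c n)⁻¹ • v) atTop (𝓝 p) := by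
    have h1 : Tendsto (fun n => (c n)⁻¹) atTop (𝓝 0) :=
      tendsto_inv_atTop_zero.comp (tendsto_natCast_atTop_atTop.atTop_add tendsto_const_nhds)
    simpa using tendsto_const_nhds.add (h1.smul_const v)
  refine measurable_of_tendsto_metrizable (f := fun n o =>
    if p + (c n)⁻¹ • v ∈ U then c n • (f o (p + (c n)⁻¹ • v) - f o p) else 0) (fun n => ?_)
    (tendsto_pi_nhds.2 fun o => ?_)
  · by_cases h : p + (c n)⁻¹ • v ∈ U
    · simp only [h, if_true]
      exact ((hm _ h).sub (hm p hp)).const_smul (c n)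
    · simp only [h, if_false]
      exact measurable_const
  · refine Tendsto.congr' ?_ ((differentiableAt_of_contDiffOn (hf o) hU hp).hasFDerivAt.lim v hc)
    filter_upwards [hc'.eventually (hU.mem_nhds hp)] with n hn
    exact (if_pos hn).symm

theorem measurable_iteratedFDeriv_apply {U : Set E} (hU : IsOpen U) {f : Ω → E → F}
    (hf : ∀ o, ContDiffOn ℝ ∞ (f o) U) (hm : ∀ p ∈ U, Measurable fun o => f o p) {k : ℕ}
    (v : Fin k → E) {p : E} (hp : p ∈ U) :
    Measurable fun o => iteratedFDeriv ℝ k (f o) p v := by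
  induction k generalizing f with
  | zero => simpa using hm p hp
  | succ k ih =>
    have h1 (o : Ω) : iteratedFDeriv ℝ (k + 1) (f o) p v = _ :=
      iteratedFDeriv_succ_apply_last (((hf o).contDiffAt (hU.mem_nhds hp)).of_le
        (by exact_mod_cast le_top)) v
    simp only [h1]
    exact ih (fun o => ContDiffOn.fderiv_apply_const (hf o) hU _)
      (fun q hq => measurable_fderiv_apply_of_forall hU hf hm hq _) _

end MeasurableDerivatives

/-! ### Measurable dependence of the oscillatory integral on ω -/

section MeasurableOperators

variable {Ω : Type*} [MeasurableSpace Ω] {nX nY N : ℕ} {X : Opens (Euc nX)} {Y : Opens (Euc nY)}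
  {χ : Euc N → ℂ} {Φ : Ω → Euc nX × Euc nY × Euc N → ℝ} {f : Ω → Euc nX × Euc nY × Euc N → ℂ}

theorem measurable_coeff (h : ∀ o, IsPhase X Y (Φ o))
    (hΦ : ∀ p ∈ box X Y (punctured N), Measurable fun o => Φ o p) (j : Fin nY ⊕ Fin N)
    {p : Euc nX × Euc nY × Euc N} (hp : p ∈ box X Y (punctured N)) :
    Measurable fun o => coeff χ (Φ o) j p := by
  have hd (v : Euc nX × Euc nY × Euc N) : Measurable fun o => fderiv ℝ (Φ o) p v :=
    measurable_fderiv_apply_of_forall (box X Y (punctured N)).isOpen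
      (fun o => (h o).contDiffOn) hΦ hp v
  have hr : Measurable fun o => phaseR (Φ o) p :=
    (Finset.measurable_fun_sum _ fun l _ => ((hd _).pow_const 2).const_mul _).add
      (Finset.measurable_fun_sum _ fun k _ => (hd _).pow_const 2)
  unfold coeff coeffHom
  exact ((((Complex.measurable_ofReal.comp hr).const_div _).mul_const _).mul
    (Complex.measurable_ofReal.comp (hd _))).const_mul _

theorem measurable_regOpParam_iterate (h : ∀ o, IsPhase X Y (Φ o)) (hχ : IsCutoff χ)
    (hΦ : ∀ p ∈ box X Y (punctured N), Measurable fun o => Φ o p)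
    (hf : ∀ o, ContDiffOn ℝ ∞ (f o) (box X Y (punctured N)))
    (hfm : ∀ p ∈ box X Y (punctured N), Measurable fun o => f o p) (κ : ℕ)
    {p : Euc nX × Euc nY × Euc N} (hp : p ∈ box X Y (punctured N)) :
    Measurable fun o => (regOpParam χ (Φ o))^[κ] (f o) p := by
  induction κ generalizing p with
  | zero => exact hfm p hp
  | succ κ ih =>
    simp only [Function.iterate_succ_apply']
    have hs (o : Ω) := contDiffOn_regOpParam_iterate (h o) hχ (hf o) κ
    refine (Finset.measurable_fun_sum _ fun j _ => ?_).neg.add ((ih hp).const_mul _)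
    exact measurable_fderiv_apply_of_forall (box X Y (punctured N)).isOpen
      (fun o => contDiffOn_coeff_mul (h o) hχ (hs o) j)
      (fun q hq => (measurable_coeff h hΦ j hq).mul (ih hq)) hp _

/-- The integrand is a Carathéodory function, continuous in (y, ξ) and measurable in ω, hence
jointly measurable. Continuity holds on Y × Ξ only, so the argument runs on this subtype with its
induced measure. -/
theorem measurable_paramIntegral (hf : ∀ o, ContinuousOn (f o) (box X Y (punctured N)))
    (hfm : ∀ p ∈ box X Y (punctured N), Measurable fun o => f o p) {x : Euc nX} (hx : x ∈ X) :
    Measurable fun o => paramIntegral Y (f o) x := by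
  have hs := measurableSet_fiber Y N
  have h1 : Measurable (Function.uncurry
      fun (q : ((Y : Set (Euc nY)) ×ˢ ({0}ᶜ : Set (Euc N)) : Set _)) o => f o (x, q.1)) :=
    measurable_uncurry_of_continuous_of_measurable
      (fun o => (continuousOn_slice (hf o) hx).domRestrict)
      (fun q => hfm _ ⟨hx, q.2.1, q.2.2⟩)
  have : SigmaFinite (Measure.comap (Subtype.val :
      ((Y : Set (Euc nY)) ×ˢ ({0}ᶜ : Set (Euc N)) : Set _) → _) volume) := by
    refine SigmaFinite.of_map _ measurable_subtype_coe.aemeasurable ?_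
    rw [map_comap_subtype_coe hs]
    infer_instance
  have h2 := h1.stronglyMeasurable.integral_prod_left' (μ := Measure.comap Subtype.val volume)
  simp only [Function.uncurry] at h2
  have h3 (o : Ω) := integral_subtype_comap (μ := volume) hs (fun q => f o (x, q))
  simp only [h3] at h2
  exact h2.measurable

/-- `critIndex` is the same for all ω, so a single power of the regularizing operator is involved.
-/
theorem measurable_oscValue (h : ∀ o, IsPhase X Y (Φ o)) (hχ : IsCutoff χ)
    (hΦ : ∀ p ∈ box X Y (punctured N), Measurable fun o => Φ o p)
    (hf : ∀ o, ContDiffOn ℝ ∞ (f o) (box X Y (punctured N)))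
    (hfm : ∀ p ∈ box X Y (punctured N), Measurable fun o => f o p) (d ρ δ : ℝ) {x : Euc nX}
    (hx : x ∈ X) : Measurable fun o => oscValue χ Y (Φ o) d ρ δ (f o) x := by
  refine measurable_paramIntegral (fun o => ?_) (fun p hp => ?_) hx
  · exact (contDiffOn_const.mul (h o).contDiffOn.ofReal).cexp.continuousOn.mul
      (contDiffOn_regOpParam_iterate (h o) hχ (hf o) _).continuousOn
  · exact (((Complex.measurable_ofReal.comp (hΦ p hp)).const_mul _).cexp).mul
      (measurable_regOpParam_iterate h hχ hΦ hf hfm _ hp)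

end MeasurableOperators

/-! ### Continuity of point evaluations on phases and amplitudes -/

section Evaluation

variable {nX nY N : ℕ} (X : Opens (Euc nX)) (Y : Opens (Euc nY))

theorem eventually_mem_exhaustion {n : ℕ} {Z : Opens (Euc n)} {x : Euc n} (hx : x ∈ Z) :
    ∀ᶠ m in atTop, x ∈ exhaustion Z m := by
  have hpos : 0 < Metric.infEDist x (Z : Set (Euc n))ᶜ := by
    refine pos_iff_ne_zero.2 fun h0 => ?_
    have := Metric.mem_closure_iff_infEDist_zero.2 h0
    rw [Z.isOpen.isClosed_compl.closure_eq] at this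
    exact this hx
  obtain ⟨M, hM⟩ := ENNReal.exists_inv_nat_lt hpos.ne'
  filter_upwards [eventually_ge_atTop M, eventually_ge_atTop ⌈‖x‖⌉₊] with m h1 h2
  refine ⟨hx, (Nat.le_ceil _).trans (by exact_mod_cast h2), ?_⟩
  exact (ENNReal.inv_le_inv.2 (by exact_mod_cast h1)).trans hM.le

theorem continuous_of_norm_le_seminorm {𝕜 V : Type*} [RCLike 𝕜] [AddCommGroup V] [Module 𝕜 V]
    [TopologicalSpace V] {p : SeminormFamily 𝕜 V ℕ} (hp : WithSeminorms p) (L : V →ₗ[𝕜] 𝕜)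
    {C : ℝ} (hC : 0 ≤ C) {m : ℕ} (h : ∀ v, ‖L v‖ ≤ C * p m v) : Continuous L := by
  refine hp.continuous_normedSpace_rng 𝕜 L ⟨{m}, ⟨C, hC⟩, fun v => ?_⟩
  simp only [Finset.sup_singleton]
  exact h v

/-- The seminorms see only ‖ξ‖ = 1; homogeneity transports the bound to p with constant ‖ξ‖. -/
theorem Mhg.continuous_apply {p : Euc nX × Euc nY × Euc N} (hp : p ∈ box X Y (punctured N)) :
    Continuous fun Φ : Mhg X Y N => Φ p := by
  obtain ⟨m, hmX, hmY⟩ :=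
    ((eventually_mem_exhaustion hp.1).and (eventually_mem_exhaustion hp.2.1)).exists
  have hn : 0 < ‖p.2.2‖ := norm_pos_iff.2 hp.2.2
  let L : Mhg X Y N →ₗ[ℝ] ℝ :=
    { toFun := fun Φ => Φ p, map_add' := fun _ _ => rfl, map_smul' := fun _ _ => rfl }
  refine continuous_of_norm_le_seminorm (Mhg.withSeminorms X Y N) L hn.le (m := m) fun Φ => ?_
  let p' : Euc nX × Euc nY × Euc N := (p.1, p.2.1, ‖p.2.2‖⁻¹ • p.2.2)
  have hp' : p' ∈ dom X Y N := ⟨hp.1, hp.2.1, smul_ne_zero (inv_ne_zero hn.ne') hp.2.2⟩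
  have h1 := Φ.2 p.1 hp.1 p.2.1 hp.2.1 _ hp'.2.2 _ hn
  rw [smul_inv_smul₀ hn.ne'] at h1
  change ‖Φ p‖ ≤ _
  have h2 : Φ p = ‖p.2.2‖ * Φ p' := h1
  rw [h2, norm_mul, norm_norm]
  refine mul_le_mul_of_nonneg_left ?_ hn.le
  have h3 := le_ciSup (Mhg.bdd X Y N m Φ) ⟨(⟨p', hp'⟩, ⟨0, Fin.elim0⟩), hmX, hmY, by
    simp [p', norm_smul, hn.ne']⟩
  refine le_trans (le_of_eq ?_) h3
  rw [one_mul]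
  change _ = ‖iteratedFDeriv ℝ 0 Φ.1.1 p' (fun t : Fin 0 => t.elim0)‖
  rw [iteratedFDeriv_zero_apply]

theorem Amplitude.continuous_apply {d ρ δ : ℝ} {p : Euc nX × Euc nY × Euc N}
    (hp : p ∈ box X Y (punctured N)) : Continuous fun a : Amplitude X Y N d ρ δ => a p := by
  obtain ⟨m, hmX, hmY⟩ :=
    ((eventually_mem_exhaustion hp.1).and (eventually_mem_exhaustion hp.2.1)).exists
  let L : Amplitude X Y N d ρ δ →ₗ[ℂ] ℂ :=
    { toFun := fun a => a p, map_add' := fun _ _ => rfl, map_smul' := fun _ _ => rfl }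
  refine continuous_of_norm_le_seminorm (Amplitude.withSeminorms X Y N d ρ δ) L
    (Real.rpow_nonneg (bracket_pos p.2.2).le d) (m := m) fun a => ?_
  have h3 := le_ciSup (Amplitude.bdd X Y N d ρ δ m a) ⟨(⟨p, hp⟩, ⟨0, Fin.elim0⟩), hmX, hmY⟩
  have h4 : bracket p.2.2 ^ (-d) * ‖a p‖ ≤ Amplitude.seminorm X Y N d ρ δ m a := by
    refine le_trans (le_of_eq ?_) h3
    change _ = bracket p.2.2 ^ (-d + ρ * ((xiOrder (Fin.elim0 : Fin 0 → Idx nX nY N) : ℕ) : ℝ) -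
      δ * ((xyOrder (Fin.elim0 : Fin 0 → Idx nX nY N) : ℕ) : ℝ)) * ‖iteratedFDeriv ℝ 0 a.1.1 p (fun t : Fin 0 => t.elim0)‖
    rw [iteratedFDeriv_zero_apply]
    simp [xiOrder, xyOrder]
  rw [Real.rpow_neg (bracket_pos _).le,
    inv_mul_le_iff₀ (Real.rpow_pos_of_pos (bracket_pos _) _)] at h4
  exact h4

end Evaluation


/-! ### Borel measurability in separable spaces with countably many seminorms -/

section Separability

theorem exists_countable_dist_lt {V W : Type*} [PseudoMetricSpace W] [SecondCountableTopology W]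
    (r : V → W) : ∃ D : Set V, D.Countable ∧ ∀ v, ∀ ε > 0, ∃ d ∈ D, dist (r v) (r d) < ε := by
  let _ : PseudoMetricSpace V := PseudoMetricSpace.induced r inferInstance
  have : SecondCountableTopology V := secondCountableTopology_induced V W r
  obtain ⟨D, hD, hd⟩ := exists_countable_dense V
  exact ⟨D, hD, fun v ε hε => hd.exists_dist_lt v hε⟩

/-- Separability is inherited through maps into separable metric spaces. One countable set is chosen
for each finite set of seminorms, and there are countably many of these. -/
theorem exists_countable_seminorm_lt {ι 𝕜 V : Type*} [Countable ι] [RCLike 𝕜] [AddCommGroup V]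
    [Module 𝕜 V] (p : ι → Seminorm 𝕜 V) {W : ι → Type*} [∀ i, PseudoMetricSpace (W i)]
    [∀ i, SecondCountableTopology (W i)] (r : ∀ i, V → W i)
    (hr : ∀ i u v, p i (u - v) ≤ dist (r i u) (r i v)) :
    ∃ D : Set V, D.Countable ∧ ∀ (s : Finset ι) v, ∀ ε > 0, ∃ d ∈ D, s.sup p (v - d) < ε := by
  choose D hD hd using fun s : Finset ι =>
    exists_countable_dist_lt (fun v (i : s) => r i v)
  refine ⟨⋃ s, D s, countable_iUnion hD, fun s v ε hε => ?_⟩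
  obtain ⟨d, hdD, hdv⟩ := hd s v ε hε
  refine ⟨d, mem_iUnion.2 ⟨s, hdD⟩, Seminorm.finset_sup_apply_lt hε fun i hi => ?_⟩
  exact (hr i v d).trans_lt ((dist_le_pi_dist (fun i : s => r i v) _ ⟨i, hi⟩).trans_lt hdv)

/-- Balls of finite suprema of seminorms with centres in D and radii 1/(n + 1) form a countable
base, and the preimage of such a ball is a finite intersection of measurable sets. -/
theorem measurable_of_measurable_seminorm {Ω ι 𝕜 V : Type*} [MeasurableSpace Ω] [Countable ι]
    [Nonempty ι] [RCLike 𝕜] [AddCommGroup V] [Module 𝕜 V] [TopologicalSpace V] [MeasurableSpace V]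
    [BorelSpace V] {p : SeminormFamily 𝕜 V ι} (hp : WithSeminorms p) {D : Set V}
    (hD : D.Countable) (hd : ∀ (s : Finset ι) v, ∀ ε > 0, ∃ d ∈ D, s.sup p (v - d) < ε)
    {F : Ω → V} (hF : ∀ i, ∀ d ∈ D, Measurable fun o => p i (F o - d)) : Measurable F := by
  refine measurable_of_isOpen fun U hU => ?_
  let T : Set (V × Finset ι × ℕ) :=
    {t | t.1 ∈ D ∧ (t.2.1.sup p).ball t.1 (1 / ((t.2.2 : ℝ) + 1)) ⊆ U}
  have hT : T.Countable :=
    (hD.prod (countable_univ (α := Finset ι × ℕ))).mono fun t ht => mk_mem_prod ht.1 (mem_univ _)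
  have hU' : U = ⋃ t ∈ T, (t.2.1.sup p).ball t.1 (1 / ((t.2.2 : ℝ) + 1)) := by
    refine Subset.antisymm (fun x hx => ?_) (iUnion₂_subset fun t ht => ht.2)
    obtain ⟨s, r, hr, hs⟩ := (hp.isOpen_iff_mem_balls U).1 hU x hx
    -- With radius below r/2, the ball around d contains x and stays inside the r-ball around x.
    obtain ⟨n, hn⟩ := exists_nat_one_div_lt (half_pos hr)
    obtain ⟨d, hdD, hdx⟩ := hd s x _ (Nat.one_div_pos_of_nat (α := ℝ) (n := n))
    have hsub : (s.sup p).ball d (1 / ((n : ℝ) + 1)) ⊆ U := by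
      refine fun y hy => hs ?_
      rw [Seminorm.mem_ball] at hy ⊢
      have h1 := map_add_le_add (s.sup p) (y - d) (d - x)
      rw [sub_add_sub_cancel, map_sub_rev (s.sup p) d x] at h1
      linarith
    exact mem_iUnion₂.2 ⟨(d, s, n), ⟨hdD, hsub⟩, (Seminorm.mem_ball _).2 hdx⟩
  rw [hU', preimage_iUnion₂]
  refine MeasurableSet.biUnion hT fun t ht => ?_
  have hpos : 0 < 1 / ((t.2.2 : ℝ) + 1) := Nat.one_div_pos_of_nat
  have h1 : F ⁻¹' (t.2.1.sup p).ball t.1 (1 / ((t.2.2 : ℝ) + 1)) =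
      ⋂ i ∈ t.2.1, {o | p i (F o - t.1) < 1 / ((t.2.2 : ℝ) + 1)} := by
    ext o
    simp only [mem_preimage, Seminorm.mem_ball, mem_iInter, mem_ofPred_eq]
    exact ⟨fun h i hi => (Seminorm.le_finset_sup_apply hi).trans_lt h,
      Seminorm.finset_sup_apply_lt hpos⟩
  rw [h1]
  exact Finset.measurableSet_biInter _ fun i _ =>
    measurableSet_lt (hF i _ ht.1) measurable_const

end Separability

/-! ### Borel measurability of maps into C^∞ -/

namespace CInfty

variable {n : ℕ} (X : Opens (Euc n))

instance compactSpace_exhaustion (m : ℕ) : CompactSpace (exhaustion X m) :=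
  isCompact_iff_compactSpace.1 (isCompact_exhaustion X m)

theorem contDiffOn (f : CInfty X) : ContDiffOn ℝ ∞ f X := f.2.1

theorem continuousOn_iteratedFDeriv (f : CInfty X) {k : ℕ} (v : Fin k → Euc n) :
    ContinuousOn (fun x => iteratedFDeriv ℝ k f x v) X := continuousOn_deriv f.2 v

/-- The partial derivatives of order at most `m`, restricted to `K_{X,m}`. -/
noncomputable def restrictJet (m : ℕ) (f : CInfty X) (s : Multi (Fin n) m) :
    C(exhaustion X m, ℂ) :=
  ⟨fun x => iteratedFDeriv ℝ s.1 f x (fun t => basisDir (s.2 t)),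
    ((continuousOn_iteratedFDeriv X f _).mono fun _ hx => hx.1).domRestrict⟩

theorem iteratedFDeriv_sub_apply (f g : CInfty X) {x : Euc n} (hx : x ∈ X) {k : ℕ}
    (v : Fin k → Euc n) : iteratedFDeriv ℝ k (f - g : CInfty X) x v =
      iteratedFDeriv ℝ k f x v - iteratedFDeriv ℝ k g x v :=
  map_sub (derivAt ℂ X ⟨x, hx⟩ v) f g

theorem seminorm_le_iff {m : ℕ} {f : CInfty X} {c : ℝ} (hc : 0 ≤ c) :
    CInfty.seminorm X m f ≤ c ↔ ∀ (s : Multi (Fin n) m), ∀ x ∈ exhaustion X m,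
      ‖iteratedFDeriv ℝ s.1 f x (fun t => basisDir (s.2 t))‖ ≤ c := by
  constructor
  · intro h s x hx
    refine le_trans ?_ h
    have := le_ciSup (CInfty.bdd X m f) ⟨(⟨x, hx.1⟩, s), hx⟩
    rw [one_mul] at this
    exact this
  · intro h
    refine Real.iSup_le (fun i => ?_) hc
    rw [one_mul]
    exact h i.1.2 i.1.1 i.2

theorem seminorm_sub_le_dist (m : ℕ) (f g : CInfty X) :
    CInfty.seminorm X m (f - g) ≤ dist (restrictJet X m f) (restrictJet X m g) := by
  refine (seminorm_le_iff X dist_nonneg).2 fun s x hx => ?_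
  rw [iteratedFDeriv_sub_apply X f g hx.1, ← dist_eq_norm]
  exact (ContinuousMap.dist_apply_le_dist (f := restrictJet X m f s) (g := restrictJet X m g s)
    ⟨x, hx⟩).trans (dist_le_pi_dist _ _ s)

theorem exists_countable_dense : ∃ D : Set (CInfty X), D.Countable ∧
    ∀ (s : Finset ℕ) v, ∀ ε > 0, ∃ d ∈ D, s.sup (CInfty.seminorm X) (v - d) < ε :=
  exists_countable_seminorm_lt (CInfty.seminorm X) (restrictJet X) (seminorm_sub_le_dist X)

/-- The derivatives are continuous on the compact set, so the supremum may be taken over a countable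
dense subset. -/
theorem measurable_seminorm {Ω : Type*} [MeasurableSpace Ω] {F : Ω → CInfty X}
    (hF : ∀ x ∈ X, Measurable fun o => F o x) (m : ℕ) :
    Measurable fun o => CInfty.seminorm X m (F o) := by
  refine measurable_of_Iic fun c => ?_
  by_cases hc : 0 ≤ c
  · obtain ⟨D, hD, hd⟩ := TopologicalSpace.exists_countable_dense (exhaustion X m)
    have h1 : (fun o => CInfty.seminorm X m (F o)) ⁻¹' Iic c =
        ⋂ (s : Multi (Fin n) m), ⋂ x ∈ D,
          {o | ‖iteratedFDeriv ℝ s.1 (F o) x (fun t => basisDir (s.2 t))‖ ≤ c} := by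
      ext o
      simp only [mem_preimage, mem_Iic, mem_iInter, mem_ofPred_eq]
      rw [seminorm_le_iff X hc]
      refine ⟨fun h s x _ => h s x x.2, fun h s x hx => ?_⟩
      have h2 : IsClosed {y : exhaustion X m | ‖restrictJet X m (F o) s y‖ ≤ c} :=
        isClosed_le (restrictJet X m (F o) s).continuous.norm continuous_const
      exact h2.closure_subset_iff.2 (fun y hy => h s y hy) (hd ⟨x, hx⟩)
    rw [h1]
    refine MeasurableSet.iInter fun s => MeasurableSet.biInter hD fun x _ => ?_
    exact measurableSet_le (measurable_iteratedFDeriv_apply X.isOpen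
      (fun o => contDiffOn X (F o)) hF _ x.2.1).norm measurable_const
  · have h1 : (fun o => CInfty.seminorm X m (F o)) ⁻¹' Iic c = ∅ :=
      eq_empty_of_forall_notMem fun o ho => hc ((apply_nonneg _ _).trans ho)
    rw [h1]
    exact MeasurableSet.empty

theorem measurable_of_apply {Ω : Type*} [MeasurableSpace Ω] {F : Ω → CInfty X}
    (hF : ∀ x ∈ X, Measurable fun o => F o x) : Measurable F := by
  obtain ⟨D, hD, hd⟩ := exists_countable_dense X
  refine measurable_of_measurable_seminorm (CInfty.withSeminorms X) hD hd fun m d _ => ?_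
  exact measurable_seminorm X (F := fun o => F o - d) (fun x hx => (hF x hx).sub_const (d x)) m

end CInfty


/-! ### Amplitudes times bounded families of test functions -/

section BoundedFamilies

variable {nX nY N : ℕ} {I : Type*} {X : Opens (Euc nX)} {Y : Opens (Euc nY)} {ρ δ d : ℝ}
  {a : Euc nX × Euc nY × Euc N → ℂ}

theorem isBoundedFamily_of_hasCompactSupport {ψ : Euc nY → ℂ} (h : ContDiff ℝ ∞ ψ)
    (hc : HasCompactSupport ψ) : IsBoundedFamily (fun _ : Unit => ψ) := by
  refine ⟨fun _ => h, fun k => ?_⟩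
  obtain ⟨C, hC⟩ := (hc.iteratedFDeriv (𝕜 := ℝ) k).exists_bound_of_continuous
    (h.continuous_iteratedFDeriv (m := k) (by exact_mod_cast le_top))
  exact ⟨C, (norm_nonneg _).trans (hC 0), fun _ y => hC y⟩

theorem isBoundedFamily_of_isVonNBounded {K : Compacts (Euc nY)} {B : Set 𝓓_{K}(Euc nY, ℂ)}
    (hB : Bornology.IsVonNBounded ℂ B) : IsBoundedFamily (fun φ : B => (φ.1 : Euc nY → ℂ)) := by
  refine ⟨fun φ => φ.1.contDiff, fun k => ?_⟩
  obtain ⟨r, hr, h⟩ := (ContDiffMapSupportedIn.withSeminorms ℂ (Euc nY) ℂ ⊤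
    K).isVonNBounded_iff_seminorm_bounded.1 hB k
  exact ⟨r, hr.le, fun φ y =>
    (ContDiffMapSupportedIn.norm_iteratedFDeriv_apply_le_seminorm_top ℂ).trans (h φ.1 φ.2).le⟩

theorem symb_mul_isBoundedFamily (hδ : 0 ≤ δ)
    (ha : ∀ n, Symb X Y (punctured N) dir (stdWeight ρ δ) n d (fun _ : Unit => a))
    {ψ : I → Euc nY → ℂ} (hψ : IsBoundedFamily ψ) (n : ℕ) :
    Symb X Y (punctured N) dir (stdWeight ρ δ) n d (fun i p => a p * ψ i p.2.1) := by
  have h1 := ((ha n).reparam (fun _ : I => ())).mul (hψ.symb (X := X) (Y := Y) (R := punctured N)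
    (e := dir) (w := stdWeight ρ δ)
    (by rintro (j | j | j) <;> simp [dir, stdWeight, hδ]) le_rfl n)
  rwa [add_zero] at h1

end BoundedFamilies

/-! ### The operator on test functions and its continuity -/

section Operator

variable {nX nY N : ℕ} {X : Opens (Euc nX)} {Y : Opens (Euc nY)}
  {χ : Euc N → ℂ} {Φ : Euc nX × Euc nY × Euc N → ℝ} {ρ δ d : ℝ} {a : Euc nX × Euc nY × Euc N → ℂ}

variable (h : IsPhase X Y Φ) (hχ : IsCutoff χ) (hρ : 0 < ρ) (hρ_le : ρ ≤ 1) (hδ : 0 ≤ δ)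
  (hδ_lt : δ < 1)
  (ha : ∀ n, Symb X Y (punctured N) dir (stdWeight ρ δ) n d (fun _ : Unit => a))

include h hχ hρ hρ_le hδ hδ_lt ha

/-- The operator `ψ ↦ A_{Φ,a}[ψ]` on test functions. -/
theorem exists_linearMap_oscValue : ∃ W : 𝓓(Y, ℂ) →ₗ[ℂ] CInfty X, ∀ ψ : 𝓓(Y, ℂ), ∀ x ∈ X,
    W ψ x = ((2 * Real.pi : ℝ) : ℂ)⁻¹ ^ N *
      oscValue χ Y Φ d ρ δ (fun p => a p * ψ p.2.1) x := by
  have hsymb (ψ : 𝓓(Y, ℂ)) := symb_mul_isBoundedFamily hδ ha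
    (isBoundedFamily_of_hasCompactSupport ψ.contDiff ψ.hasCompactSupport)
  have h0 (ψ : 𝓓(Y, ℂ)) (_ : Unit) (p : Euc nX × Euc nY × Euc N) (hp : p.2.1 ∉ tsupport ψ) :
      a p * ψ p.2.1 = 0 := by rw [image_eq_zero_of_notMem_tsupport hp, mul_zero]
  choose W hW using fun ψ : 𝓓(Y, ℂ) => exists_cinfty_oscValue h hχ hρ hρ_le hδ hδ_lt (hsymb ψ)
    ψ.hasCompactSupport ψ.tsupport_subset (h0 ψ) ()
  have hint (ψ : 𝓓(Y, ℂ)) {x : Euc nX} (hx : x ∈ X) := integrableOn_oscIntegrand h hχ hρ hρ_le hδ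
    hδ_lt (hsymb ψ) ψ.hasCompactSupport ψ.tsupport_subset (h0 ψ) le_rfl () hx
  have hlin (c : ℂ) (ψ θ : 𝓓(Y, ℂ)) {x : Euc nX} (hx : x ∈ X) :
      oscValue χ Y Φ d ρ δ (fun p => a p * ψ p.2.1 + c * (a p * θ p.2.1)) x =
        oscValue χ Y Φ d ρ δ (fun p => a p * ψ p.2.1) x +
          c * oscValue χ Y Φ d ρ δ (fun p => a p * θ p.2.1) x := by
    unfold oscValue paramIntegral
    rw [← integral_const_mul, ← integral_add (hint ψ hx) ((hint θ hx).const_mul c)]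
    refine setIntegral_congr_fun (measurableSet_fiber Y N) fun q hq => ?_
    have h1 := regOpParam_iterate_add_smul h hχ ((hsymb ψ 0).contDiffOn ())
      ((hsymb θ 0).contDiffOn ()) c (critIndex N d (min ρ (1 - δ)))
      (show (x, q) ∈ box X Y (punctured N) from ⟨hx, hq.1, hq.2⟩)
    simp only [oscIntegrand] at h1 ⊢
    rw [h1]
    ring
  refine ⟨⟨⟨W, fun ψ θ => CInfty.ext fun x hx => ?_⟩, fun c θ => CInfty.ext fun x hx => ?_⟩, hW⟩
  · change W (ψ + θ) x = W ψ x + W θ x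
    have h1 : (fun p : Euc nX × Euc nY × Euc N => a p * (ψ + θ) p.2.1) =
        fun p => a p * ψ p.2.1 + 1 * (a p * θ p.2.1) := by
      funext p
      simp [mul_add]
    rw [hW _ x hx, hW _ x hx, hW _ x hx, h1, hlin 1 ψ θ hx, one_mul, mul_add]
  · change W (c • θ) x = c * W θ x
    have h1 : (fun p : Euc nX × Euc nY × Euc N => a p * (c • θ) p.2.1) =
        fun p => a p * (0 : 𝓓(Y, ℂ)) p.2.1 + c * (a p * θ p.2.1) := by
      funext p
      simp [mul_left_comm]
    -- For zero test functions and factor -1 this reads V = V - V, whence V = 0.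
    have h2 := hlin (-1) 0 0 hx
    simp only [zero_apply, mul_zero, add_zero] at h2
    have h3 : oscValue χ Y Φ d ρ δ (fun p => a p * (0 : 𝓓(Y, ℂ)) p.2.1) x = 0 := by
      simp only [zero_apply, mul_zero]
      linear_combination h2
    rw [hW _ x hx, hW _ x hx, h1, hlin c 0 θ hx, h3, zero_add, mul_left_comm]

theorem isFIO_of_eq_oscValue {ψ : 𝓓(Y, ℂ)} {v : CInfty X} (hv : ∀ x ∈ X,
    v x = ((2 * Real.pi : ℝ) : ℂ)⁻¹ ^ N * oscValue χ Y Φ d ρ δ (fun p => a p * ψ p.2.1) x) :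
    IsFIO χ Φ a ψ v := fun x hx =>
  ⟨_, hasOscIntegral_oscValue h hχ hρ hρ_le hδ hδ_lt (symb_mul_isBoundedFamily hδ ha
      (isBoundedFamily_of_hasCompactSupport ψ.contDiff ψ.hasCompactSupport))
    ψ.hasCompactSupport ψ.tsupport_subset
    (fun _ p hp => by rw [image_eq_zero_of_notMem_tsupport hp, mul_zero]) () hx, hv x hx⟩

/-- As 𝓓_K is first countable, it suffices that bounded sets have bounded images. This is the
uniform derivative bound, with the bounded set itself as the index of the family. -/
theorem continuous_comp_ofSupportedIn {W : 𝓓(Y, ℂ) →ₗ[ℂ] CInfty X}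
    (hW : ∀ ψ : 𝓓(Y, ℂ), ∀ x ∈ X, W ψ x = ((2 * Real.pi : ℝ) : ℂ)⁻¹ ^ N *
      oscValue χ Y Φ d ρ δ (fun p => a p * ψ p.2.1) x) {K : Compacts (Euc nY)}
    (hK : (K : Set (Euc nY)) ⊆ Y) :
    Continuous fun φ : 𝓓_{K}(Euc nY, ℂ) => W (TestFunction.ofSupportedIn hK φ) := by
  have hp := CInfty.withSeminorms X
  have : IsTopologicalAddGroup (CInfty X) := hp.topologicalAddGroup
  have : ContinuousSMul ℂ (CInfty X) := hp.continuousSMul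
  have : FirstCountableTopology 𝓓_{K}(Euc nY, ℂ) :=
    (ContDiffMapSupportedIn.withSeminorms ℂ (Euc nY) ℂ ⊤ K).firstCountableTopology
  refine LinearMap.continuous_of_locally_bounded
    (W.comp (TestFunction.ofSupportedInCLM ℂ hK).toLinearMap) fun B hB => ?_
  rw [hp.image_isVonNBounded_iff_seminorm_bounded]
  intro m
  have hsymb := symb_mul_isBoundedFamily hδ ha (isBoundedFamily_of_isVonNBounded hB)
  have h0 (φ : B) (p : Euc nX × Euc nY × Euc N) (hp : p.2.1 ∉ (K : Set (Euc nY))) :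
      a p * φ.1 p.2.1 = 0 := by rw [φ.1.zero_on_compl hp, Pi.zero_apply, mul_zero]
  choose C hC0 hC using fun s : Multi (Fin nX) m => exists_norm_iteratedFDeriv_oscValue_le h hχ hρ
    hρ_le hδ hδ_lt hsymb K.isCompact hK h0 (isCompact_exhaustion X m) (fun x hx => hx.1) s.2
  set c : ℂ := ((2 * Real.pi : ℝ) : ℂ)⁻¹ ^ N
  have hb : 0 ≤ ‖c‖ * ∑ s, C s := mul_nonneg (norm_nonneg _) (Finset.sum_nonneg fun s _ => hC0 s)
  refine ⟨‖c‖ * ∑ s, C s + 1, by positivity, fun φ hφ => ?_⟩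
  refine lt_of_le_of_lt ((CInfty.seminorm_le_iff X hb).2 fun s x hx => ?_) (lt_add_one _)
  have h1 := hW (TestFunction.ofSupportedIn hK φ)
  have h2 : (W (TestFunction.ofSupportedIn hK φ) : Euc nX → ℂ) =ᶠ[𝓝 x]
      c • oscValue χ Y Φ d ρ δ (fun p => a p * φ p.2.1) := by
    filter_upwards [X.isOpen.mem_nhds hx.1] with z hz
    exact h1 z hz
  have h3 : ContDiffAt ℝ s.1 (oscValue χ Y Φ d ρ δ (fun p => a p * φ p.2.1)) x :=
    ((contDiffOn_oscValue h hχ hρ hρ_le hδ hδ_lt hsymb K.isCompact hK h0 ⟨φ, hφ⟩).contDiffAt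
      (X.isOpen.mem_nhds hx.1)).of_le (by exact_mod_cast le_top)
  change ‖iteratedFDeriv ℝ s.1 (W (TestFunction.ofSupportedIn hK φ) : Euc nX → ℂ) x _‖ ≤ _
  rw [(h2.iteratedFDeriv ℝ s.1).eq_of_nhds, iteratedFDeriv_const_smul_apply h3,
    smul_apply, norm_smul]
  exact mul_le_mul_of_nonneg_left ((hC s ⟨φ, hφ⟩ x hx).trans
    (Finset.single_le_sum (fun s _ => hC0 s) (Finset.mem_univ s))) (norm_nonneg _)

end Operator

/-! ### Phases in 𝓜_α and the exchange of x and y -/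

section Malpha

variable {nX nY N : ℕ} {X : Opens (Euc nX)} {Y : Opens (Euc nY)} {α : ℝ}

/-- The quantity bounded below by α is r / ‖ξ‖². -/
theorem phaseR_pos_of_le (hα : 0 < α) {Φ : Euc nX × Euc nY × Euc N → ℝ}
    {p : Euc nX × Euc nY × Euc N} (hp : p.2.2 ≠ 0)
    (h : α ≤ ∑ k, (‖p.2.2‖⁻¹ * fderiv ℝ Φ p (dir (.inr (.inl k)))) ^ 2 +
      ∑ l, (fderiv ℝ Φ p (dir (.inr (.inr l)))) ^ 2) : 0 < phaseR Φ p := by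
  have hn : 0 < ‖p.2.2‖ := norm_pos_iff.2 hp
  have h1 : phaseR Φ p = ‖p.2.2‖ ^ 2 *
      (∑ k, (‖p.2.2‖⁻¹ * fderiv ℝ Φ p (dir (.inr (.inl k)))) ^ 2 +
        ∑ l, (fderiv ℝ Φ p (dir (.inr (.inr l)))) ^ 2) := by
    rw [phaseR, mul_add, Finset.mul_sum, Finset.mul_sum, add_comm]
    congr 1
    refine Finset.sum_congr rfl fun k _ => ?_
    field_simp
  rw [h1]
  exact mul_pos (by positivity) (hα.trans_le h)

theorem isPhase_of_mem_Malpha (hα : 0 < α) (Φ : Malpha X Y N α) : IsPhase X Y Φ.1 where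
  contDiffOn := Φ.1.1.2.1
  homogeneous x hx y hy ξ hξ t ht := by
    rw [Real.rpow_one]
    exact Φ.1.2 x hx y hy ξ hξ t ht
  phaseR_pos p hp := phaseR_pos_of_le hα hp.2.2 (Φ.2 p.1 hp.1 p.2.1 hp.2.1 p.2.2 hp.2.2).2

theorem isPhase_swap_of_mem_Malpha (hα : 0 < α) (Φ : Malpha X Y N α) :
    IsPhase Y X (fun p => Φ.1 (swapXY nX nY N p)) where
  contDiffOn := Φ.1.1.2.1.comp (swapXY nX nY N).contDiff.contDiffOn
    fun p hp => ⟨hp.2.1, hp.1, hp.2.2⟩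
  homogeneous y hy x hx ξ hξ t ht := by
    rw [Real.rpow_one]
    exact Φ.1.2 x hx y hy ξ hξ t ht
  phaseR_pos p hp := by
    have hp' : swapXY nX nY N p ∈ dom X Y N := ⟨hp.2.1, hp.1, hp.2.2⟩
    have hd : fderiv ℝ (fun p => Φ.1 (swapXY nX nY N p)) p =
        (fderiv ℝ Φ.1 (swapXY nX nY N p)).comp (swapXY nX nY N) :=
      ((differentiableAt_of_contDiffOn Φ.1.1.2.1 (dom X Y N).isOpen hp').hasFDerivAt.comp p
        (swapXY nX nY N).hasFDerivAt).fderiv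
    refine phaseR_pos_of_le hα hp.2.2 ?_
    rw [hd]
    exact (Φ.2 p.2.1 hp.2.1 p.1 hp.1 p.2.2 hp.2.2).1

theorem symb_swap_of_mem_amplitude {d ρ δ : ℝ} (a : Amplitude X Y N d ρ δ) (n : ℕ) :
    Symb Y X (punctured N) dir (stdWeight ρ δ) n d
      (fun _ : Unit => fun p => a (swapXY nX nY N p)) := by
  refine (symb_of_mem_amplitude (I := Unit) a n).swap (fun j => match j with
    | .inl i => .inr (.inl i)
    | .inr (.inl i) => .inl i
    | .inr (.inr i) => .inr (.inr i)) ?_ ?_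
  · rintro (j | j | j) <;> rfl
  · rintro (j | j | j) <;> rfl

end Malpha


/-! ### Separability of 𝓓_K -/

section TestFunctions

variable {n : ℕ}

instance finiteDimensional_continuousMultilinearMap (i : ℕ) :
    FiniteDimensional ℝ ((Euc n) [×i]→L[ℝ] ℂ) :=
  FiniteDimensional.of_injective
    (ContinuousMultilinearMap.toMultilinearMapLinear :
      _ →ₗ[ℝ] MultilinearMap ℝ (fun _ : Fin i => Euc n) ℂ)
    ContinuousMultilinearMap.toMultilinearMap_injective

/-- The i-th derivative restricted to K lies in a space of continuous functions from a compact
metric space to a finite-dimensional space, which is separable; derivatives off K contribute nothing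
to the seminorms. -/
theorem exists_countable_dense_contDiffMapSupportedIn (K : Compacts (Euc n)) :
    ∃ D : Set 𝓓_{K}(Euc n, ℂ), D.Countable ∧ ∀ (s : Finset ℕ) v, ∀ ε > 0, ∃ d ∈ D,
      s.sup (ContDiffMapSupportedIn.seminorm ℂ (Euc n) ℂ ⊤ K) (v - d) < ε := by
  have (i : ℕ) : ProperSpace ((Euc n) [×i]→L[ℝ] ℂ) := FiniteDimensional.proper ℝ _
  have hc (i : ℕ) (f : 𝓓_{K}(Euc n, ℂ)) : Continuous (iteratedFDeriv ℝ i f) :=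
    f.contDiff.continuous_iteratedFDeriv (by exact_mod_cast le_top)
  let r (i : ℕ) (f : 𝓓_{K}(Euc n, ℂ)) : C(K, (Euc n) [×i]→L[ℝ] ℂ) :=
    ⟨fun x => iteratedFDeriv ℝ i f x, (hc i f).comp continuous_subtype_val⟩
  refine exists_countable_seminorm_lt _ r fun i f g => ?_
  refine (ContDiffMapSupportedIn.seminorm_top_le_iff ℂ dist_nonneg i (f - g)).2 fun x hx => ?_
  have h1 : iteratedFDeriv ℝ i (f - g : 𝓓_{K}(Euc n, ℂ)) x =
      iteratedFDeriv ℝ i f x - iteratedFDeriv ℝ i g x :=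
    iteratedFDeriv_sub_apply (f.contDiff.contDiffAt.of_le (by exact_mod_cast le_top))
      (g.contDiff.contDiffAt.of_le (by exact_mod_cast le_top))
  rw [h1, ← dist_eq_norm]
  exact ContinuousMap.dist_apply_le_dist (f := r i f) (g := r i g) ⟨x, hx⟩

/-- The distance to the complement attains its minimum on K, so an index that works for the
minimizer and for the norm bound works for all of K. -/
theorem exists_subset_exhaustion {X : Opens (Euc n)} {K : Set (Euc n)} (hK : IsCompact K)
    (hKX : K ⊆ X) : ∃ m, K ⊆ exhaustion X m := by
  rcases K.eq_empty_or_nonempty with rfl | hne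
  · exact ⟨0, empty_subset _⟩
  obtain ⟨x₀, hx₀, hmin⟩ := hK.exists_isMinOn hne
    (Metric.continuous_infEDist (s := (X : Set (Euc n))ᶜ)).continuousOn
  obtain ⟨R, hR⟩ := hK.isBounded.exists_norm_le
  obtain ⟨m, hm, hmR⟩ := ((eventually_mem_exhaustion (hKX hx₀)).and
    (eventually_ge_atTop ⌈R⌉₊)).exists
  exact ⟨m, fun x hx => ⟨hKX hx, (hR x hx).trans ((Nat.le_ceil R).trans (by exact_mod_cast hmR)),
    hm.2.2.trans (hmin hx)⟩⟩

end TestFunctions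

/-! ### Borel measurability for the weak-∗ topology of 𝓓' -/

section WeakMeasurability

/-- Substitute for second countability. For fixed i, all admissible open sets O are merged into
their union, which is again open, so that every open U is a countable union of the sets `A i ∩ R i
⁻¹' O i`. -/
theorem measurable_of_countable_local_base {Ω T ι : Type*} [MeasurableSpace Ω] [TopologicalSpace T]
    [MeasurableSpace T] [BorelSpace T] [Countable ι] {W : ι → Type*} [∀ i, TopologicalSpace (W i)]
    [∀ i, MeasurableSpace (W i)] [∀ i, OpensMeasurableSpace (W i)] (A : ι → Set T)
    (R : ∀ i, T → W i)
    (hAR : ∀ U : Set T, IsOpen U → ∀ S ∈ U, ∃ i, S ∈ A i ∧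
      ∃ O : Set (W i), IsOpen O ∧ R i S ∈ O ∧ A i ∩ R i ⁻¹' O ⊆ U)
    {G : Ω → T} (hA : ∀ i, MeasurableSet (G ⁻¹' A i)) (hR : ∀ i, Measurable fun o => R i (G o)) :
    Measurable G := by
  refine measurable_of_isOpen fun U hU => ?_
  let O (i : ι) : Set (W i) := ⋃₀ {O | IsOpen O ∧ A i ∩ R i ⁻¹' O ⊆ U}
  have hO (i : ι) : IsOpen (O i) := isOpen_sUnion fun _ h => h.1
  have h1 : G ⁻¹' U = ⋃ i, G ⁻¹' A i ∩ (fun o => R i (G o)) ⁻¹' O i := by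
    ext o
    simp only [mem_iUnion, mem_inter_iff, mem_preimage]
    constructor
    · intro ho
      obtain ⟨i, hi, V, hV, hSV, hVU⟩ := hAR U hU (G o) ho
      exact ⟨i, hi, V, ⟨hV, hVU⟩, hSV⟩
    · rintro ⟨i, hi, V, ⟨-, hVU⟩, hSV⟩
      exact hVU ⟨hi, hSV⟩
  rw [h1]
  exact MeasurableSet.iUnion fun i => (hA i).inter (hR i (hO i).measurableSet)

variable {n : ℕ} {X : Opens (Euc n)}

theorem WeakDistribution.continuous_comp_ofSupportedIn (S : WeakDistribution X)
    {K : Compacts (Euc n)} (hK : (K : Set (Euc n)) ⊆ X) :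
    Continuous fun θ : 𝓓_{K}(Euc n, ℂ) => S (TestFunction.ofSupportedIn hK θ) :=
  (show 𝓓(X, ℂ) →L[ℂ] ℂ from S).continuous.comp (TestFunction.continuous_ofSupportedIn hK)

theorem WeakDistribution.map_sub (S : WeakDistribution X) (φ θ : 𝓓(X, ℂ)) :
    S (φ - θ) = S φ - S θ :=
  _root_.map_sub (show 𝓓(X, ℂ) →L[ℂ] ℂ from S) φ θ

/-- A single integer bounds both the constant and the order, so that countably many conditions
exhaust all distributions. -/
theorem WeakDistribution.exists_le_seminorm (S : WeakDistribution X) {K : Compacts (Euc n)}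
    (hK : (K : Set (Euc n)) ⊆ X) : ∃ j : ℕ, ∀ θ : 𝓓_{K}(Euc n, ℂ),
      ‖S (TestFunction.ofSupportedIn hK θ)‖ ≤
        j * (Finset.Iic j).sup (ContDiffMapSupportedIn.seminorm ℂ (Euc n) ℂ ⊤ K) θ := by
  have hp := ContDiffMapSupportedIn.withSeminorms ℂ (Euc n) ℂ ⊤ K
  let L : 𝓓_{K}(Euc n, ℂ) →ₗ[ℂ] ℂ := (show 𝓓(X, ℂ) →L[ℂ] ℂ from S).toLinearMap.comp
    (TestFunction.ofSupportedInCLM ℂ hK).toLinearMap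
  have hL : Continuous ((normSeminorm ℂ ℂ).comp L) :=
    (S.continuous_comp_ofSupportedIn hK).norm
  obtain ⟨s, C, -, hC⟩ := Seminorm.bound_of_continuous hp _ hL
  obtain ⟨j₁, hj₁⟩ := s.bddAbove
  refine ⟨max j₁ ⌈C⌉₊, fun θ => (hC θ).trans ?_⟩
  have h1 : s.sup (ContDiffMapSupportedIn.seminorm ℂ (Euc n) ℂ ⊤ K) ≤
      (Finset.Iic (max j₁ ⌈C⌉₊)).sup (ContDiffMapSupportedIn.seminorm ℂ (Euc n) ℂ ⊤ K) :=
    Finset.sup_mono fun i hi => Finset.mem_Iic.2 ((hj₁ hi).trans (le_max_left _ _))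
  have h2 : (C : ℝ) ≤ ((max j₁ ⌈C⌉₊ : ℕ) : ℝ) :=
    (Nat.le_ceil (C : ℝ)).trans (by exact_mod_cast le_max_right _ _)
  exact mul_le_mul h2 (h1 θ) (apply_nonneg _ _) (Nat.cast_nonneg _)

/-- The set `A (m, j)` imposes a common continuity bound on 𝓓_{K_m}, tested on a countable dense set
only. There, pairing with any φ supported in K_m is a uniform limit of pairings with elements of
this set, so the countably many latter pairings determine the neighbourhoods that are needed. -/
theorem WeakDistribution.measurable_of_apply {Ω : Type*} [MeasurableSpace Ω]
    {G : Ω → WeakDistribution X} (hG : ∀ φ : 𝓓(X, ℂ), Measurable fun o => G o φ) :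
    Measurable G := by
  let K (m : ℕ) : Compacts (Euc n) := ⟨exhaustion X m, isCompact_exhaustion X m⟩
  have hK (m : ℕ) : (K m : Set (Euc n)) ⊆ X := fun x hx => hx.1
  choose D hD hd using fun m => exists_countable_dense_contDiffMapSupportedIn (K m)
  have (m : ℕ) : Countable (D m) := (hD m).to_subtype
  let q (m j : ℕ) : Seminorm ℂ 𝓓_{K m}(Euc n, ℂ) :=
    (Finset.Iic j).sup (ContDiffMapSupportedIn.seminorm ℂ (Euc n) ℂ ⊤ (K m))
  let A (i : ℕ × ℕ) : Set (WeakDistribution X) := {S | ∀ θ ∈ D i.1,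
    ‖S (TestFunction.ofSupportedIn (hK i.1) θ)‖ ≤ i.2 * q i.1 i.2 θ}
  have hq (m j : ℕ) : Continuous (q m j) :=
    Seminorm.continuous_finsetSup fun i _ =>
      (ContDiffMapSupportedIn.withSeminorms ℂ (Euc n) ℂ ⊤ (K m)).continuous_seminorm i
  have hdense (m : ℕ) : Dense (D m) := fun v => by
    have hp := ContDiffMapSupportedIn.withSeminorms ℂ (Euc n) ℂ ⊤ (K m)
    rw [mem_closure_iff]
    intro U hU hv
    obtain ⟨s, r, hr, hs⟩ := (hp.isOpen_iff_mem_balls U).1 hU v hv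
    obtain ⟨d, hdD, hdv⟩ := hd m s v r hr
    exact ⟨d, hs (by rwa [Seminorm.mem_ball, map_sub_rev]), hdD⟩
  have hA (i : ℕ × ℕ) {S : WeakDistribution X} (hS : S ∈ A i) (θ : 𝓓_{K i.1}(Euc n, ℂ)) :
      ‖S (TestFunction.ofSupportedIn (hK i.1) θ)‖ ≤ i.2 * q i.1 i.2 θ :=
    (isClosed_le (S.continuous_comp_ofSupportedIn (hK i.1)).norm
      ((hq i.1 i.2).const_mul _)).closure_subset_iff.2 hS (hdense i.1 θ)
  refine measurable_of_countable_local_base (W := fun i : ℕ × ℕ => D i.1 → ℂ) A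
    (fun i S θ => S (TestFunction.ofSupportedIn (hK i.1) θ.1)) ?_ (fun i => ?_) (fun i => ?_)
  · intro U hU S hSU
    obtain ⟨V, hV, rfl⟩ := isOpen_induced_iff.1 hU
    obtain ⟨s, u, hu, hsu⟩ := isOpen_pi_iff.1 hV _ hSU
    choose! ε hε hεu using fun φ hφ => Metric.isOpen_iff.1 (hu φ hφ).1 _ (hu φ hφ).2
    obtain ⟨m, hm⟩ := exists_subset_exhaustion (X := X)
      (s.isCompact_biUnion fun φ _ => φ.hasCompactSupport)
      (iUnion₂_subset fun φ _ => φ.tsupport_subset)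
    obtain ⟨j, hj⟩ := S.exists_le_seminorm (hK m)
    have hφ (φ : 𝓓(X, ℂ)) (h : φ ∈ s) :
        ∃ θ : 𝓓_{K m}(Euc n, ℂ), TestFunction.ofSupportedIn (hK m) θ = φ :=
      ⟨.of_support_subset φ.contDiff (subset_closure.trans
        ((subset_biUnion_of_mem (u := fun φ : 𝓓(X, ℂ) => tsupport φ) h).trans hm)), rfl⟩
    choose! φ' hφ' using hφ
    -- The factor j + 1 absorbs the constant j of the continuity bound and is nonzero even for j =
    -- 0.
    have hθ (φ : 𝓓(X, ℂ)) (h : φ ∈ s) : ∃ θ ∈ D m, q m j (φ' φ - θ) < ε φ / (4 * (j + 1)) :=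
      hd m _ _ _ (div_pos (hε φ h) (by positivity))
    choose! θ hθD hθ using hθ
    refine ⟨(m, j), fun d _ => hj d, {z | ∀ φ : s, ‖z ⟨θ φ, hθD φ φ.2⟩ -
      S (TestFunction.ofSupportedIn (hK m) (θ φ))‖ < ε φ / 4}, ?_, ?_, ?_⟩
    · simp only [ofPred_forall]
      exact isOpen_iInter_of_finite fun φ =>
        isOpen_lt ((continuous_apply _).sub continuous_const).norm continuous_const
    · intro φ
      simpa using hε φ φ.2
    · rintro S' ⟨hS', hz⟩
      refine hsu fun φ hφ => hεu φ hφ ?_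
      -- Applied to both S' and S; with the closeness on θ this gives three errors of at most ε/4,
      -- in total less than ε.
      have hbound {T : WeakDistribution X} (hT : T ∈ A (m, j)) :
          ‖T φ - T (TestFunction.ofSupportedIn (hK m) (θ φ))‖ ≤ ε φ / 4 := by
        have h1 := hA (m, j) hT (φ' φ - θ φ)
        have h2 : T (TestFunction.ofSupportedIn (hK m) (φ' φ - θ φ)) =
            T φ - T (TestFunction.ofSupportedIn (hK m) (θ φ)) := by
          have h3 : TestFunction.ofSupportedIn (hK m) (φ' φ - θ φ) =
              TestFunction.ofSupportedIn (hK m) (φ' φ) - TestFunction.ofSupportedIn (hK m) (θ φ) :=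
            rfl
          rw [h3, hφ' φ hφ, T.map_sub]
        rw [h2] at h1
        have h3 := (lt_div_iff₀ (by positivity)).1 (hθ φ hφ)
        have h4 : 0 ≤ q m j (φ' φ - θ φ) := apply_nonneg _ _
        have h5 : ((m, j).2 : ℝ) * q (m, j).1 (m, j).2 (φ' φ - θ φ) = j * q m j (φ' φ - θ φ) := rfl
        rw [h5] at h1
        linarith
      have h1 := hbound hS'
      have h2 := hbound (T := S) (fun d _ => hj d)
      have h3 := hz ⟨φ, hφ⟩
      have h4 : S' φ - S φ = (S' φ - S' (TestFunction.ofSupportedIn (hK m) (θ φ))) +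
          (S' (TestFunction.ofSupportedIn (hK m) (θ φ)) -
            S (TestFunction.ofSupportedIn (hK m) (θ φ))) -
          (S φ - S (TestFunction.ofSupportedIn (hK m) (θ φ))) := by ring
      change dist (S' φ) (S φ) < ε φ
      rw [dist_eq_norm, h4]
      have h5 := norm_sub_le ((S' φ - S' (TestFunction.ofSupportedIn (hK m) (θ φ))) +
          (S' (TestFunction.ofSupportedIn (hK m) (θ φ)) -
            S (TestFunction.ofSupportedIn (hK m) (θ φ))))
          (S φ - S (TestFunction.ofSupportedIn (hK m) (θ φ)))
      have h6 := norm_add_le (S' φ - S' (TestFunction.ofSupportedIn (hK m) (θ φ)))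
          (S' (TestFunction.ofSupportedIn (hK m) (θ φ)) -
            S (TestFunction.ofSupportedIn (hK m) (θ φ)))
      have h7 := hε φ hφ
      simp only at h3
      linarith
  · have h1 : G ⁻¹' A i = ⋂ θ ∈ D i.1,
        {o | ‖G o (TestFunction.ofSupportedIn (hK i.1) θ)‖ ≤ i.2 * q i.1 i.2 θ} := by
      ext o
      simp [A]
    rw [h1]
    exact MeasurableSet.biInter (hD i.1) fun θ _ => measurableSet_le (hG _).norm measurable_const
  · exact measurable_pi_lambda _ fun θ => hG _

end WeakMeasurability

end SFIO

namespace SFIO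

/-! ### The adjoint on compactly supported distributions -/

section Transpose

variable {nX nY N : ℕ} {X : Opens (Euc nX)} {Y : Opens (Euc nY)}
  {χ : Euc N → ℂ} {Φ : Euc nX × Euc nY × Euc N → ℝ} {ρ δ d : ℝ} {a : Euc nX × Euc nY × Euc N → ℂ}

/-- The adjoint of the operator on test functions, applied to `u ∈ 𝓔'(X)`. -/
theorem exists_weakDistribution (h : IsPhase X Y Φ) (hχ : IsCutoff χ) (hρ : 0 < ρ) (hρ_le : ρ ≤ 1)
    (hδ : 0 ≤ δ) (hδ_lt : δ < 1)
    (ha : ∀ n, Symb X Y (punctured N) dir (stdWeight ρ δ) n d (fun _ : Unit => a))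
    (u : CompactDistribution X) {W : 𝓓(Y, ℂ) →ₗ[ℂ] CInfty X}
    (hW : ∀ ψ : 𝓓(Y, ℂ), ∀ x ∈ X, W ψ x = ((2 * Real.pi : ℝ) : ℂ)⁻¹ ^ N *
      oscValue χ Y Φ d ρ δ (fun p => a p * ψ p.2.1) x) :
    ∃ T : WeakDistribution Y, ∀ ψ, T ψ = u (W ψ) := by
  refine ⟨show 𝓓(Y, ℂ) →L[ℂ] ℂ from TestFunction.mkCLM ℂ (fun ψ => u (W ψ)) (fun f g => ?_)
    (fun c f => ?_) (fun K hK => ?_), fun ψ => rfl⟩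
  · rw [map_add, map_add]
  · rw [map_smul, map_smul]
  · exact u.continuous.comp
      (continuous_comp_ofSupportedIn h hχ hρ hρ_le hδ hδ_lt ha hW hK)

end Transpose

end SFIO

/-! ### The theorem -/

theorem mainTheorem1 {nX nY N : ℕ} (X : Opens (Euc nX)) (Y : Opens (Euc nY))
    {α d ρ δ : ℝ} (hα : 0 < α) (hρ : 0 < ρ) (hρ_le : ρ ≤ 1) (hδ : 0 ≤ δ) (hδ_lt : δ < 1)
    (χ : Euc N → ℂ) (hχ : IsCutoff χ)
    {Ω : Type*} [MeasurableSpace Ω]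
    (Φ : Ω → Malpha X Y N α) (hΦ : Measurable Φ)
    (a : Ω → Amplitude X Y N d ρ δ) (ha : Measurable a) :
    (∀ ψ : 𝓓(Y, ℂ), ∃ F : Ω → CInfty X,
      (∀ ω, IsFIO χ (Φ ω).1 (a ω) ψ (F ω)) ∧ Measurable F) ∧
    (∀ u : CompactDistribution Y, ∃ G : Ω → WeakDistribution X,
      (∀ ω, IsFIODistribution χ (Φ ω).1 (a ω) u (G ω)) ∧ Measurable G) := by
  have hΦm (p : Euc nX × Euc nY × Euc N) (hp : p ∈ box X Y (punctured N)) :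
      Measurable fun ω => (Φ ω).1 p :=
    (Mhg.continuous_apply X Y hp).measurable.comp (measurable_subtype_coe.comp hΦ)
  have ham (p : Euc nX × Euc nY × Euc N) (hp : p ∈ box X Y (punctured N)) :
      Measurable fun ω => a ω p :=
    (Amplitude.continuous_apply X Y hp).measurable.comp ha
  constructor
  · intro ψ
    have hψ := isBoundedFamily_of_hasCompactSupport ψ.contDiff ψ.hasCompactSupport
    choose W hW using fun ω => exists_linearMap_oscValue (isPhase_of_mem_Malpha hα (Φ ω)) hχ hρ
      hρ_le hδ hδ_lt (symb_of_mem_amplitude (I := Unit) (a ω))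
    refine ⟨fun ω => W ω ψ, fun ω => isFIO_of_eq_oscValue (isPhase_of_mem_Malpha hα (Φ ω)) hχ hρ
      hρ_le hδ hδ_lt (symb_of_mem_amplitude (I := Unit) (a ω)) (hW ω ψ),
      CInfty.measurable_of_apply X fun x hx => ?_⟩
    simp only [fun ω => hW ω ψ x hx]
    exact (measurable_oscValue (fun ω => isPhase_of_mem_Malpha hα (Φ ω)) hχ hΦm
      (fun ω => (symb_mul_isBoundedFamily hδ (symb_of_mem_amplitude (a ω)) hψ 0).contDiffOn ())
      (fun p hp => (ham p hp).mul_const _) d ρ δ hx).const_mul _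
  · intro u
    -- The transpose is the operator of the swapped phase and amplitude; here the first of the two
    -- lower bounds in the definition of 𝓜_α is used.
    choose W hW using fun ω => exists_linearMap_oscValue (isPhase_swap_of_mem_Malpha hα (Φ ω)) hχ
      hρ hρ_le hδ hδ_lt (symb_swap_of_mem_amplitude (a ω))
    choose G hG using fun ω => exists_weakDistribution (isPhase_swap_of_mem_Malpha hα (Φ ω)) hχ
      hρ hρ_le hδ hδ_lt (symb_swap_of_mem_amplitude (a ω)) u (hW ω)
    refine ⟨G, fun ω φ => ⟨W ω φ, isFIO_of_eq_oscValue (isPhase_swap_of_mem_Malpha hα (Φ ω)) hχ hρ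
      hρ_le hδ hδ_lt (symb_swap_of_mem_amplitude (a ω)) (hW ω φ), hG ω φ⟩,
      WeakDistribution.measurable_of_apply fun φ => ?_⟩
    have hφ := isBoundedFamily_of_hasCompactSupport φ.contDiff φ.hasCompactSupport
    have hmem (p : Euc nY × Euc nX × Euc N) (hp : p ∈ box Y X (punctured N)) :
        swapXY nX nY N p ∈ box X Y (punctured N) := ⟨hp.2.1, hp.1, hp.2.2⟩
    simp only [fun ω => hG ω φ]
    -- The pairing with φ is the continuous functional u applied to a Borel measurable map into
    -- C^∞(Y), so the first kind of measurability feeds the second.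
    refine u.continuous.measurable.comp (CInfty.measurable_of_apply Y fun y hy => ?_)
    simp only [fun ω => hW ω φ y hy]
    exact (measurable_oscValue (fun ω => isPhase_swap_of_mem_Malpha hα (Φ ω)) hχ
      (fun p hp => hΦm _ (hmem p hp))
      (fun ω => (symb_mul_isBoundedFamily hδ (symb_swap_of_mem_amplitude (a ω)) hφ 0).contDiffOn ())
      (fun p hp => (ham _ (hmem p hp)).mul_const _) d ρ δ hy).const_mul _
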